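/- Let $(M,g)$ be a connected smooth Riemannian manifold of dimension $n$ (Hausdorff, second countable) that is complete as a metric space, let $\mathrm{Vol}$ be its Riemannian volume measure, and let $\exp_x : T_xM \to M$ be the exponential map of the Levi-Civita connection. Let $\delta > 0$ and let $K \subseteq M$ be a measurable set. The geodesic walk in $K$ with step size $\delta$ is the time-homogeneous Markov chain with state space $K$ that, from $x \in K$, draws $u$ from the standard Gaussian distribution $N(0,I)$ on the Euclidean space $(T_xM, g_x)$ and moves to $\exp_x(\delta u)$ if $\exp_x(\delta u) \in K$, and stays at $x$ otherwise. Let $P_x$ be the distribution of the next state. (For $K = M$ this is the unrestricted walk.) 1. $(P_x)_{x\in K}$ is a Markov kernel on $K$ (each $P_x$ is a probability measure and $x \mapsto P_x(A)$ is measurable for every measurable $A \subseteq K$), and the geodesic walk is reversible with respect to the Riemannian volume: for all measurable $A, B \subseteq K$, $$\int_B P_x(A)\, d\mathrm{Vol}(x) = \int_A P_x(B)\, d\mathrm{Vol}(x).$$ 2. Suppose moreover that $0 < \mathrm{Vol}(K) < \infty$ and that $K$ is geodesically convex, i.e. any two points $p,q\in K$ are joined by a geodesic contained in $K$ that is, up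 to reparametrization, the unique length-minimizing curve in $M$ from $p$ to $q$. Then the stationary distribution of the geodesic walk in $K$ is the uniform distribution on $K$: the probability measure $\pi(A) = \mathrm{Vol}(A)/\mathrm{Vol}(K)$ satisfies $\int_K P_x(A)\, d\pi(x) = \pi(A)$ for every measurable $A \subseteq K$, and it is the only probability measure on $K$ with this property. -/

import Mathlib

open MeasureTheory ProbabilityTheory Set Bundle Manifold
open scoped ContDiff ENNReal Manifold

noncomputable section

namespace GeodesicWalk

variable {n : ℕ} {M : Type*} [TopologicalSpace M] [ChartedSpace (EuclideanSpace ℝ (Fin n)) M]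

/-- Tangent spaces carry their Borel σ-algebra. -/
instance instMeasurableSpaceTangentSpace (x : M) : MeasurableSpace (TangentSpace (𝓡 n) x) :=
  borel _

instance instBorelSpaceTangentSpace (x : M) : BorelSpace (TangentSpace (𝓡 n) x) :=
  ⟨rfl⟩

instance instFiniteDimensionalTangentSpace (x : M) :
    FiniteDimensional ℝ (TangentSpace (𝓡 n) x) :=
  inferInstanceAs (FiniteDimensional ℝ (EuclideanSpace ℝ (Fin n)))

/-- The `i`-th coordinate vector field `∂ᵢ` of the chart centred at `x₀`, at the point with
coordinates `y`. -/
def coordField (x₀ : M) (i : Fin n) (y : EuclideanSpace ℝ (Fin n)) :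
    TangentSpace (𝓡 n) ((extChartAt (𝓡 n) x₀).symm y) :=
  mfderiv 𝓘(ℝ, EuclideanSpace ℝ (Fin n)) (𝓡 n) (extChartAt (𝓡 n) x₀).symm y
    (EuclideanSpace.single i (1 : ℝ) : EuclideanSpace ℝ (Fin n))

/-- The velocity of a curve `γ` at time `t`, as a point of the tangent bundle. -/
def velocity (γ : ℝ → M) (t : ℝ) : TangentBundle (𝓡 n) M :=
  ⟨γ t, mfderiv 𝓘(ℝ, ℝ) (𝓡 n) γ t 1⟩

theorem exists_chartCenter (n : ℕ) (M : Type*) [TopologicalSpace M]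
    [ChartedSpace (EuclideanSpace ℝ (Fin n)) M] [SecondCountableTopology M] [Nonempty M] :
    ∃ c : ℕ → M, ⋃ i, (chartAt (EuclideanSpace ℝ (Fin n)) (c i)).source = univ := by
  obtain ⟨s, hs, hU⟩ := TopologicalSpace.countable_cover_nhds
    (fun x : M ↦ chart_source_mem_nhds (EuclideanSpace ℝ (Fin n)) x)
  have hne : s.Nonempty := by
    by_contra h
    rw [not_nonempty_iff_eq_empty] at h
    subst h
    exact empty_ne_univ (by simpa using hU)
  obtain ⟨c, rfl⟩ := hs.exists_eq_range hne
  exact ⟨c, by simpa using hU⟩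

/-- A sequence of points whose charts cover `M`. -/
def chartCenter (n : ℕ) (M : Type*) [TopologicalSpace M]
    [ChartedSpace (EuclideanSpace ℝ (Fin n)) M] [SecondCountableTopology M] [Nonempty M] :
    ℕ → M :=
  (exists_chartCenter n M).choose

variable [RiemannianBundle (fun x : M ↦ TangentSpace (𝓡 n) x)]

/-- The matrix `g_{ij}` of the metric in the chart centred at `x₀`, as a function of the
coordinates `y`. -/
def metricMatrix (x₀ : M) (y : EuclideanSpace ℝ (Fin n)) : Matrix (Fin n) (Fin n) ℝ :=
  Matrix.of fun i j ↦ inner ℝ (coordField x₀ i y) (coordField x₀ j y)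

/-- `∂_l g_{ij}` in the chart centred at `x₀`. -/
def metricDeriv (x₀ : M) (l i j : Fin n) (y : EuclideanSpace ℝ (Fin n)) : ℝ :=
  fderiv ℝ (fun z ↦ metricMatrix x₀ z i j) y (EuclideanSpace.single l (1 : ℝ))

/-- The Christoffel symbols of the Levi-Civita connection in the chart centred at `x₀`:
`Γᵏᵢⱼ = ½ ∑ₗ gᵏˡ (∂ᵢ gⱼₗ + ∂ⱼ gᵢₗ - ∂ₗ gᵢⱼ)`. -/
def christoffel (x₀ : M) (k i j : Fin n) (y : EuclideanSpace ℝ (Fin n)) : ℝ :=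
  (1 / 2 : ℝ) * ∑ l, (metricMatrix x₀ y)⁻¹ k l *
    (metricDeriv x₀ i j l y + metricDeriv x₀ j i l y - metricDeriv x₀ l i j y)

/-- A geodesic `γ : ℝ → M`: a smooth curve with `∇_{γ'} γ' = 0` for the Levi-Civita connection,
written in coordinates: `c̈ᵏ + ∑ᵢⱼ Γᵏᵢⱼ(c) ċⁱ ċʲ = 0` for the local representation `c` of `γ` in
every chart `chartAt _ x₀` around `γ t`. -/
def IsGeodesic (γ : ℝ → M) : Prop :=
  ContMDiff 𝓘(ℝ, ℝ) (𝓡 n) ∞ γ ∧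
    ∀ (t : ℝ) (x₀ : M), γ t ∈ (extChartAt (𝓡 n) x₀).source → ∀ k : Fin n,
      deriv (deriv fun s ↦ extChartAt (𝓡 n) x₀ (γ s) k) t +
        ∑ i, ∑ j, christoffel x₀ k i j (extChartAt (𝓡 n) x₀ (γ t)) *
          deriv (fun s ↦ extChartAt (𝓡 n) x₀ (γ s) i) t *
          deriv (fun s ↦ extChartAt (𝓡 n) x₀ (γ s) j) t = 0

open Classical in
/-- The exponential map `exp_x v = γ(1)`, where `γ` is the geodesic with `γ(0) = x`, `γ'(0) = v`.
Such a `γ : ℝ → M` exists (and is unique) for all `x` and `v` when `M` is complete; the value `x`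
in the other case is a dummy. -/
def expMap (x : M) (v : TangentSpace (𝓡 n) x) : M :=
  if h : ∃ γ : ℝ → M, IsGeodesic (n := n) γ ∧ velocity γ 0 = (⟨x, v⟩ : TangentBundle (𝓡 n) M) then
    h.choose 1
  else x

/-- `γ`, restricted to `[0, 1]`, is a curve of minimal length in `M` from `p` to `q`. -/
def IsLengthMinimizer (p q : M) (γ : ℝ → M) : Prop :=
  ContMDiffOn 𝓘(ℝ, ℝ) (𝓡 n) 1 γ (Icc 0 1) ∧ γ 0 = p ∧ γ 1 = q ∧
    ∀ σ : ℝ → M, ContMDiffOn 𝓘(ℝ, ℝ) (𝓡 n) 1 σ (Icc 0 1) → σ 0 = p → σ 1 = q →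
      pathELength (𝓡 n) γ 0 1 ≤ pathELength (𝓡 n) σ 0 1

variable (n) in
/-- Geodesically convex sets of a complete manifold: any two points of `A` are joined by a geodesic
segment contained in `A` that is, up to reparametrization, the unique length minimizer in `M`
between them. -/
def GeodesicallyConvex (A : Set M) : Prop :=
  ∀ p ∈ A, ∀ q ∈ A, ∃ γ : ℝ → M, IsGeodesic (n := n) γ ∧ IsLengthMinimizer (n := n) p q γ ∧
    γ '' Icc 0 1 ⊆ A ∧
    ∀ σ : ℝ → M, IsLengthMinimizer (n := n) p q σ → σ '' Icc 0 1 = γ '' Icc 0 1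

variable [MeasurableSpace M]

/-- The measure `√(det g) dx¹ ⋯ dxⁿ` on the domain of the chart centred at `x₀`, as a measure
on `M`. -/
def chartVolume (x₀ : M) : Measure M :=
  (((volume : Measure (EuclideanSpace ℝ (Fin n))).restrict
      (extChartAt (𝓡 n) x₀).target).withDensity
    fun y ↦ ENNReal.ofReal (Real.sqrt (metricMatrix x₀ y).det)).map (extChartAt (𝓡 n) x₀).symm

variable (n) in
/-- The Riemannian volume: `√(det g) dx¹ ⋯ dxⁿ` in each chart. The local expressions agree on
overlaps of charts; they are glued along a countable partition of `M` into pieces of charts. -/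
def riemannianVolume [SecondCountableTopology M] [Nonempty M] : Measure M :=
  Measure.sum fun i : ℕ ↦ (chartVolume (n := n) (chartCenter n M i)).restrict
    (disjointed (fun j ↦ (chartAt (EuclideanSpace ℝ (Fin n)) (chartCenter n M j)).source) i)

variable (n) in
/-- The uniform distribution on `K` (for `0 < Vol(K) < ∞`), as a measure on the subtype `K`. -/
def uniformDistribution [SecondCountableTopology M] [Nonempty M] (K : Set M) : Measure K :=
  (riemannianVolume n K)⁻¹ • (riemannianVolume n).comap Subtype.val

/-- The standard Gaussian `N(0, I)` on the Euclidean space `(T_x M, g_x)`. -/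
def tangentGaussian (x : M) : Measure (TangentSpace (𝓡 n) x) :=
  stdGaussian (TangentSpace (𝓡 n) x)

open Classical in
/-- One update of the walk in `K` with step size `δ`: from `x`, with sampled direction `u`, move to
`exp_x (δ u)` if this point lies in `K`, and stay at `x` otherwise. -/
def walkUpdate (δ : ℝ) (K : Set M) (x : K) (u : TangentSpace (𝓡 n) (x : M)) : K :=
  if h : expMap (x : M) (δ • u) ∈ K then ⟨expMap (x : M) (δ • u), h⟩ else x

variable (n) in
/-- The one-step distribution `P_x` of the geodesic walk in `K` with step size `δ`: the law of the
update from `x` when `u` is drawn from `N(0, I)` in `T_x M`. For `K = M` this is the unrestricted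
geodesic walk. -/
def oneStep (δ : ℝ) (K : Set M) (x : K) : Measure K :=
  (tangentGaussian (n := n) (x : M)).map (walkUpdate δ K x)

end GeodesicWalk

end

open MeasureTheory ProbabilityTheory Set Bundle Manifold
open scoped ContDiff ENNReal Manifold
open Filter Topology Metric

/-! The walk is the shadow on `M` of a deterministic motion of positions and velocities: `exp_x (δ
u)` is the base point, at time `δ`, of the geodesic flow on the tangent bundle started at `(x, u)`.
Reversibility comes from two symmetries of the measure `m(dx, du) = Vol(dx) N(0, I)(du)` on the
tangent bundle.

In the coordinates `(y, v)` of a chart, `m` has density `c · det g(y) · exp (-g(v, v) / 2)`: one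
factor `√(det g)` comes from the volume, the other from the Gaussian written in coordinates that are
not orthonormal. The exponential is constant along the flow, because geodesics have constant speed.
The divergence of the geodesic field is `-tr (g⁻¹ D_v g)`, which cancels the logarithmic derivative
of `det g` along the field. So the continuity equation holds, and Liouville's theorem
(`FieldAtlas.measurePreserving_flow`) shows that the flow preserves `m`. Reversing velocities
preserves `m` since Gaussians are symmetric. The flow followed by this reversal is an involution
that exchanges "start in `A`, end in `B`" with "start in `B`, end in `A`"; this is detailed balance
for the unrestricted walk (`lintegral_fibreGaussian_symm`). Rejected moves contribute an integral
over `A ∩ B`, which is symmetric in `A` and `B`.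

The flow exists for all times (`complete_geodesicAtlas`): on a bounded time interval constant speed
makes the base curve Lipschitz, so by metric completeness it stays in a compact set, over which
vectors of bounded length have a uniform lifetime.

Invariance of the uniform distribution follows from reversibility; convexity serves only for
uniqueness. It makes `exp_x` reach all of `K`. If `P_x N = 0`, the set of velocities leading into
`N` is null for the Gaussian, hence for Lebesgue measure, and its image under a differentiable map
between spaces of equal dimension is null; hence `Vol` on `K` is absolutely continuous with respect
to every `P_x`. For two invariant probability measures, their minimum is again invariant, and so are
the two mutually singular remainders. If both remainders were non-zero, both would dominate `Vol` on
`K`, which would then vanish. -/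

noncomputable section

/-! ### Derivatives of determinants -/

section Determinant

theorem differentiable_matrix_det {ι : Type*} [Fintype ι] [DecidableEq ι] :
    Differentiable ℝ (fun A : ι → ι → ℝ ↦ (Matrix.of A).det) := by
  simp only [Matrix.det_apply, Matrix.of_apply]
  fun_prop

/-- The Jacobi formula along a curve of matrices with derivative `A M`. -/
theorem hasDerivAt_matrix_det {ι : Type*} [Fintype ι] [DecidableEq ι] {M : ℝ → Matrix ι ι ℝ}
    {A : Matrix ι ι ℝ} {t : ℝ} (hM : ∀ i j, HasDerivAt (fun s ↦ M s i j) ((A * M t) i j) t) :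
    HasDerivAt (fun s ↦ (M s).det) (A.trace * (M t).det) t := by
  set D : (ι → ι → ℝ) → ℝ := fun A ↦ (Matrix.of A).det
  let m : ι → ι → ℝ := M t
  let B : ι → ι → ℝ := A * M t
  have hD : HasFDerivAt D (fderiv ℝ D m) m := (differentiable_matrix_det _).hasFDerivAt
  let N : ℝ → ι → ι → ℝ := fun s i j ↦ M s i j
  have hMt : HasDerivAt N B t :=
    hasDerivAt_pi.2 fun i ↦ hasDerivAt_pi.2 fun j ↦ hM i j
  have h1 : HasDerivAt (fun s ↦ (M s).det) (fderiv ℝ D m B) t :=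
    HasFDerivAt.comp_hasDerivAt (l := D) (f := N) t hD hMt
  -- By the chain rule only the velocity of the curve matters, so it may be replaced by a line.
  -- Along the line the determinant is `det (1 + r A) · det (M t)`, a polynomial in `r` with linear
  -- coefficient `tr A · det (M t)`.
  have hline : HasDerivAt (fun r : ℝ ↦ m + r • B) B 0 := by
    simpa using! ((hasDerivAt_id (0 : ℝ)).smul_const B).const_add m
  have h2 : HasDerivAt (fun r : ℝ ↦ D (m + r • B)) (fderiv ℝ D m B) 0 := by
    refine HasFDerivAt.comp_hasDerivAt (l := D) (0 : ℝ) ?_ hline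
    simpa using hD
  have h3 : (fun r : ℝ ↦ D (m + r • B)) =
      fun r ↦ (1 + A.trace * r + Polynomial.eval r
        (1 + (Polynomial.X : Polynomial ℝ) • A.map Polynomial.C).det.divX.divX * r ^ 2)
          * (M t).det := by
    funext r
    rw [← Matrix.det_one_add_smul, ← Matrix.det_mul, add_mul, one_mul, Matrix.smul_mul]
    rfl
  have h4 : HasDerivAt (fun r : ℝ ↦ (1 + A.trace * r + Polynomial.eval r
        (1 + (Polynomial.X : Polynomial ℝ) • A.map Polynomial.C).det.divX.divX * r ^ 2)
          * (M t).det) (A.trace * (M t).det) 0 := by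
    set q := (1 + (Polynomial.X : Polynomial ℝ) • A.map Polynomial.C).det.divX.divX
    have := ((((hasDerivAt_id (0 : ℝ)).const_mul A.trace).const_add 1).add
      ((q.hasDerivAt 0).mul ((hasDerivAt_id (0 : ℝ)).pow 2))).mul_const (M t).det
    simpa using! this
  rw [h3] at h2
  rw [h4.unique h2]
  exact h1

/-- The Liouville formula: if `Y` has derivative `A Y` then `det Y` has derivative `tr A · det Y`. -/
theorem hasDerivAt_det_clm {V : Type*} [NormedAddCommGroup V] [NormedSpace ℝ V]
    [FiniteDimensional ℝ V] {Y : ℝ → V →L[ℝ] V} {A : V →L[ℝ] V} {t : ℝ}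
    (hY : HasDerivAt Y (A ∘L Y t) t) :
    HasDerivAt (fun s ↦ (Y s).det) (LinearMap.trace ℝ V A * (Y t).det) t := by
  set b := Module.finBasis ℝ V
  have hdet : ∀ L : V →L[ℝ] V, L.det = (LinearMap.toMatrix b b (L : V →ₗ[ℝ] V)).det := fun L ↦ by
    rw [LinearMap.det_toMatrix]
  simp only [hdet]
  rw [LinearMap.trace_eq_matrix_trace ℝ b]
  apply hasDerivAt_matrix_det
  intro i j
  rw [← LinearMap.toMatrix_comp, ← ContinuousLinearMap.toLinearMap_comp]
  simp only [LinearMap.toMatrix_apply, ContinuousLinearMap.coe_coe]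
  have h1 : HasDerivAt (fun s ↦ Y s (b j)) ((A ∘L Y t) (b j)) t := by
    simpa using hY.clm_apply (hasDerivAt_const t (b j))
  exact (LinearMap.toContinuousLinearMap (b.coord i)).hasFDerivAt.comp_hasDerivAt t h1

end Determinant

/-! ### Local flows and their dependence on the initial condition -/

section LocalFlow

variable {V : Type*} [NormedAddCommGroup V] [NormedSpace ℝ V]

/-- Grönwall's inequality forwards in time, and for negative times the same inequality applied to `s
↦ e (-s)`. -/
theorem norm_le_gronwallBound_two_sided {e e' : ℝ → V} {K c ε : ℝ}
    (he : ∀ t ∈ Ioo (-ε) ε, HasDerivAt e (e' t) t) (h0 : e 0 = 0)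
    (hb : ∀ t ∈ Ioo (-ε) ε, ‖e' t‖ ≤ K * ‖e t‖ + c) {t : ℝ} (ht : t ∈ Ioo (-ε) ε) :
    ‖e t‖ ≤ gronwallBound 0 K c |t| := by
  rcases le_total 0 t with h | h
  · rw [abs_of_nonneg h]
    have hs : Icc 0 t ⊆ Ioo (-ε) ε := fun s hs ↦ ⟨by linarith [hs.1, ht.2], hs.2.trans_lt ht.2⟩
    simpa using norm_le_gronwallBound_of_norm_deriv_right_le (a := 0) (b := t) (δ := 0)
      (fun s hs' ↦ (he s (hs hs')).continuousAt.continuousWithinAt)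
      (fun s hs' ↦ (he s (hs ⟨hs'.1, hs'.2.le⟩)).hasDerivWithinAt) (by simp [h0])
      (fun s hs' ↦ hb s (hs ⟨hs'.1, hs'.2.le⟩)) t ⟨h, le_rfl⟩
  · rw [abs_of_nonpos h]
    have hs : ∀ s ∈ Icc 0 (-t), -s ∈ Ioo (-ε) ε := fun s hs ↦
      ⟨by linarith [hs.2, ht.1], by linarith [hs.1, ht.1]⟩
    have hd : ∀ s ∈ Icc 0 (-t), HasDerivAt (fun s ↦ e (-s)) (-e' (-s)) s := fun s hs' ↦ by
      simpa using! (he (-s) (hs s hs')).scomp s (hasDerivAt_neg s)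
    simpa using norm_le_gronwallBound_of_norm_deriv_right_le (a := 0) (b := -t) (δ := 0)
      (f := fun s ↦ e (-s)) (f' := fun s ↦ -e' (-s))
      (fun s hs' ↦ (hd s hs').continuousAt.continuousWithinAt)
      (fun s hs' ↦ (hd s ⟨hs'.1, hs'.2.le⟩).hasDerivWithinAt) (by simp [h0])
      (fun s hs' ↦ by simpa using hb (-s) (hs s ⟨hs'.1, hs'.2.le⟩)) (-t)
      ⟨by linarith, le_rfl⟩

/-- The local flow of a `C²` vector field exists and is differentiable in the initial condition;
its derivative solves the linearised equation. -/
theorem exists_local_flow [CompleteSpace V] {F : V → V} {Ω : Set V} (hΩ : IsOpen Ω)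
    (hF : ContDiffOn ℝ 2 F Ω) {z₀ : V} (hz₀ : z₀ ∈ Ω) :
    ∃ r > 0, ∃ ε > 0, ∃ (α : V → ℝ → V) (Y : V → ℝ → V →L[ℝ] V), ∀ z ∈ ball z₀ r,
      α z 0 = z ∧ Y z 0 = ContinuousLinearMap.id ℝ V ∧ ∀ t ∈ Ioo (-ε) ε,
        α z t ∈ Ω ∧ HasDerivAt (α z) (F (α z t)) t ∧
        HasDerivAt (Y z) (fderiv ℝ F (α z t) ∘L Y z t) t ∧
        HasFDerivAt (fun z' ↦ α z' t) (Y z t) z := by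
  have hF2 : ContDiffAt ℝ 2 F z₀ := hF.contDiffAt (hΩ.mem_nhds hz₀)
  have hDF : ContDiffAt ℝ 1 (fderiv ℝ F) z₀ := hF2.fderiv_right (by norm_num)
  -- a ball on which `F` has bounded and Lipschitz derivative
  obtain ⟨K₂, s, hs, hlip⟩ := hDF.exists_lipschitzOnWith
  obtain ⟨R, hR, hRs⟩ := Metric.mem_nhds_iff.1
    (Filter.inter_mem hs (hΩ.mem_nhds hz₀))
  have hRΩ : ball z₀ R ⊆ Ω := fun z hz ↦ (hRs hz).2
  set K₁ : ℝ := ‖fderiv ℝ F z₀‖ + K₂ * R + 1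
  have hK₁ : 0 < K₁ := by positivity
  have hbd : ∀ z ∈ ball z₀ R, ‖fderiv ℝ F z‖ ≤ K₁ := by
    intro z hz
    have h1 := hlip.norm_sub_le (hRs hz).1 (mem_of_mem_nhds hs)
    have h2 : ‖z - z₀‖ < R := by simpa [dist_eq_norm] using hz
    have h3 : ‖fderiv ℝ F z‖ ≤ ‖fderiv ℝ F z - fderiv ℝ F z₀‖ + ‖fderiv ℝ F z₀‖ := by
      simpa using norm_add_le (fderiv ℝ F z - fderiv ℝ F z₀) (fderiv ℝ F z₀)
    have h4 : (K₂ : ℝ) * ‖z - z₀‖ ≤ K₂ * R := by gcongr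
    simp only [K₁]
    linarith
  have hdiff : ∀ z ∈ ball z₀ R, DifferentiableAt ℝ F z := fun z hz ↦
    (hF.contDiffAt (hΩ.mem_nhds (hRΩ hz))).differentiableAt (by norm_num)
  have htaylor : ∀ a ∈ ball z₀ R, ∀ b ∈ ball z₀ R,
      ‖F b - F a - fderiv ℝ F a (b - a)‖ ≤ K₂ * ‖b - a‖ ^ 2 := by
    intro a ha b hb
    have hseg : segment ℝ a b ⊆ ball z₀ R := (convex_ball z₀ R).segment_subset ha hb
    have := (convex_segment a b).norm_image_sub_le_of_norm_fderiv_le' (f := F) (𝕜 := ℝ)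
      (C := K₂ * ‖b - a‖) (φ := fderiv ℝ F a) (fun z hz ↦ hdiff z (hseg hz))
      (fun z hz ↦ ?_) (left_mem_segment ℝ a b) (right_mem_segment ℝ a b)
    · rwa [mul_assoc, ← sq] at this
    · refine (hlip.norm_sub_le (hRs (hseg hz)).1 (hRs ha).1).trans ?_
      gcongr
      exact norm_sub_le_of_mem_segment hz
  -- Picard-Lindelöf for the vector field together with its linearisation
  set G : V × (V →L[ℝ] V) → V × (V →L[ℝ] V) := fun p ↦ (F p.1, fderiv ℝ F p.1 ∘L p.2)
  set p₀ : V × (V →L[ℝ] V) := (z₀, ContinuousLinearMap.id ℝ V)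
  -- Two derivatives of `F` are needed here: the linearised equation involves `fderiv ℝ F`, which
  -- must itself be `C¹`.
  have hG : ContDiffAt ℝ 1 G p₀ := by
    refine ContDiffAt.prodMk ?_ ?_
    · exact ContDiffAt.comp (g := F) p₀ (hF2.of_le (by norm_num)) contDiffAt_fst
    · exact ContDiffAt.clm_comp (ContDiffAt.comp (g := fderiv ℝ F) p₀ hDF contDiffAt_fst)
        contDiffAt_snd
  obtain ⟨ε, hε, a, r, L, K, hr, hpl⟩ := IsPicardLindelof.of_contDiffAt_one hG
  obtain ⟨β, hβ, L', hL'⟩ := (hpl 0).exists_forall_mem_closedBall_eq_hasDerivWithinAt_lipschitzOnWith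
  simp only [zero_sub, zero_add] at hβ hL'
  have hβd : ∀ p ∈ closedBall p₀ r, ∀ t ∈ Ioo (-ε) ε, HasDerivAt (β p) (G (β p t)) t :=
    fun p hp t ht ↦ ((hβ p hp).2 t ⟨ht.1.le, ht.2.le⟩).hasDerivAt (Icc_mem_nhds ht.1 ht.2)
  have hcont : ContinuousOn (Function.uncurry β) (closedBall p₀ r ×ˢ Icc (-ε) ε) :=
    continuousOn_prod_of_continuousOn_lipschitzOnWith _ L'
      (fun p hp t ht ↦ ((hβ p hp).2 t ht).continuousWithinAt) hL'
  -- Joint continuity in time and initial value keeps nearby trajectories, for short times, in the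
  -- ball where the bounds on `F` hold.
  have hmem : ∀ᶠ q in 𝓝 (p₀, (0 : ℝ)), (β q.1 q.2).1 ∈ ball z₀ R := by
    have hc : ContinuousAt (Function.uncurry β) (p₀, 0) :=
      hcont.continuousAt (prod_mem_nhds (closedBall_mem_nhds _ hr) (Icc_mem_nhds (by simpa) hε))
    have h0 : (Function.uncurry β) (p₀, 0) = p₀ :=
      (hβ p₀ (mem_closedBall_self r.2)).1
    have : Tendsto (fun q ↦ (Function.uncurry β q).1) (𝓝 (p₀, (0 : ℝ))) (𝓝 z₀) := by
      have := hc.fst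
      rwa [ContinuousAt, h0] at this
    exact this (ball_mem_nhds _ hR)
  obtain ⟨η, hη, hηmem⟩ := Metric.eventually_nhds_iff_ball.1 hmem
  have hball : ∀ z ∈ ball z₀ (min r η), (z, ContinuousLinearMap.id ℝ V) ∈ closedBall p₀ r ∧
      ∀ t ∈ Ioo (-min ε η) (min ε η), (β (z, ContinuousLinearMap.id ℝ V) t).1 ∈ ball z₀ R := by
    intro z hz
    rw [mem_ball, lt_min_iff] at hz
    refine ⟨?_, fun t ht ↦ hηmem ((z, _), t) ?_⟩
    · rw [mem_closedBall, Prod.dist_eq, dist_self]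
      exact max_le hz.1.le r.2
    · rw [mem_ball, Prod.dist_eq, Prod.dist_eq, dist_self]
      refine max_lt (max_lt hz.2 hη) ?_
      rw [Real.dist_0_eq_abs, abs_lt]
      exact ⟨by linarith [ht.1, min_le_right ε η], by linarith [ht.2, min_le_right ε η]⟩
  refine ⟨min r η, lt_min hr hη, min ε η, lt_min hε hη,
    fun z t ↦ (β (z, ContinuousLinearMap.id ℝ V) t).1,
    fun z t ↦ (β (z, ContinuousLinearMap.id ℝ V) t).2, fun z hz ↦ ?_⟩
  have hIoo : Ioo (-min ε η) (min ε η) ⊆ Ioo (-ε) ε :=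
    Ioo_subset_Ioo (neg_le_neg (min_le_left _ _)) (min_le_left _ _)
  have hα : ∀ z ∈ ball z₀ (min r η), ∀ t ∈ Ioo (-min ε η) (min ε η),
      HasDerivAt (fun t ↦ (β (z, ContinuousLinearMap.id ℝ V) t).1)
        (F (β (z, ContinuousLinearMap.id ℝ V) t).1) t := fun z hz t ht ↦
    (hβd _ (hball z hz).1 t (hIoo ht)).fst
  have hY : ∀ z ∈ ball z₀ (min r η), ∀ t ∈ Ioo (-min ε η) (min ε η),
      HasDerivAt (fun t ↦ (β (z, ContinuousLinearMap.id ℝ V) t).2)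
        (fderiv ℝ F (β (z, ContinuousLinearMap.id ℝ V) t).1 ∘L
          (β (z, ContinuousLinearMap.id ℝ V) t).2) t := fun z hz t ht ↦
    (hβd _ (hball z hz).1 t (hIoo ht)).snd
  have hinit : ∀ z ∈ ball z₀ (min r η), β (z, ContinuousLinearMap.id ℝ V) 0 = (z, .id ℝ V) :=
    fun z hz ↦ (hβ _ (hball z hz).1).1
  refine ⟨by simp [hinit z hz], by simp [hinit z hz], fun t ht ↦
    ⟨hRΩ ((hball z hz).2 t ht), hα z hz t ht, hY z hz t ht, ?_⟩⟩
  rw [hasFDerivAt_iff_isLittleO_nhds_zero]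
  -- The Grönwall bound with rate `K₁` and inhomogeneity `K₂ L'² ‖h‖²`, divided by `‖h‖²`. An error
  -- of order `‖h‖²` is more than differentiability requires.
  set C : ℝ := K₂ * L' ^ 2 / K₁ * (Real.exp (K₁ * |t|) - 1)
  refine Asymptotics.IsBigO.trans_isLittleO (g := fun h : V ↦ ‖h‖ ^ 2) ?_
    (Asymptotics.isLittleO_norm_pow_id one_lt_two)
  refine Asymptotics.IsBigO.of_bound C ?_
  have hnear : ∀ᶠ h in 𝓝 (0 : V), z + h ∈ ball z₀ (min r η) := by
    have : Tendsto (fun h : V ↦ z + h) (𝓝 0) (𝓝 z) := by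
      simpa using! (continuous_const.add continuous_id : Continuous fun h : V ↦ z + h).tendsto 0
    exact this (isOpen_ball.mem_nhds hz)
  filter_upwards [hnear] with h hh
  -- The error of the linear approximation satisfies `‖e'‖ ≤ K₁ ‖e‖ + K₂ L'² ‖h‖²`: the first term
  -- bounds the linearised field applied to `e`, the second is the Taylor remainder of `F` between
  -- two trajectories at distance at most `L' ‖h‖`.
  set e : ℝ → V := fun t ↦ (β (z + h, ContinuousLinearMap.id ℝ V) t).1 -
    (β (z, ContinuousLinearMap.id ℝ V) t).1 - (β (z, ContinuousLinearMap.id ℝ V) t).2 h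
  have hder : ∀ t ∈ Ioo (-min ε η) (min ε η), HasDerivAt e
      (F (β (z + h, ContinuousLinearMap.id ℝ V) t).1 - F (β (z, ContinuousLinearMap.id ℝ V) t).1 -
        (fderiv ℝ F (β (z, ContinuousLinearMap.id ℝ V) t).1 ∘L
          (β (z, ContinuousLinearMap.id ℝ V) t).2) h) t := fun t ht ↦ by
    refine ((hα _ hh t ht).sub (hα z hz t ht)).sub ?_
    simpa using (hY z hz t ht).clm_apply (hasDerivAt_const t h)
  have hbound := norm_le_gronwallBound_two_sided (K := K₁) (c := K₂ * L' ^ 2 * ‖h‖ ^ 2) hder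
    (by simp [e, hinit z hz, hinit _ hh]) (fun t ht ↦ ?_) ht
  · rw [gronwallBound_of_K_ne_0 hK₁.ne'] at hbound
    refine hbound.trans (le_of_eq ?_)
    simp only [C, norm_pow, norm_norm]
    ring
  · set b := (β (z + h, ContinuousLinearMap.id ℝ V) t).1
    set a := (β (z, ContinuousLinearMap.id ℝ V) t).1
    set y := (β (z, ContinuousLinearMap.id ℝ V) t).2
    have ha : a ∈ ball z₀ R := (hball z hz).2 t ht
    have hb : b ∈ ball z₀ R := (hball _ hh).2 t ht
    have hdist : ‖b - a‖ ≤ L' * ‖h‖ := by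
      have h1 := (hL' t ⟨(hIoo ht).1.le, (hIoo ht).2.le⟩).norm_sub_le (hball _ hh).1 (hball z hz).1
      have h2 : ‖((z + h, ContinuousLinearMap.id ℝ V) : V × (V →L[ℝ] V)) - (z, .id ℝ V)‖ = ‖h‖ := by
        simp [Prod.norm_def]
      rw [h2] at h1
      exact (norm_fst_le _).trans h1
    have hsplit : F b - F a - (fderiv ℝ F a ∘L y) h =
        fderiv ℝ F a (b - a - y h) + (F b - F a - fderiv ℝ F a (b - a)) := by
      simp only [map_sub, ContinuousLinearMap.comp_apply]; abel
    rw [hsplit]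
    refine (norm_add_le _ _).trans (add_le_add ?_ ?_)
    · exact ((fderiv ℝ F a).le_opNorm _).trans
        (mul_le_mul_of_nonneg_right (hbd a ha) (norm_nonneg _))
    · refine (htaylor a ha b hb).trans ?_
      rw [mul_assoc, ← mul_pow]
      gcongr

end LocalFlow

/-! ### Vector fields given in charts: solutions, uniqueness and continuation -/

theorem OpenPartialHomeomorph.measurableSet_image {X Y : Type*} [TopologicalSpace X]
    [TopologicalSpace Y] [MeasurableSpace X] [BorelSpace X] [MeasurableSpace Y] [BorelSpace Y]
    (e : OpenPartialHomeomorph X Y) {A : Set X} (hA : MeasurableSet A) (hAs : A ⊆ e.source) :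
    MeasurableSet (e '' A) := by
  rw [e.image_eq_target_inter_inv_preimage hAs, ← Subtype.image_preimage_coe]
  have hc : Continuous fun y : e.target ↦ e.symm y :=
    continuousOn_iff_continuous_domRestrict.1 e.continuousOn_symm
  exact e.open_target.measurableSet.subtype_image (hc.measurable hA)

/-- A vector field on a space `S`, given by its expressions in a family of charts that cover `S`;
the changes of charts are differentiable and map the local expressions to each other. -/
structure FieldAtlas (S V ι : Type*) [TopologicalSpace S] [NormedAddCommGroup V]
    [NormedSpace ℝ V] where
  chart : ι → OpenPartialHomeomorph S V
  field : ι → V → V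
  exists_mem_source : ∀ s, ∃ i, s ∈ (chart i).source
  contDiffOn_field : ∀ i, ContDiffOn ℝ 2 (field i) (chart i).target
  exists_hasFDerivAt : ∀ i j s, s ∈ (chart i).source → s ∈ (chart j).source →
    ∃ L : V →L[ℝ] V, HasFDerivAt (chart j ∘ (chart i).symm) L (chart i s) ∧
      L (field i (chart i s)) = field j (chart j s)

namespace FieldAtlas

variable {S V ι : Type*} [TopologicalSpace S] [NormedAddCommGroup V] [NormedSpace ℝ V]
  (𝓐 : FieldAtlas S V ι)

/-- `p` solves the differential equation at time `t`. -/
def IsSolAt (p : ℝ → S) (t : ℝ) : Prop :=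
  ContinuousAt p t ∧ ∀ i, p t ∈ (𝓐.chart i).source →
    HasDerivAt (𝓐.chart i ∘ p) (𝓐.field i (𝓐.chart i (p t))) t

variable {𝓐} {p q : ℝ → S} {t : ℝ} {i j : ι}

/-- One chart suffices, since the derivative of the change of charts carries one local expression of
the field to the other. -/
theorem isSolAt_of_chart (hc : ContinuousAt p t) (hi : p t ∈ (𝓐.chart i).source)
    (h : HasDerivAt (𝓐.chart i ∘ p) (𝓐.field i (𝓐.chart i (p t))) t) : 𝓐.IsSolAt p t := by
  refine ⟨hc, fun j hj ↦ ?_⟩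
  obtain ⟨L, hL, hLF⟩ := 𝓐.exists_hasFDerivAt i j (p t) hi hj
  rw [← hLF]
  refine (HasFDerivAt.comp_hasDerivAt t hL h).congr_of_eventuallyEq ?_
  filter_upwards [hc ((𝓐.chart i).open_source.mem_nhds hi)] with s hs
  simp only [Function.comp_apply]
  rw [(𝓐.chart i).left_inv hs]

theorem IsSolAt.congr_of_eventuallyEq (h : 𝓐.IsSolAt p t) (hpq : q =ᶠ[𝓝 t] p) :
    𝓐.IsSolAt q t := by
  refine ⟨h.1.congr hpq.symm, fun i hi ↦ ?_⟩
  rw [hpq.eq_of_nhds] at hi ⊢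
  exact (h.2 i hi).congr_of_eventuallyEq (hpq.fun_comp _)

theorem isSolAt_symm_comp {z : ℝ → V} (hz : z t ∈ (𝓐.chart i).target)
    (h : HasDerivAt z (𝓐.field i (z t)) t) : 𝓐.IsSolAt ((𝓐.chart i).symm ∘ z) t := by
  refine isSolAt_of_chart (i := i) ?_ ((𝓐.chart i).map_target hz) ?_
  · exact ((𝓐.chart i).continuousAt_symm hz).comp h.continuousAt
  · simp only [Function.comp_apply, (𝓐.chart i).right_inv hz]
    refine h.congr_of_eventuallyEq ?_
    filter_upwards [h.continuousAt ((𝓐.chart i).open_target.mem_nhds hz)] with s hs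
    exact (𝓐.chart i).right_inv hs

theorem IsSolAt.comp_add {a : ℝ} (h : 𝓐.IsSolAt p (t + a)) :
    𝓐.IsSolAt (fun s ↦ p (s + a)) t := by
  refine ⟨ContinuousAt.comp (g := p) (f := fun s ↦ s + a) h.1 (by fun_prop), fun i hi ↦ ?_⟩
  simpa using! HasDerivAt.comp_add_const t a (h.2 i hi)

/-- The field is locally Lipschitz in a chart around the common value, so uniqueness for ordinary
differential equations applies there. -/
theorem eventuallyEq_of_isSolAt (hp : ∀ᶠ s in 𝓝 t, 𝓐.IsSolAt p s)
    (hq : ∀ᶠ s in 𝓝 t, 𝓐.IsSolAt q s) (hpq : p t = q t) : p =ᶠ[𝓝 t] q := by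
  obtain ⟨i, hi⟩ := 𝓐.exists_mem_source (p t)
  have hcd : ContDiffAt ℝ 1 (𝓐.field i) (𝓐.chart i (p t)) :=
    ((𝓐.contDiffOn_field i).contDiffAt ((𝓐.chart i).open_target.mem_nhds
      ((𝓐.chart i).map_source hi))).of_le (by norm_num)
  obtain ⟨K, U, hU, hlip⟩ := hcd.exists_lipschitzOnWith
  have key : ∀ r : ℝ → S, (∀ᶠ s in 𝓝 t, 𝓐.IsSolAt r s) → p t = r t →
      (∀ᶠ s in 𝓝 t, r s ∈ (𝓐.chart i).source) ∧ ∀ᶠ s in 𝓝 t,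
        HasDerivAt (𝓐.chart i ∘ r) (𝓐.field i ((𝓐.chart i ∘ r) s)) s ∧
          (𝓐.chart i ∘ r) s ∈ U := by
    intro r hr hpr
    rw [hpr] at hi hU
    have hsrc : ∀ᶠ s in 𝓝 t, r s ∈ (𝓐.chart i).source :=
      hr.self_of_nhds.1 ((𝓐.chart i).open_source.mem_nhds hi)
    refine ⟨hsrc, ?_⟩
    have hcont : ContinuousAt (𝓐.chart i ∘ r) t :=
      ((𝓐.chart i).continuousAt hi).comp hr.self_of_nhds.1
    filter_upwards [hsrc, hr, hcont hU] with s h1 h2 h3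
    exact ⟨h2.2 i h1, h3⟩
  obtain ⟨hp1, hp2⟩ := key p hp rfl
  obtain ⟨hq1, hq2⟩ := key q hq hpq
  have := ODE_solution_unique_of_eventually (v := fun _ ↦ 𝓐.field i) (s := fun _ ↦ U)
    (Eventually.of_forall fun _ ↦ hlip) hp2 hq2 (by simp [hpq])
  filter_upwards [this, hp1, hq1] with s h1 h2 h3
  exact (𝓐.chart i).injOn h2 h3 h1

/-- The set of times near which the solutions agree is open, and relatively closed in `D` because
`S` is Hausdorff; `D` is connected. -/
theorem eqOn_of_isSolAt [T2Space S] {D : Set ℝ} (hD : IsOpen D) (hconn : IsPreconnected D)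
    (hp : ∀ s ∈ D, 𝓐.IsSolAt p s) (hq : ∀ s ∈ D, 𝓐.IsSolAt q s) (ht : t ∈ D)
    (hpq : p t = q t) : EqOn p q D := by
  have hopen : ∀ s ∈ D, p s = q s → p =ᶠ[𝓝 s] q := fun s hs h ↦
    eventuallyEq_of_isSolAt (by filter_upwards [hD.mem_nhds hs] with r hr using hp r hr)
      (by filter_upwards [hD.mem_nhds hs] with r hr using hq r hr) h
  have hsub : D ⊆ {s | p =ᶠ[𝓝 s] q} := by
    refine hconn.subset_of_closure_inter_subset ?_ ⟨t, ht, hopen t ht hpq⟩ ?_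
    · exact isOpen_iff_mem_nhds.2 fun s hs ↦ eventually_eventually_nhds.2 hs
    · rintro s ⟨hs, hsD⟩
      refine hopen s hsD ?_
      by_contra hne
      have hev : ∀ᶠ r in 𝓝 s, p r ≠ q r :=
        ((hp s hsD).1.prodMk (hq s hsD).1) (isClosed_diagonal.isOpen_compl.mem_nhds hne)
      obtain ⟨r, h1, h2⟩ := mem_closure_iff_nhds.1 hs _ hev
      exact h1 (EventuallyEq.eq_of_nhds h2)
  exact fun s hs ↦ (hsub hs).eq_of_nhds

variable (𝓐) in
theorem exists_local_isSolAt [CompleteSpace V] (s₀ : S) :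
    ∃ U ∈ 𝓝 s₀, ∃ ε > 0, ∀ s ∈ U, ∃ p : ℝ → S, p 0 = s ∧ ∀ t ∈ Ioo (-ε) ε, 𝓐.IsSolAt p t := by
  obtain ⟨i, hi⟩ := 𝓐.exists_mem_source s₀
  obtain ⟨r, hr, ε, hε, α, Y, h⟩ := exists_local_flow (𝓐.chart i).open_target
    (𝓐.contDiffOn_field i) ((𝓐.chart i).map_source hi)
  refine ⟨(𝓐.chart i).source ∩ 𝓐.chart i ⁻¹' ball (𝓐.chart i s₀) r,
    inter_mem ((𝓐.chart i).open_source.mem_nhds hi)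
      ((𝓐.chart i).continuousAt hi (ball_mem_nhds _ hr)), ε, hε, fun s hs ↦
      ⟨(𝓐.chart i).symm ∘ α (𝓐.chart i s), ?_, fun t ht ↦ ?_⟩⟩
  · simp only [Function.comp_apply]
    rw [(h _ hs.2).1, (𝓐.chart i).left_inv hs.1]
  · obtain ⟨h1, h2, -⟩ := (h _ hs.2).2.2 t ht
    exact isSolAt_symm_comp h1 h2

/-- Solutions from `s` on symmetric intervals agree where both are defined, so the diagonal choice
`t ↦ P t t` coincides near each time with a single solution. -/
theorem exists_glued [T2Space S] (s : S) {D : Set ℝ}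
    (h : ∀ t ∈ D, ∃ a, |t| < a ∧ ∃ p : ℝ → S, p 0 = s ∧ ∀ r ∈ Ioo (-a) a, 𝓐.IsSolAt p r) :
    ∃ p : ℝ → S, p 0 = s ∧ ∀ t ∈ D, 𝓐.IsSolAt p t := by
  classical
  have : Nonempty S := ⟨s⟩
  set G : Set ℝ := {t | ∃ a, |t| < a ∧ ∃ p : ℝ → S, p 0 = s ∧ ∀ r ∈ Ioo (-a) a, 𝓐.IsSolAt p r}
  choose! a ha P hP0 hP using (fun t (ht : t ∈ G) ↦ ht)
  refine ⟨fun t ↦ if t ∈ G then P t t else s, ?_, fun t ht ↦ ?_⟩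
  · by_cases h0 : (0 : ℝ) ∈ G
    · simp [h0, hP0 0 h0]
    · simp [h0]
  · have htG : t ∈ G := h t ht
    have htI := abs_lt.1 (ha t htG)
    refine (hP t htG t htI).congr_of_eventuallyEq ?_
    filter_upwards [Ioo_mem_nhds htI.1 htI.2] with r hr
    have hrG : r ∈ G := ⟨a t, abs_lt.2 hr, P t, hP0 t htG, hP t htG⟩
    simp only [hrG, if_true]
    have hm : |r| < min (a r) (a t) := lt_min (ha r hrG) (abs_lt.2 hr)
    refine eqOn_of_isSolAt (t := 0) (D := Ioo (-min (a r) (a t)) (min (a r) (a t)))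
      (𝓐 := 𝓐) isOpen_Ioo isPreconnected_Ioo
      (fun x hx ↦ hP r hrG x (Ioo_subset_Ioo (neg_le_neg (min_le_left _ _)) (min_le_left _ _) hx))
      (fun x hx ↦ hP t htG x
        (Ioo_subset_Ioo (neg_le_neg (min_le_right _ _)) (min_le_right _ _) hx))
      ?_ (by rw [hP0 r hrG, hP0 t htG]) (abs_lt.1 hm)
    have := (abs_nonneg r).trans_lt hm
    exact ⟨by linarith, this⟩

/-- A solution can be continued past the ends of its interval of definition if the local solutions
that start on it live for a uniform time. -/
theorem exists_extension [T2Space S] {s : S} {T ε : ℝ} (hT : 0 < T) (hε : 0 < ε) (hεT : ε ≤ T)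
    (hp0 : p 0 = s) (hp : ∀ t ∈ Ioo (-T) T, 𝓐.IsSolAt p t)
    (hext : ∀ t ∈ Ioo (-T) T, ∃ q : ℝ → S, q 0 = p t ∧ ∀ r ∈ Ioo (-ε) ε, 𝓐.IsSolAt q r) :
    ∃ p' : ℝ → S, p' 0 = s ∧ ∀ t ∈ Ioo (-(T + ε / 2)) (T + ε / 2), 𝓐.IsSolAt p' t := by
  classical
  -- Restarting at distance `ε / 2` from either end, with lifetime `ε`, passes the end by `ε / 2`
  -- and leaves an overlap on which uniqueness applies.
  obtain ⟨q₁, hq₁0, hq₁⟩ := hext (T - ε / 2) ⟨by linarith, by linarith⟩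
  obtain ⟨q₂, hq₂0, hq₂⟩ := hext (-(T - ε / 2)) ⟨by linarith, by linarith⟩
  have hr₁ : ∀ t ∈ Ioo (T - ε / 2 - ε) (T + ε / 2),
      𝓐.IsSolAt (fun r ↦ q₁ (r + -(T - ε / 2))) t := fun t ht ↦
    (hq₁ _ ⟨by linarith [ht.1], by linarith [ht.2]⟩).comp_add
  have hr₂ : ∀ t ∈ Ioo (-(T + ε / 2)) (-(T - ε / 2) + ε),
      𝓐.IsSolAt (fun r ↦ q₂ (r + (T - ε / 2))) t := fun t ht ↦
    (hq₂ _ ⟨by linarith [ht.1], by linarith [ht.2]⟩).comp_add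
  have he₁ : EqOn p (fun r ↦ q₁ (r + -(T - ε / 2))) (Ioo (T - ε) T) :=
    eqOn_of_isSolAt (𝓐 := 𝓐) (t := T - ε / 2) isOpen_Ioo isPreconnected_Ioo
      (fun r hr ↦ hp r ⟨by linarith [hr.1], hr.2⟩)
      (fun r hr ↦ hr₁ r ⟨by linarith [hr.1], by linarith [hr.2]⟩)
      ⟨by linarith, by linarith⟩ (by simp [hq₁0])
  have he₂ : EqOn p (fun r ↦ q₂ (r + (T - ε / 2))) (Ioo (-T) (-(T - ε))) :=
    eqOn_of_isSolAt (𝓐 := 𝓐) (t := -(T - ε / 2)) isOpen_Ioo isPreconnected_Ioo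
      (fun r hr ↦ hp r ⟨hr.1, by linarith [hr.2]⟩)
      (fun r hr ↦ hr₂ r ⟨by linarith [hr.1], by linarith [hr.2]⟩)
      ⟨by linarith, by linarith⟩ (by rw [neg_add_cancel, hq₂0])
  refine ⟨fun t ↦ if t ∈ Ioo (-T) T then p t else
    if 0 < t then q₁ (t + -(T - ε / 2)) else q₂ (t + (T - ε / 2)), by simp [hT, hp0],
    fun t ht ↦ ?_⟩
  by_cases h : t ∈ Ioo (-T) T
  · refine (hp t h).congr_of_eventuallyEq ?_
    filter_upwards [Ioo_mem_nhds h.1 h.2] with r hr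
    simp only [hr, if_true]
  rcases lt_or_ge 0 t with h0 | h0
  · have hTt : T ≤ t := by
      by_contra hlt
      exact h ⟨by linarith, by linarith⟩
    refine (hr₁ t ⟨by linarith, ht.2⟩).congr_of_eventuallyEq ?_
    filter_upwards [Ioo_mem_nhds (show T - ε < t by linarith) ht.2] with r hr
    by_cases hrT : r ∈ Ioo (-T) T
    · simp only [hrT, if_true]
      exact he₁ ⟨hr.1, hrT.2⟩
    · simp only [hrT, if_false, if_pos (show 0 < r by
        by_contra hr0
        exact hrT ⟨by linarith [hr.1], by linarith⟩)]
  · have hTt : t ≤ -T := by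
      by_contra hlt
      exact h ⟨by linarith, by linarith⟩
    refine (hr₂ t ⟨ht.1, by linarith⟩).congr_of_eventuallyEq ?_
    filter_upwards [Ioo_mem_nhds ht.1 (show t < -(T - ε) by linarith)] with r hr
    by_cases hrT : r ∈ Ioo (-T) T
    · simp only [hrT, if_true]
      exact he₂ ⟨hrT.1, hr.2⟩
    · simp only [hrT, if_false, if_neg (show ¬ 0 < r by
        intro hr0
        exact hrT ⟨by linarith, by linarith [hr.2]⟩)]

variable (𝓐) in
/-- Every point lies on a solution that is defined for all times. -/
def Complete : Prop := ∀ s : S, ∃ p : ℝ → S, p 0 = s ∧ ∀ t, 𝓐.IsSolAt p t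

/-- Were the supremum of the lifetimes of solutions from `s` finite, gluing would give a solution up
to the supremum, and the uniform time would continue it further. -/
theorem complete_of_uniform_time [T2Space S] [CompleteSpace V]
    (hext : ∀ (p : ℝ → S) (T : ℝ), 0 < T → (∀ t ∈ Ioo (-T) T, 𝓐.IsSolAt p t) →
      ∃ ε > 0, ∀ t ∈ Ioo (-T) T, ∃ q : ℝ → S, q 0 = p t ∧ ∀ r ∈ Ioo (-ε) ε, 𝓐.IsSolAt q r) :
    𝓐.Complete := by
  intro s
  set A : Set ℝ := {a | 0 < a ∧ ∃ p : ℝ → S, p 0 = s ∧ ∀ r ∈ Ioo (-a) a, 𝓐.IsSolAt p r}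
  obtain ⟨U, hU, ε₀, hε₀, h₀⟩ := 𝓐.exists_local_isSolAt s
  have hA : ε₀ ∈ A := ⟨hε₀, h₀ s (mem_of_mem_nhds hU)⟩
  by_cases hb : BddAbove A
  · exfalso
    have hT : 0 < sSup A := hε₀.trans_le (le_csSup hb hA)
    obtain ⟨p, hp0, hp⟩ := exists_glued (𝓐 := 𝓐) s (D := Ioo (-sSup A) (sSup A)) fun t ht ↦ by
      obtain ⟨a, ha, hta⟩ := exists_lt_of_lt_csSup ⟨ε₀, hA⟩ (abs_lt.2 ht)
      exact ⟨a, hta, ha.2⟩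
    obtain ⟨ε, hε, he⟩ := hext p _ hT hp
    have hε' : 0 < min ε (sSup A) := lt_min hε hT
    have hmem : sSup A + min ε (sSup A) / 2 ∈ A :=
      ⟨by linarith, exists_extension hT hε' (min_le_right _ _) hp0 hp fun t ht ↦ by
        obtain ⟨q, hq0, hq⟩ := he t ht
        exact ⟨q, hq0, fun r hr ↦ hq r
          (Ioo_subset_Ioo (neg_le_neg (min_le_left _ _)) (min_le_left _ _) hr)⟩⟩
    linarith [le_csSup hb hmem]
  · obtain ⟨p, hp0, hp⟩ := exists_glued (𝓐 := 𝓐) s (D := univ) fun t _ ↦ by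
      obtain ⟨a, ha, hta⟩ := not_bddAbove_iff.1 hb |t|
      exact ⟨a, hta, ha.2⟩
    exact ⟨p, hp0, fun t ↦ hp t (mem_univ t)⟩

/-- The flow of a complete vector field. -/
def flow (h : 𝓐.Complete) (t : ℝ) (s : S) : S := (h s).choose t

/-! ### The flow of a complete field, its differentiability, and Liouville's theorem -/

section Flow

variable (h : 𝓐.Complete)

theorem flow_zero (s : S) : flow h 0 s = s := (h s).choose_spec.1

theorem isSolAt_flow (s : S) (t : ℝ) : 𝓐.IsSolAt (fun r ↦ flow h r s) t := (h s).choose_spec.2 t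

theorem continuous_flow_apply (s : S) : Continuous fun t ↦ flow h t s :=
  continuous_iff_continuousAt.2 fun t ↦ (isSolAt_flow h s t).1

theorem flow_eq [T2Space S] {p : ℝ → S} {s : S} {D : Set ℝ} (hD : IsOpen D)
    (hconn : IsPreconnected D) (h0 : (0 : ℝ) ∈ D) (hp0 : p 0 = s)
    (hp : ∀ t ∈ D, 𝓐.IsSolAt p t) {t : ℝ} (ht : t ∈ D) : flow h t s = p t :=
  eqOn_of_isSolAt (𝓐 := 𝓐) hD hconn (fun r _ ↦ isSolAt_flow h s r) hp h0
    (by rw [flow_zero, hp0]) ht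

theorem flow_add [T2Space S] (a b : ℝ) (s : S) : flow h (a + b) s = flow h a (flow h b s) :=
  (flow_eq h (p := fun r ↦ flow h (r + b) s) isOpen_univ isPreconnected_univ (mem_univ _)
    (by simp) (fun t _ ↦ (isSolAt_flow h s (t + b)).comp_add) (mem_univ a)).symm

theorem flow_neg_flow [T2Space S] (t : ℝ) (s : S) : flow h (-t) (flow h t s) = s := by
  rw [← flow_add, neg_add_cancel, flow_zero]

theorem flow_flow_neg [T2Space S] (t : ℝ) (s : S) : flow h t (flow h (-t) s) = s := by
  rw [← flow_add, add_neg_cancel, flow_zero]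

theorem image_flow [T2Space S] (t : ℝ) (A : Set S) : flow h t '' A = flow h (-t) ⁻¹' A :=
  congrFun (image_eq_preimage_of_inverse (flow_neg_flow h t) (flow_flow_neg h t)) A

/-- The flow near a point, in a chart. -/
theorem exists_flow_chart [T2Space S] [CompleteSpace V] {s₀ : S} (hi : s₀ ∈ (𝓐.chart i).source) :
    ∃ U ∈ 𝓝 s₀, ∃ ε > 0, U ⊆ (𝓐.chart i).source ∧ ∀ s ∈ U, ∃ Y : ℝ → V →L[ℝ] V,
      Y 0 = ContinuousLinearMap.id ℝ V ∧ ∀ t ∈ Ioo (-ε) ε, flow h t s ∈ (𝓐.chart i).source ∧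
        HasDerivAt Y (fderiv ℝ (𝓐.field i) (𝓐.chart i (flow h t s)) ∘L Y t) t ∧
        HasFDerivAt (𝓐.chart i ∘ flow h t ∘ (𝓐.chart i).symm) (Y t) (𝓐.chart i s) := by
  obtain ⟨r, hr, ε, hε, α, Y, hα⟩ := exists_local_flow (𝓐.chart i).open_target
    (𝓐.contDiffOn_field i) ((𝓐.chart i).map_source hi)
  have hflow : ∀ z ∈ (𝓐.chart i).target ∩ ball (𝓐.chart i s₀) r, ∀ t ∈ Ioo (-ε) ε,
      flow h t ((𝓐.chart i).symm z) = (𝓐.chart i).symm (α z t) := fun z hz t ht ↦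
    flow_eq h (p := (𝓐.chart i).symm ∘ α z) isOpen_Ioo isPreconnected_Ioo ⟨by simpa, hε⟩
      (by simp [(hα z hz.2).1])
      (fun t ht ↦ isSolAt_symm_comp ((hα z hz.2).2.2 t ht).1 ((hα z hz.2).2.2 t ht).2.1) ht
  have hopen : IsOpen ((𝓐.chart i).target ∩ ball (𝓐.chart i s₀) r) :=
    (𝓐.chart i).open_target.inter isOpen_ball
  refine ⟨(𝓐.chart i).source ∩ 𝓐.chart i ⁻¹' ball (𝓐.chart i s₀) r,
    inter_mem ((𝓐.chart i).open_source.mem_nhds hi)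
      ((𝓐.chart i).continuousAt hi (ball_mem_nhds _ hr)), ε, hε, inter_subset_left,
      fun s hs ↦ ⟨Y (𝓐.chart i s), (hα _ hs.2).2.1, fun t ht ↦ ?_⟩⟩
  have hz : 𝓐.chart i s ∈ (𝓐.chart i).target ∩ ball (𝓐.chart i s₀) r :=
    ⟨(𝓐.chart i).map_source hs.1, hs.2⟩
  obtain ⟨h1, h2, h3, h4⟩ := (hα _ hs.2).2.2 t ht
  have hf := hflow _ hz t ht
  rw [(𝓐.chart i).left_inv hs.1] at hf
  refine ⟨hf ▸ (𝓐.chart i).map_target h1, ?_, ?_⟩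
  · rwa [hf, (𝓐.chart i).right_inv h1]
  · refine h4.congr_of_eventuallyEq ?_
    filter_upwards [hopen.mem_nhds hz] with z hz'
    simp only [Function.comp_apply]
    rw [hflow z hz' t ht, (𝓐.chart i).right_inv ((hα z hz'.2).2.2 t ht).1]

/-- A property of the flow that holds for small times and is stable under composition holds for
all times. -/
theorem flow_induction [T2Space S] {Q : ℝ → S → Prop}
    (hloc : ∀ s₀, ∃ U ∈ 𝓝 s₀, ∃ ε > 0, ∀ s ∈ U, ∀ t ∈ Ioo (-ε) ε, Q t s)
    (hcomp : ∀ a b s, Q a s → Q b (flow h a s) → Q (b + a) s) (t : ℝ) (s : S) : Q t s := by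
  -- The truth value of `Q t s` is a locally constant function of `t`: from a nearby time a short
  -- flow, forwards or backwards, transports the property. Connectedness of `ℝ` then reduces
  -- everything to time `0`.
  have hlc : IsLocallyConstant fun t ↦ Q t s := by
    rw [IsLocallyConstant.iff_eventually_eq]
    intro t₀
    obtain ⟨U, hU, ε, hε, hQ⟩ := hloc (flow h t₀ s)
    have key : ∀ a b, flow h a s ∈ U → |b - a| < ε → Q a s → Q b s := fun a b ha hab hQa ↦ by
      simpa using hcomp a (b - a) s hQa (hQ _ ha _ (abs_lt.1 hab))
    filter_upwards [(continuous_flow_apply h s).continuousAt hU, ball_mem_nhds t₀ hε] with a ha ha'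
    rw [mem_ball, Real.dist_eq] at ha'
    exact propext ⟨key a t₀ ha (by rwa [abs_sub_comm]), key t₀ a (mem_of_mem_nhds hU) ha'⟩
  have h0 : Q 0 s := by
    obtain ⟨U, hU, ε, hε, hQ⟩ := hloc s
    exact hQ s (mem_of_mem_nhds hU) 0 ⟨by simpa, hε⟩
  rw [hlc.apply_eq_of_preconnectedSpace t 0]
  exact h0

variable (𝓐) in
/-- Differentiability at a point, read in the charts. -/
def IsDiffAt (f : S → S) (s : S) : Prop :=
  ContinuousAt f s ∧ ∀ i j, s ∈ (𝓐.chart i).source → f s ∈ (𝓐.chart j).source →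
    DifferentiableAt ℝ (𝓐.chart j ∘ f ∘ (𝓐.chart i).symm) (𝓐.chart i s)

/-- Changes of charts are differentiable, so one pair of charts suffices. The condition `hev` is
separate information: a chart has arbitrary values off its source, so the local expression alone
does not control `f` near `s`. -/
theorem isDiffAt_of_chart {f : S → S} {s : S} (hi : s ∈ (𝓐.chart i).source)
    (hj : f s ∈ (𝓐.chart j).source) (hev : ∀ᶠ s' in 𝓝 s, f s' ∈ (𝓐.chart j).source)
    (hd : DifferentiableAt ℝ (𝓐.chart j ∘ f ∘ (𝓐.chart i).symm) (𝓐.chart i s)) :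
    𝓐.IsDiffAt f s := by
  have hc : ContinuousAt f s := by
    have h1 : ContinuousAt ((𝓐.chart j).symm ∘ (𝓐.chart j ∘ f ∘ (𝓐.chart i).symm) ∘ 𝓐.chart i)
        s := by
      refine ContinuousAt.comp ?_ (hd.continuousAt.comp ((𝓐.chart i).continuousAt hi))
      simp only [Function.comp_apply, (𝓐.chart i).left_inv hi]
      exact (𝓐.chart j).continuousAt_symm ((𝓐.chart j).map_source hj)
    refine h1.congr ?_
    filter_upwards [hev, (𝓐.chart i).open_source.mem_nhds hi] with s' h2 h3
    simp only [Function.comp_apply]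
    rw [(𝓐.chart i).left_inv h3, (𝓐.chart j).left_inv h2]
  refine ⟨hc, fun i' j' hi' hj' ↦ ?_⟩
  obtain ⟨L, hL, -⟩ := 𝓐.exists_hasFDerivAt i' i s hi' hi
  obtain ⟨L', hL', -⟩ := 𝓐.exists_hasFDerivAt j j' (f s) hj hj'
  have h1 : DifferentiableAt ℝ ((𝓐.chart j ∘ f ∘ (𝓐.chart i).symm) ∘
      (𝓐.chart i ∘ (𝓐.chart i').symm)) (𝓐.chart i' s) := by
    refine DifferentiableAt.comp _ ?_ hL.differentiableAt
    simpa only [Function.comp_apply, (𝓐.chart i').left_inv hi'] using hd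
  have h2 : DifferentiableAt ℝ ((𝓐.chart j' ∘ (𝓐.chart j).symm) ∘
      ((𝓐.chart j ∘ f ∘ (𝓐.chart i).symm) ∘ (𝓐.chart i ∘ (𝓐.chart i').symm)))
      (𝓐.chart i' s) := by
    refine DifferentiableAt.comp _ ?_ h1
    simp only [Function.comp_apply, (𝓐.chart i').left_inv hi', (𝓐.chart i).left_inv hi]
    exact hL'.differentiableAt
  refine h2.congr_of_eventuallyEq ?_
  have hcs : ContinuousAt (𝓐.chart i').symm (𝓐.chart i' s) :=
    (𝓐.chart i').continuousAt_symm ((𝓐.chart i').map_source hi')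
  rw [ContinuousAt, (𝓐.chart i').left_inv hi'] at hcs
  filter_upwards [hcs hev, hcs ((𝓐.chart i).open_source.mem_nhds hi)] with z h3 h4
  simp only [Function.comp_apply]
  rw [(𝓐.chart i).left_inv h4, (𝓐.chart j).left_inv h3]

theorem IsDiffAt.comp {f g : S → S} {s : S} (hg : 𝓐.IsDiffAt g (f s)) (hf : 𝓐.IsDiffAt f s) :
    𝓐.IsDiffAt (g ∘ f) s := by
  obtain ⟨i, hi⟩ := 𝓐.exists_mem_source s
  obtain ⟨j, hj⟩ := 𝓐.exists_mem_source (f s)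
  obtain ⟨k, hk⟩ := 𝓐.exists_mem_source (g (f s))
  have hc : ContinuousAt (g ∘ f) s := hg.1.comp hf.1
  refine isDiffAt_of_chart hi (j := k) hk (hc ((𝓐.chart k).open_source.mem_nhds hk)) ?_
  have h1 := hf.2 i j hi hj
  have h2 := hg.2 j k hj hk
  have h3 : DifferentiableAt ℝ ((𝓐.chart k ∘ g ∘ (𝓐.chart j).symm) ∘
      (𝓐.chart j ∘ f ∘ (𝓐.chart i).symm)) (𝓐.chart i s) := by
    refine DifferentiableAt.comp _ ?_ h1
    simpa only [Function.comp_apply, (𝓐.chart i).left_inv hi] using h2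
  refine h3.congr_of_eventuallyEq ?_
  have hcs : ContinuousAt (𝓐.chart i).symm (𝓐.chart i s) :=
    (𝓐.chart i).continuousAt_symm ((𝓐.chart i).map_source hi)
  rw [ContinuousAt, (𝓐.chart i).left_inv hi] at hcs
  filter_upwards [hcs (hf.1 ((𝓐.chart j).open_source.mem_nhds hj))] with z h4
  simp only [Function.comp_apply]
  rw [(𝓐.chart j).left_inv h4]

theorem isDiffAt_flow [T2Space S] [CompleteSpace V] (t : ℝ) (s : S) : 𝓐.IsDiffAt (flow h t) s := by
  refine flow_induction h (Q := fun t s ↦ 𝓐.IsDiffAt (flow h t) s) (fun s₀ ↦ ?_)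
    (fun a b s h1 h2 ↦ ?_) t s
  · obtain ⟨i, hi⟩ := 𝓐.exists_mem_source s₀
    obtain ⟨U, hU, ε, hε, hUs, hY⟩ := exists_flow_chart h hi
    refine ⟨interior U, interior_mem_nhds.2 hU, ε, hε, fun s hs t ht ↦ ?_⟩
    obtain ⟨Y, -, h1⟩ := hY s (interior_subset hs)
    obtain ⟨h2, -, h3⟩ := h1 t ht
    refine isDiffAt_of_chart (hUs (interior_subset hs)) h2 ?_ h3.differentiableAt
    filter_upwards [isOpen_interior.mem_nhds hs] with s' hs'
    obtain ⟨_, -, h4⟩ := hY s' (interior_subset hs')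
    exact (h4 t ht).1
  · have : flow h (b + a) = flow h b ∘ flow h a := by
      funext s
      exact flow_add h b a s
    rw [this]
    exact h2.comp h1

theorem continuous_flow [T2Space S] [CompleteSpace V] (t : ℝ) : Continuous (flow h t) :=
  continuous_iff_continuousAt.2 fun s ↦ (isDiffAt_flow h t s).1

/-- **Liouville theorem**: the flow of a complete vector field preserves a measure whose density
satisfies the continuity equation in every chart. -/
theorem measurePreserving_flow [T2Space S] [SecondCountableTopology S] [MeasurableSpace S]
    [BorelSpace S] [FiniteDimensional ℝ V] [MeasurableSpace V] [BorelSpace V] (ν : Measure V)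
    [ν.IsAddHaarMeasure] {μ : Measure S} {ρ : ι → V → ℝ}
    (hμ : ∀ i (A : Set S), MeasurableSet A → A ⊆ (𝓐.chart i).source →
      μ A = ∫⁻ z in 𝓐.chart i '' A, ENNReal.ofReal (ρ i z) ∂ν)
    (hρ0 : ∀ i z, z ∈ (𝓐.chart i).target → 0 ≤ ρ i z)
    (hρ : ∀ i z, z ∈ (𝓐.chart i).target → DifferentiableAt ℝ (ρ i) z)
    (hdiv : ∀ i z, z ∈ (𝓐.chart i).target → fderiv ℝ (ρ i) z (𝓐.field i z) +
      LinearMap.trace ℝ V (fderiv ℝ (𝓐.field i) z) * ρ i z = 0) (t : ℝ) :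
    MeasurePreserving (flow h t) μ μ := by
  have : CompleteSpace V := FiniteDimensional.complete ℝ V
  have hchart : ∀ (i : ι) (A : Set S), MeasurableSet A → A ⊆ (𝓐.chart i).source →
      MeasurableSet (𝓐.chart i '' A) := fun i A hA hAs ↦
    (𝓐.chart i).measurableSet_image hA hAs
  -- Preservation of measure is first stated for images of small sets, a local property in `(t, s)`
  -- that composes and thus suits `flow_induction`.
  have hQ : ∀ t s, ∃ U ∈ 𝓝 s, ∀ A ⊆ U, MeasurableSet A → μ (flow h t '' A) = μ A := by
    refine flow_induction h (fun s₀ ↦ ?_) (fun a b s h1 h2 ↦ ?_)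
    · obtain ⟨i, hi⟩ := 𝓐.exists_mem_source s₀
      obtain ⟨U, hU, ε, hε, hUs, hY⟩ := exists_flow_chart h hi
      choose! Y hY0 hY' using hY
      refine ⟨interior U, interior_mem_nhds.2 hU, ε, hε, fun s hs t ht ↦
        ⟨U, mem_interior_iff_mem_nhds.1 hs, fun A hAU hA ↦ ?_⟩⟩
      have hAs : A ⊆ (𝓐.chart i).source := hAU.trans hUs
      have hA' : flow h t '' A ⊆ (𝓐.chart i).source := by
        rintro _ ⟨s, hs, rfl⟩
        exact (hY' s (hAU hs) t ht).1
      have hmA' : MeasurableSet (flow h t '' A) := by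
        rw [image_flow]
        exact (continuous_flow h _).measurable hA
      have himg : 𝓐.chart i '' (flow h t '' A) =
          (𝓐.chart i ∘ flow h t ∘ (𝓐.chart i).symm) '' (𝓐.chart i '' A) := by
        rw [image_image, image_image]
        refine image_congr fun s hs ↦ ?_
        simp only [Function.comp_apply, (𝓐.chart i).left_inv (hAs hs)]
      rw [hμ i _ hmA' hA', hμ i A hA hAs, himg,
        lintegral_image_eq_lintegral_abs_det_fderiv_mul ν (hchart i A hA hAs)
          (f' := fun z ↦ Y ((𝓐.chart i).symm z) t)]
      · refine setLIntegral_congr_fun (hchart i A hA hAs) ?_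
        rintro _ ⟨s, hs, rfl⟩
        simp only [Function.comp_apply, (𝓐.chart i).left_inv (hAs hs)]
        have hpos : 0 ≤ ρ i (𝓐.chart i (flow h t s)) :=
          hρ0 i _ ((𝓐.chart i).map_source (hY' s (hAU hs) t ht).1)
        rw [← ENNReal.ofReal_mul (abs_nonneg _)]
        congr 1
        -- The Jacobian times the transported density is constant in time: `det Y` grows at the rate
        -- `tr (fderiv F)` by Liouville's formula, and the continuity equation cancels this against
        -- the derivative of `ρ`.
        have hconst : ∀ r ∈ Ioo (-ε) ε, HasDerivAt
            (fun r ↦ (Y s r).det * ρ i (𝓐.chart i (flow h r s))) 0 r := by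
          intro r hr
          obtain ⟨h1, h2, -⟩ := hY' s (hAU hs) r hr
          have h3 := hasDerivAt_det_clm h2
          have h4 : HasDerivAt (fun r ↦ ρ i (𝓐.chart i (flow h r s)))
              (fderiv ℝ (ρ i) (𝓐.chart i (flow h r s))
                (𝓐.field i (𝓐.chart i (flow h r s)))) r :=
            HasFDerivAt.comp_hasDerivAt r
              (hρ i _ ((𝓐.chart i).map_source h1)).hasFDerivAt ((isSolAt_flow h s r).2 i h1)
          have h5 := hdiv i _ ((𝓐.chart i).map_source h1)
          exact (h3.mul h4).congr_deriv (by linear_combination (Y s r).det * h5)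
        have h0 : (0 : ℝ) ∈ Ioo (-ε) ε := ⟨by simpa, hε⟩
        have heq := (convex_Ioo (-ε) ε).is_const_of_fderivWithin_eq_zero (𝕜 := ℝ)
          (fun r hr ↦ (hconst r hr).differentiableAt.differentiableWithinAt) (fun r hr ↦ ?_) ht h0
        · simp only [hY0 s (hAU hs), flow_zero] at heq
          have hid : (ContinuousLinearMap.id ℝ V).det = 1 := by
            simp [ContinuousLinearMap.det]
          rw [hid, one_mul] at heq
          -- The sign of the Jacobian is irrelevant: `ρ` is non-negative, so the absolute value is
          -- taken of the whole product, which equals the initial density.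
          rw [← abs_of_nonneg hpos, ← abs_mul, heq, abs_of_nonneg]
          exact hρ0 i _ ((𝓐.chart i).map_source (hAs hs))
        · rw [fderivWithin_of_isOpen isOpen_Ioo hr]
          ext
          simpa using (hconst r hr).deriv
      · rintro _ ⟨s, hs, rfl⟩
        simp only [(𝓐.chart i).left_inv (hAs hs)]
        exact (hY' s (hAU hs) t ht).2.2.hasFDerivWithinAt
      · rintro _ ⟨s, hs, rfl⟩ _ ⟨s', hs', rfl⟩ heq
        simp only [Function.comp_apply, (𝓐.chart i).left_inv (hAs hs),
          (𝓐.chart i).left_inv (hAs hs')] at heq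
        have := (𝓐.chart i).injOn (hY' s (hAU hs) t ht).1 (hY' s' (hAU hs') t ht).1 heq
        rw [← flow_neg_flow h t s, this, flow_neg_flow h t s']
    · obtain ⟨U, hU, hUA⟩ := h1
      obtain ⟨W, hW, hWA⟩ := h2
      refine ⟨U ∩ flow h a ⁻¹' W, inter_mem hU ((continuous_flow h a).continuousAt hW),
        fun A hA hmA ↦ ?_⟩
      have : flow h (b + a) '' A = flow h b '' (flow h a '' A) := by
        rw [image_image]
        exact image_congr fun s _ ↦ flow_add h b a s
      rw [this, hWA _ (by rintro _ ⟨s, hs, rfl⟩; exact (hA hs).2), hUA A (fun s hs ↦ (hA hs).1) hmA]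
      rw [image_flow]
      exact (continuous_flow h _).measurable hmA
  refine ⟨(continuous_flow h t).measurable, ?_⟩
  -- Time `-t`, because the preimage under the flow at time `t` is the image under the flow at time
  -- `-t`. Countably many neighbourhoods then cover `S`.
  choose U hU hUA using hQ (-t)
  obtain ⟨c, hc, hcU⟩ := TopologicalSpace.countable_cover_nhds
    (fun s ↦ interior_mem_nhds.2 (hU s))
  refine (Measure.ext_iff_of_biUnion_eq_univ hc hcU).2 fun s _ ↦ ?_
  ext A hA
  have hm : MeasurableSet (A ∩ interior (U s)) := hA.inter isOpen_interior.measurableSet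
  rw [Measure.restrict_apply hA, Measure.restrict_apply hA,
    Measure.map_apply (continuous_flow h t).measurable hm, ← hUA s _ ?_ hm, image_flow, neg_neg]
  exact inter_subset_right.trans interior_subset

end Flow

end FieldAtlas

/-- The coordinate space of an `n`-dimensional manifold. -/
abbrev Coord (n : ℕ) := EuclideanSpace ℝ (Fin n)

/-! ### Christoffel symbols and the geodesic field in one coordinate domain -/

namespace LocalMetric

variable {n : ℕ}

/-- The bilinear form of a matrix. -/
def form (A : Matrix (Fin n) (Fin n) ℝ) (u w : Coord n) : ℝ := ∑ i, ∑ j, A i j * u i * w j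

section Form

variable (A B : Matrix (Fin n) (Fin n) ℝ) (u v w : Coord n) (c : ℝ)

theorem form_add_left : form A (u + v) w = form A u w + form A v w := by
  simp only [form, PiLp.add_apply, mul_add, add_mul, Finset.sum_add_distrib]

theorem form_smul_left : form A (c • u) w = c * form A u w := by
  simp only [form, PiLp.smul_apply, smul_eq_mul, Finset.mul_sum]
  exact Finset.sum_congr rfl fun i _ ↦ Finset.sum_congr rfl fun j _ ↦ by ring

theorem form_neg_left : form A (-u) w = -form A u w := by
  rw [← neg_one_smul ℝ u, form_smul_left]; ring

theorem form_sub_left : form A (u - v) w = form A u w - form A v w := by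
  rw [sub_eq_add_neg, form_add_left, form_neg_left]; ring

theorem form_comm (hA : A.IsSymm) : form A u w = form A w u := by
  unfold form
  rw [Finset.sum_comm]
  exact Finset.sum_congr rfl fun i _ ↦ Finset.sum_congr rfl fun j _ ↦ by
    rw [← hA.apply i j]; ring

theorem form_single_left (i : Fin n) :
    form A (EuclideanSpace.single i 1) w = ∑ j, A i j * w j := by
  unfold form
  rw [Finset.sum_eq_single i]
  · simp
  · intro k _ hk
    simp [hk]
  · simp

theorem form_single_single (i j : Fin n) :
    form A (EuclideanSpace.single i 1) (EuclideanSpace.single j 1) = A i j := by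
  rw [form_single_left, Finset.sum_eq_single j] <;> simp +contextual

end Form

theorem hasDerivAt_form {A : ℝ → Matrix (Fin n) (Fin n) ℝ} {A' : Matrix (Fin n) (Fin n) ℝ}
    {u w : ℝ → Coord n} {u' w' : Coord n} {t : ℝ}
    (hA : ∀ i j, HasDerivAt (fun s ↦ A s i j) (A' i j) t) (hu : HasDerivAt u u' t)
    (hw : HasDerivAt w w' t) :
    HasDerivAt (fun s ↦ form (A s) (u s) (w s))
      (form A' (u t) (w t) + form (A t) u' (w t) + form (A t) (u t) w') t := by
  have hu' : ∀ i, HasDerivAt (fun s ↦ u s i) (u' i) t := fun i ↦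
    (EuclideanSpace.proj (𝕜 := ℝ) i).hasFDerivAt.comp_hasDerivAt t hu
  have hw' : ∀ i, HasDerivAt (fun s ↦ w s i) (w' i) t := fun i ↦
    (EuclideanSpace.proj (𝕜 := ℝ) i).hasFDerivAt.comp_hasDerivAt t hw
  refine (HasDerivAt.fun_sum fun i _ ↦ HasDerivAt.fun_sum fun j _ ↦
    ((hA i j).mul (hu' i)).mul (hw' j)).congr_deriv ?_
  simp only [form, ← Finset.sum_add_distrib]
  exact Finset.sum_congr rfl fun i _ ↦ Finset.sum_congr rfl fun j _ ↦ by
    simp only [Pi.mul_apply]; ring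

variable (g : Coord n → Matrix (Fin n) (Fin n) ℝ)

/-- The directional derivative `D_v g` of the metric. -/
def dmat (y v : Coord n) : Matrix (Fin n) (Fin n) ℝ :=
  Matrix.of fun i j ↦ fderiv ℝ (fun z ↦ g z i j) y v

/-- The Christoffel symbols of the metric `g`. -/
def chris (k i j : Fin n) (y : Coord n) : ℝ :=
  (1 / 2 : ℝ) * ∑ l, (g y)⁻¹ k l * (dmat g y (EuclideanSpace.single i 1) j l +
    dmat g y (EuclideanSpace.single j 1) i l - dmat g y (EuclideanSpace.single l 1) i j)

/-- The Christoffel symbols as a bilinear map. -/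
def gam (y u w : Coord n) : Coord n :=
  WithLp.toLp 2 fun k ↦ ∑ i, ∑ j, chris g k i j y * u i * w j

/-- The geodesic vector field in coordinates. -/
def spray (z : Coord n × Coord n) : Coord n × Coord n := (z.2, -gam g z.1 z.2 z.2)

variable {g}

theorem dmat_eq_sum (y v : Coord n) (i j : Fin n) :
    dmat g y v i j = ∑ k, v k * dmat g y (EuclideanSpace.single k 1) i j := by
  have hv : v = ∑ k, v k • (EuclideanSpace.single k 1 : Coord n) := by
    ext m
    simp [Finset.sum_apply, Pi.single_apply]
  simp only [dmat, Matrix.of_apply]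
  conv_lhs => rw [hv]
  simp [map_sum]

theorem form_dmat (y v u w : Coord n) : form (dmat g y v) u w =
    ∑ k, ∑ i, ∑ j, dmat g y (EuclideanSpace.single k 1) i j * u i * w j * v k := by
  unfold form
  simp only [dmat_eq_sum y v, Finset.sum_mul]
  rw [Finset.sum_comm]
  conv_rhs => rw [Finset.sum_comm]; enter [2, i]; rw [Finset.sum_comm]
  rw [Finset.sum_comm]
  refine Finset.sum_congr rfl fun i _ ↦ Finset.sum_congr rfl fun j _ ↦
    Finset.sum_congr rfl fun k _ ↦ ?_
  ring

theorem dmat_isSymm (hs : ∀ y, (g y).IsSymm) (y v : Coord n) : (dmat g y v).IsSymm := by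
  ext i j
  simp only [Matrix.transpose_apply, dmat, Matrix.of_apply]
  congr 2
  funext z
  exact (hs z).apply i j

theorem chris_symm (hs : ∀ y, (g y).IsSymm) (k i j : Fin n) (y : Coord n) :
    chris g k i j y = chris g k j i y := by
  unfold chris
  congr 1
  refine Finset.sum_congr rfl fun l _ ↦ ?_
  rw [(dmat_isSymm hs y _).apply j i]
  ring

/-- The Christoffel symbols with lowered index. -/
theorem form_gam (hs : ∀ y, (g y).IsSymm) {y : Coord n} (hdet : IsUnit (g y).det)
    (u w x : Coord n) :
    form (g y) (gam g y u w) x = (1 / 2 : ℝ) *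
      (form (dmat g y u) w x + form (dmat g y w) u x - form (dmat g y x) u w) := by
  have hinv : ∀ l m, ∑ k, (g y)⁻¹ k l * g y k m = if l = m then 1 else 0 := by
    intro l m
    have h1 : ((g y)⁻¹ * g y) l m = (1 : Matrix (Fin n) (Fin n) ℝ) l m := by
      rw [Matrix.nonsing_inv_mul _ hdet]
    rw [Matrix.mul_apply, Matrix.one_apply] at h1
    rw [← h1]
    refine Finset.sum_congr rfl fun k _ ↦ ?_
    have : (g y)⁻¹.IsSymm := (hs y).inv
    rw [this.apply k l]
  set T : Fin n → Fin n → Fin n → ℝ := fun i j l ↦ dmat g y (EuclideanSpace.single i 1) j l +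
    dmat g y (EuclideanSpace.single j 1) i l - dmat g y (EuclideanSpace.single l 1) i j
  have hlhs : form (g y) (gam g y u w) x =
      (1 / 2 : ℝ) * ∑ i, ∑ j, ∑ m, T i j m * u i * w j * x m := by
    calc form (g y) (gam g y u w) x
        = ∑ k, ∑ m, ∑ i, ∑ j, ∑ l, (1 / 2 : ℝ) *
            (((g y)⁻¹ k l * g y k m) * (T i j l * u i * w j * x m)) := by
          unfold form gam chris
          refine Finset.sum_congr rfl fun k _ ↦ Finset.sum_congr rfl fun m _ ↦ ?_
          simp only [Finset.mul_sum, Finset.sum_mul]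
          refine Finset.sum_congr rfl fun i _ ↦ Finset.sum_congr rfl fun j _ ↦
            Finset.sum_congr rfl fun l _ ↦ ?_
          simp only [T]
          ring
      -- The sum over `k` is moved innermost, where `g⁻¹` and `g` contract to the identity and force
      -- `l = m`.
      _ = ∑ i, ∑ j, ∑ m, ∑ l, ∑ k, (1 / 2 : ℝ) *
            (((g y)⁻¹ k l * g y k m) * (T i j l * u i * w j * x m)) := by
          rw [Finset.sum_comm]
          have h1 : ∀ m : Fin n, ∑ k, ∑ i, ∑ j, ∑ l, (1 / 2 : ℝ) *
              (((g y)⁻¹ k l * g y k m) * (T i j l * u i * w j * x m)) =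
              ∑ i, ∑ j, ∑ l, ∑ k, (1 / 2 : ℝ) *
              (((g y)⁻¹ k l * g y k m) * (T i j l * u i * w j * x m)) := by
            intro m
            rw [Finset.sum_comm]
            refine Finset.sum_congr rfl fun i _ ↦ ?_
            rw [Finset.sum_comm]
            refine Finset.sum_congr rfl fun j _ ↦ ?_
            rw [Finset.sum_comm]
          simp only [h1]
          rw [Finset.sum_comm]
          refine Finset.sum_congr rfl fun i _ ↦ ?_
          rw [Finset.sum_comm]
      _ = (1 / 2 : ℝ) * ∑ i, ∑ j, ∑ m, T i j m * u i * w j * x m := by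
          simp only [Finset.mul_sum]
          refine Finset.sum_congr rfl fun i _ ↦ Finset.sum_congr rfl fun j _ ↦
            Finset.sum_congr rfl fun m _ ↦ ?_
          simp only [← Finset.mul_sum, ← Finset.sum_mul, hinv]
          simp
  rw [hlhs]
  congr 1
  have e2 : form (dmat g y w) u x = ∑ i, ∑ j, ∑ m,
      dmat g y (EuclideanSpace.single j 1) i m * u i * x m * w j := by
    rw [form_dmat, Finset.sum_comm]
  have e3 : form (dmat g y x) u w = ∑ i, ∑ j, ∑ m,
      dmat g y (EuclideanSpace.single m 1) i j * u i * w j * x m := by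
    rw [form_dmat, Finset.sum_comm]
    exact Finset.sum_congr rfl fun i _ ↦ Finset.sum_comm
  rw [form_dmat, e2, e3]
  simp only [← Finset.sum_add_distrib, ← Finset.sum_sub_distrib]
  refine Finset.sum_congr rfl fun i _ ↦ Finset.sum_congr rfl fun j _ ↦
    Finset.sum_congr rfl fun m _ ↦ ?_
  simp only [T]
  ring

/-- The Christoffel symbols transform as a connection under a change of coordinates `ψ`. -/
theorem gam_transform {G : Coord n → Matrix (Fin n) (Fin n) ℝ} (hs : ∀ y, (g y).IsSymm)
    (hS : ∀ y, (G y).IsSymm) {ψ : Coord n → Coord n} {y : Coord n}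
    (hdet : IsUnit (g y).det) (hDet : IsUnit (G (ψ y)).det)
    (hpos : ∀ u, form (G (ψ y)) u u = 0 → u = 0)
    (hg : ∀ i j, DifferentiableAt ℝ (fun z ↦ g z i j) y)
    (hG : ∀ i j, DifferentiableAt ℝ (fun z ↦ G z i j) (ψ y)) (hψ : ContDiffAt ℝ 2 ψ y)
    (hsurj : Function.Surjective (fderiv ℝ ψ y))
    (hpull : ∀ᶠ z in 𝓝 y, ∀ u w,
      form (g z) u w = form (G (ψ z)) (fderiv ℝ ψ z u) (fderiv ℝ ψ z w)) (v : Coord n) :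
    fderiv ℝ ψ y (gam g y v v) = fderiv ℝ (fderiv ℝ ψ) y v v +
      gam G (ψ y) (fderiv ℝ ψ y v) (fderiv ℝ ψ y v) := by
  have hψ1 : DifferentiableAt ℝ ψ y := hψ.differentiableAt (by norm_num)
  have hψ2 : DifferentiableAt ℝ (fderiv ℝ ψ) y :=
    (hψ.fderiv_right (m := 1) (by norm_num)).differentiableAt (by norm_num)
  have hsymm : ∀ a b, fderiv ℝ (fderiv ℝ ψ) y a b = fderiv ℝ (fderiv ℝ ψ) y b a :=
    hψ.isSymmSndFDerivAt (by simp)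
  -- The derivative in direction `a` of the identity expressing `g` as the pull-back of `G` under
  -- `ψ`.
  have hD : ∀ a b c, form (dmat g y a) b c =
      form (dmat G (ψ y) (fderiv ℝ ψ y a)) (fderiv ℝ ψ y b) (fderiv ℝ ψ y c) +
      form (G (ψ y)) (fderiv ℝ (fderiv ℝ ψ) y a b) (fderiv ℝ ψ y c) +
      form (G (ψ y)) (fderiv ℝ ψ y b) (fderiv ℝ (fderiv ℝ ψ) y a c) := by
    intro a b c
    have hl : HasDerivAt (fun r : ℝ ↦ y + r • a) a 0 := by
      simpa using! ((hasDerivAt_id (0 : ℝ)).smul_const a).const_add y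
    have hl0 : y + (0 : ℝ) • a = y := by simp
    have h1 : HasDerivAt (fun r : ℝ ↦ form (g (y + r • a)) b c) (form (dmat g y a) b c) 0 := by
      have := hasDerivAt_form (A := fun r : ℝ ↦ g (y + r • a)) (A' := dmat g y a) (t := 0)
        (fun i j ↦ HasFDerivAt.comp_hasDerivAt (l := fun z ↦ g z i j) (0 : ℝ)
          (by rw [hl0]; exact (hg i j).hasFDerivAt) hl)
        (hasDerivAt_const 0 b) (hasDerivAt_const 0 c)
      refine this.congr_deriv ?_
      simp [form]
    have hψl : HasDerivAt (fun r : ℝ ↦ ψ (y + r • a)) (fderiv ℝ ψ y a) 0 :=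
      HasFDerivAt.comp_hasDerivAt (l := ψ) (0 : ℝ) (by rw [hl0]; exact hψ1.hasFDerivAt) hl
    have hdl : HasDerivAt (fun r : ℝ ↦ fderiv ℝ ψ (y + r • a))
        (fderiv ℝ (fderiv ℝ ψ) y a) 0 :=
      HasFDerivAt.comp_hasDerivAt (l := fderiv ℝ ψ) (0 : ℝ)
        (by rw [hl0]; exact hψ2.hasFDerivAt) hl
    have hdb : ∀ b, HasDerivAt (fun r : ℝ ↦ fderiv ℝ ψ (y + r • a) b)
        (fderiv ℝ (fderiv ℝ ψ) y a b) 0 := fun b ↦ by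
      simpa using hdl.clm_apply (hasDerivAt_const 0 b)
    have h2 := hasDerivAt_form (A := fun r : ℝ ↦ G (ψ (y + r • a)))
      (A' := dmat G (ψ y) (fderiv ℝ ψ y a)) (t := 0)
      (fun i j ↦ HasFDerivAt.comp_hasDerivAt (l := fun z ↦ G z i j) (0 : ℝ)
        (by rw [hl0]; exact (hG i j).hasFDerivAt) hψl) (hdb b) (hdb c)
    simp only [hl0] at h2
    refine h1.unique (h2.congr_of_eventuallyEq ?_)
    have : Tendsto (fun r : ℝ ↦ y + r • a) (𝓝 0) (𝓝 y) := by
      simpa using hl.continuousAt.tendsto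
    filter_upwards [this.eventually hpull] with r hr using hr b c
  -- The defect of the transformation law. By `form_gam`, `hD` and the symmetry of the second
  -- derivative of `ψ`, it is `G`-orthogonal to the range of `fderiv ℝ ψ y`, which is everything;
  -- definiteness of `G` gives `X = 0`.
  set X := fderiv ℝ ψ y (gam g y v v) - fderiv ℝ (fderiv ℝ ψ) y v v -
    gam G (ψ y) (fderiv ℝ ψ y v) (fderiv ℝ ψ y v)
  have hX : ∀ u, form (G (ψ y)) X (fderiv ℝ ψ y u) = 0 := by
    intro u
    simp only [X, form_sub_left]
    have hc := form_comm (G (ψ y)) (fderiv ℝ ψ y v) (fderiv ℝ (fderiv ℝ ψ) y v u) (hS _)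
    rw [← hpull.self_of_nhds, form_gam hs hdet, form_gam hS hDet, hD, hD, hsymm u v]
    linear_combination (1 / 2 : ℝ) * hc
  obtain ⟨u, hu⟩ := hsurj X
  have hX0 : X = 0 := hpos X (by simpa only [hu] using hX u)
  simp only [X, sub_sub, sub_eq_zero] at hX0
  exact hX0

/-- A change of coordinates maps the geodesic vector fields to each other. -/
theorem hasFDerivAt_tangent {ψ : Coord n → Coord n} {z : Coord n × Coord n}
    (hψ : ContDiffAt ℝ 2 ψ z.1) :
    HasFDerivAt (fun z : Coord n × Coord n ↦ (ψ z.1, fderiv ℝ ψ z.1 z.2))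
      (((fderiv ℝ ψ z.1).comp (.fst ℝ (Coord n) (Coord n))).prod
        (((fderiv ℝ ψ z.1).comp (.snd ℝ (Coord n) (Coord n))) +
          ((fderiv ℝ (fderiv ℝ ψ) z.1).comp (.fst ℝ (Coord n) (Coord n))).flip z.2)) z := by
  have hψ1 : HasFDerivAt ψ (fderiv ℝ ψ z.1) z.1 :=
    (hψ.differentiableAt (by norm_num)).hasFDerivAt
  have hψ2 : HasFDerivAt (fderiv ℝ ψ) (fderiv ℝ (fderiv ℝ ψ) z.1) z.1 :=
    ((hψ.fderiv_right (m := 1) (by norm_num)).differentiableAt (by norm_num)).hasFDerivAt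
  exact (hψ1.comp z hasFDerivAt_fst).prodMk
    ((hψ2.comp z hasFDerivAt_fst).clm_apply hasFDerivAt_snd)

/-- The speed is constant along the geodesic vector field. -/
theorem hasDerivAt_energy (hs : ∀ y, (g y).IsSymm) {c w : ℝ → Coord n} {t : ℝ}
    (hdet : IsUnit (g (c t)).det) (hg : ∀ i j, DifferentiableAt ℝ (fun z ↦ g z i j) (c t))
    (hc : HasDerivAt c (w t) t) (hw : HasDerivAt w (-gam g (c t) (w t) (w t)) t) :
    HasDerivAt (fun s ↦ form (g (c s)) (w s) (w s)) 0 t := by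
  have := hasDerivAt_form (A := fun s ↦ g (c s)) (A' := dmat g (c t) (w t))
    (fun i j ↦ HasFDerivAt.comp_hasDerivAt (l := fun z ↦ g z i j) t (hg i j).hasFDerivAt hc) hw hw
  refine this.congr_deriv ?_
  -- With all three arguments of `form_gam` equal, the lowered Christoffel term is half of `form
  -- (dmat g (c t) (w t)) (w t) (w t)`; it occurs twice with a minus sign and cancels the derivative
  -- of the metric.
  rw [form_comm _ (w t) _ (hs _), form_neg_left, form_gam hs hdet]
  ring

theorem trace_prod (L : Coord n × Coord n →ₗ[ℝ] Coord n × Coord n) :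
    LinearMap.trace ℝ _ L =
      LinearMap.trace ℝ (Coord n) (LinearMap.fst ℝ _ _ ∘ₗ L ∘ₗ LinearMap.inl ℝ _ _) +
      LinearMap.trace ℝ (Coord n) (LinearMap.snd ℝ _ _ ∘ₗ L ∘ₗ LinearMap.inr ℝ _ _) := by
  have hL : L = (L ∘ₗ LinearMap.inl ℝ _ _) ∘ₗ LinearMap.fst ℝ _ _ +
      (L ∘ₗ LinearMap.inr ℝ _ _) ∘ₗ LinearMap.snd ℝ _ _ := by
    ext <;> simp [show ((0 : Coord n), (0 : Coord n)) = 0 from rfl]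
  conv_lhs => rw [hL]
  rw [map_add, LinearMap.trace_comp_comm', LinearMap.trace_comp_comm'
    (LinearMap.snd ℝ (Coord n) (Coord n)) (L ∘ₗ LinearMap.inr ℝ _ _)]

theorem trace_coord (L : Coord n →ₗ[ℝ] Coord n) :
    LinearMap.trace ℝ (Coord n) L = ∑ k, L (EuclideanSpace.single k 1) k := by
  rw [LinearMap.trace_eq_matrix_trace ℝ (EuclideanSpace.basisFun (Fin n) ℝ).toBasis,
    Matrix.trace]
  simp [LinearMap.toMatrix_apply]

/-- In the contraction `Γᵏᵢₖ` the last two derivative terms cancel by symmetry of `g⁻¹`, which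
leaves `½ gᵏˡ ∂ᵢ gₖₗ`. -/
theorem trace_gam (hs : ∀ y, (g y).IsSymm) (y v : Coord n) :
    ∑ k, gam g y v (EuclideanSpace.single k 1) k =
      (1 / 2 : ℝ) * ((g y)⁻¹ * dmat g y v).trace := by
  have h1 : ∀ k, gam g y v (EuclideanSpace.single k 1) k = ∑ i, chris g k i k y * v i := by
    intro k
    simp only [gam]
    refine Finset.sum_congr rfl fun i _ ↦ ?_
    rw [Finset.sum_eq_single k]
    · simp
    · intro b _ hb
      simp [hb.symm]
    · simp
  have hinv : (g y)⁻¹.IsSymm := (hs y).inv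
  have h2 : ∀ i, ∑ k, chris g k i k y = (1 / 2 : ℝ) *
      ∑ k, ∑ l, (g y)⁻¹ k l * dmat g y (EuclideanSpace.single i 1) k l := by
    intro i
    unfold chris
    rw [← Finset.mul_sum]
    congr 1
    simp only [add_sub_assoc, mul_add, Finset.sum_add_distrib]
    rw [add_eq_left]
    simp only [mul_sub, Finset.sum_sub_distrib, sub_eq_zero]
    rw [Finset.sum_comm]
    refine Finset.sum_congr rfl fun k _ ↦ Finset.sum_congr rfl fun l _ ↦ ?_
    rw [hinv.apply k l]
  simp only [h1]
  rw [Finset.sum_comm]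
  simp only [← Finset.sum_mul, h2]
  simp only [Matrix.trace, Matrix.diag, Matrix.mul_apply]
  simp only [dmat_eq_sum y v, Finset.mul_sum, Finset.sum_mul]
  rw [Finset.sum_comm]
  refine Finset.sum_congr rfl fun k _ ↦ ?_
  rw [Finset.sum_comm]
  refine Finset.sum_congr rfl fun l _ ↦ Finset.sum_congr rfl fun i _ ↦ ?_
  rw [(dmat_isSymm hs y _).apply k l]
  ring

section Smooth

variable {Ω : Set (Coord n)} {m : ℕ∞ω}

theorem contDiffOn_det (hg : ∀ i j, ContDiffOn ℝ m (fun z ↦ g z i j) Ω) :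
    ContDiffOn ℝ m (fun z ↦ (g z).det) Ω := by
  simp only [Matrix.det_apply]
  exact ContDiffOn.sum fun σ _ ↦ (contDiffOn_prod fun i _ ↦ hg _ _).const_smul _

theorem contDiffOn_inv (hg : ∀ i j, ContDiffOn ℝ m (fun z ↦ g z i j) Ω)
    (hdet : ∀ y ∈ Ω, (g y).det ≠ 0) (k l : Fin n) :
    ContDiffOn ℝ m (fun z ↦ (g z)⁻¹ k l) Ω := by
  simp only [Matrix.inv_def, Matrix.smul_apply, Ring.inverse_eq_inv', smul_eq_mul,
    Matrix.adjugate_apply]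
  refine ((contDiffOn_det hg).inv hdet).mul ?_
  refine contDiffOn_det (g := fun z ↦ (g z).updateRow l (Pi.single k 1)) fun i j ↦ ?_
  by_cases h : i = l
  · subst h
    simp only [Matrix.updateRow_self]
    exact contDiffOn_const
  · simp only [Matrix.updateRow_ne h]
    exact hg i j

theorem contDiffOn_chris (hΩ : IsOpen Ω) (hg : ∀ i j, ContDiffOn ℝ ∞ (fun z ↦ g z i j) Ω)
    (hdet : ∀ y ∈ Ω, (g y).det ≠ 0) (k i j : Fin n) : ContDiffOn ℝ ∞ (chris g k i j) Ω := by
  have hd : ∀ (v : Coord n) i j, ContDiffOn ℝ ∞ (fun y ↦ dmat g y v i j) Ω := fun v i j ↦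
    ((hg i j).fderiv_of_isOpen hΩ (by simp)).clm_apply contDiffOn_const
  exact contDiffOn_const.mul (ContDiffOn.sum fun l _ ↦ (contDiffOn_inv hg hdet k l).mul
    (((hd _ _ _).add (hd _ _ _)).sub (hd _ _ _)))

theorem contDiffOn_spray (hΩ : IsOpen Ω) (hg : ∀ i j, ContDiffOn ℝ ∞ (fun z ↦ g z i j) Ω)
    (hdet : ∀ y ∈ Ω, (g y).det ≠ 0) : ContDiffOn ℝ ∞ (spray g) (Ω ×ˢ univ) := by
  refine contDiffOn_snd.prodMk (ContDiffOn.neg ?_)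
  rw [contDiffOn_euclidean]
  intro k
  have hc : ∀ i : Fin n, ContDiffOn ℝ ∞ (fun z : Coord n × Coord n ↦ z.2 i) (Ω ×ˢ univ) := fun i ↦
    ((EuclideanSpace.proj (𝕜 := ℝ) i).contDiff.comp contDiff_snd).contDiffOn
  have : ContDiffOn ℝ ∞ (fun z : Coord n × Coord n ↦
      ∑ i, ∑ j, chris g k i j z.1 * z.2 i * z.2 j) (Ω ×ˢ univ) :=
    ContDiffOn.sum fun i _ ↦ ContDiffOn.sum fun j _ ↦
    (((contDiffOn_chris hΩ hg hdet k i j).comp contDiffOn_fst fun z hz ↦ hz.1).mul (hc i)).mul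
      (hc j)
  exact this

theorem contDiffOn_form (hg : ∀ i j, ContDiffOn ℝ m (fun z ↦ g z i j) Ω) :
    ContDiffOn ℝ m (fun z : Coord n × Coord n ↦ form (g z.1) z.2 z.2) (Ω ×ˢ univ) := by
  have hc : ∀ i : Fin n, ContDiffOn ℝ m (fun z : Coord n × Coord n ↦ z.2 i) (Ω ×ˢ univ) := fun i ↦
    ((EuclideanSpace.proj (𝕜 := ℝ) i).contDiff.comp contDiff_snd).contDiffOn
  exact ContDiffOn.sum fun i _ ↦ ContDiffOn.sum fun j _ ↦
    (((hg i j).comp contDiffOn_fst fun z hz ↦ hz.1).mul (hc i)).mul (hc j)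

variable (g) in
/-- The density `c · det g · exp (-|v|² / 2)` on phase space. -/
def density (c : ℝ) (z : Coord n × Coord n) : ℝ :=
  c * ((g z.1).det * Real.exp (-(form (g z.1) z.2 z.2) / 2))

theorem differentiableAt_density (hΩ : IsOpen Ω) (hg : ∀ i j, ContDiffOn ℝ ∞ (fun z ↦ g z i j) Ω)
    (c : ℝ) {z : Coord n × Coord n} (hz : z ∈ Ω ×ˢ univ) :
    DifferentiableAt ℝ (density g c) z := by
  have h1 : ContDiffOn ℝ ∞ (density g c) (Ω ×ˢ univ) :=
    contDiffOn_const.mul (((contDiffOn_det hg).comp contDiffOn_fst fun z hz ↦ hz.1).mul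
      (((contDiffOn_form hg).neg.div_const 2).exp))
  exact (h1.contDiffAt ((hΩ.prod isOpen_univ).mem_nhds hz)).differentiableAt (by simp)

/-- The position component `v` does not depend on the position, so its diagonal block is zero. The
velocity component is quadratic, so its diagonal block is `-2 Γ(v, ·)`, whose trace is given by
`trace_gam`. -/
theorem trace_fderiv_spray (hs : ∀ y, (g y).IsSymm) {z : Coord n × Coord n}
    (hF : DifferentiableAt ℝ (spray g) z) :
    LinearMap.trace ℝ _ (fderiv ℝ (spray g) z : Coord n × Coord n →ₗ[ℝ] Coord n × Coord n) =
      -((g z.1)⁻¹ * dmat g z.1 z.2).trace := by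
  set L := fderiv ℝ (spray g) z
  have hL1 : ∀ a, (L a).1 = a.2 := by
    intro a
    have h1 : HasFDerivAt (fun z : Coord n × Coord n ↦ z.2) ((.fst ℝ _ _ : _ →L[ℝ] Coord n).comp L) z :=
      hF.hasFDerivAt.fst
    have := h1.unique hasFDerivAt_snd
    exact congrArg (fun f : Coord n × Coord n →L[ℝ] Coord n ↦ f a) this
  have hL2 : ∀ b k, (L (0, b)).2 k = -(2 * gam g z.1 z.2 b k) := by
    intro b k
    have hl : HasDerivAt (fun r : ℝ ↦ z + r • ((0 : Coord n), b)) ((0 : Coord n), b) 0 := by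
      simpa using! ((hasDerivAt_id (0 : ℝ)).smul_const ((0 : Coord n), b)).const_add z
    have h1 : HasDerivAt (fun r : ℝ ↦ spray g (z + r • ((0 : Coord n), b))) (L (0, b)) 0 :=
      HasFDerivAt.comp_hasDerivAt (l := spray g) (0 : ℝ) (by simpa using hF.hasFDerivAt) hl
    have h2 : HasDerivAt (fun r : ℝ ↦ (spray g (z + r • ((0 : Coord n), b))).2 k)
        ((L (0, b)).2 k) 0 :=
      (EuclideanSpace.proj (𝕜 := ℝ) k).hasFDerivAt.comp_hasDerivAt (0 : ℝ) h1.snd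
    have hw : HasDerivAt (fun r : ℝ ↦ z.2 + r • b) b 0 := by
      simpa using! ((hasDerivAt_id (0 : ℝ)).smul_const b).const_add z.2
    have h3 := (hasDerivAt_form (A := fun _ ↦ Matrix.of fun i j ↦ chris g k i j z.1) (A' := 0)
      (fun i j ↦ hasDerivAt_const 0 _) hw hw).neg
    have h4 : (fun r : ℝ ↦ (spray g (z + r • ((0 : Coord n), b))).2 k) = -fun r : ℝ ↦
        form (Matrix.of fun i j ↦ chris g k i j z.1) (z.2 + r • b) (z.2 + r • b) := by
      funext r
      simp [spray, gam, form]
    rw [h4] at h2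
    rw [h2.unique h3]
    have hC : (Matrix.of fun i j ↦ chris g k i j z.1).IsSymm := by
      ext i j
      exact chris_symm hs k j i z.1
    have h5 : form (Matrix.of fun i j ↦ chris g k i j z.1) z.2 b = gam g z.1 z.2 b k := rfl
    simp only [zero_smul, add_zero]
    rw [form_comm _ b z.2 hC, h5]
    simp [form]
    ring
  rw [trace_prod, trace_coord, trace_coord]
  have h1 : ∀ k : Fin n, (LinearMap.fst ℝ (Coord n) (Coord n) ∘ₗ
      (L : Coord n × Coord n →ₗ[ℝ] Coord n × Coord n) ∘ₗ LinearMap.inl ℝ _ _)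
        (EuclideanSpace.single k 1) k = 0 := by
    intro k
    simp [hL1]
  have h2 : ∀ k : Fin n, (LinearMap.snd ℝ (Coord n) (Coord n) ∘ₗ
      (L : Coord n × Coord n →ₗ[ℝ] Coord n × Coord n) ∘ₗ LinearMap.inr ℝ _ _)
        (EuclideanSpace.single k 1) k = -(2 * gam g z.1 z.2 (EuclideanSpace.single k 1) k) := by
    intro k
    simp [hL2]
  simp only [h1, h2, Finset.sum_const_zero, Finset.sum_neg_distrib, ← Finset.mul_sum,
    trace_gam hs]
  ring

/-- The continuity equation for the geodesic vector field. -/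
theorem density_continuity_equation (hΩ : IsOpen Ω)
    (hg : ∀ i j, ContDiffOn ℝ ∞ (fun z ↦ g z i j) Ω) (hdet : ∀ y ∈ Ω, (g y).det ≠ 0)
    (hs : ∀ y, (g y).IsSymm) (c : ℝ) {z : Coord n × Coord n} (hz : z ∈ Ω ×ˢ univ) :
    fderiv ℝ (density g c) z (spray g z) + LinearMap.trace ℝ _
      (fderiv ℝ (spray g) z : Coord n × Coord n →ₗ[ℝ] Coord n × Coord n) * density g c z = 0 := by
  have hF : DifferentiableAt ℝ (spray g) z :=
    ((contDiffOn_spray hΩ hg hdet).contDiffAt ((hΩ.prod isOpen_univ).mem_nhds hz)).differentiableAt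
      (by simp)
  have hgd : ∀ i j, DifferentiableAt ℝ (fun z ↦ g z i j) z.1 := fun i j ↦
    ((hg i j).contDiffAt (hΩ.mem_nhds hz.1)).differentiableAt (by simp)
  have hu : IsUnit (g z.1).det := (hdet _ hz.1).isUnit
  have hl : HasDerivAt (fun r : ℝ ↦ z + r • spray g z) (spray g z) 0 := by
    simpa using! ((hasDerivAt_id (0 : ℝ)).smul_const (spray g z)).const_add z
  have h1 : HasDerivAt (fun r : ℝ ↦ density g c (z + r • spray g z))
      (fderiv ℝ (density g c) z (spray g z)) 0 :=
    HasFDerivAt.comp_hasDerivAt (l := density g c) (0 : ℝ)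
      (by simpa using (differentiableAt_density hΩ hg c hz).hasFDerivAt) hl
  have hc : HasDerivAt (fun r : ℝ ↦ (z + r • spray g z).1) z.2 0 := hl.fst
  have hw : HasDerivAt (fun r : ℝ ↦ (z + r • spray g z).2) (-gam g z.1 z.2 z.2) 0 := hl.snd
  -- Along the field the energy is stationary, so only `det g` contributes to the derivative of the
  -- density; by Jacobi's formula its logarithmic derivative is the negative of the divergence.
  have h2 : HasDerivAt (fun r : ℝ ↦ form (g (z + r • spray g z).1) (z + r • spray g z).2
      (z + r • spray g z).2) 0 0 :=
    hasDerivAt_energy hs (by simpa using hu) (by simpa using hgd) (by simpa using hc)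
      (by simpa using hw)
  have h3 : HasDerivAt (fun r : ℝ ↦ (g (z + r • spray g z).1).det)
      ((dmat g z.1 z.2 * (g z.1)⁻¹).trace * (g z.1).det) 0 := by
    have := hasDerivAt_matrix_det (M := fun r : ℝ ↦ g (z + r • spray g z).1)
      (A := dmat g z.1 z.2 * (g z.1)⁻¹) (t := 0) fun i j ↦ ?_
    · simpa using this
    · have h4 : dmat g z.1 z.2 * (g z.1)⁻¹ * g (z + (0 : ℝ) • spray g z).1 = dmat g z.1 z.2 := by
        rw [zero_smul, add_zero, Matrix.mul_assoc, Matrix.nonsing_inv_mul _ hu, Matrix.mul_one]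
      rw [h4]
      exact HasFDerivAt.comp_hasDerivAt (l := fun z ↦ g z i j) (0 : ℝ)
        (by simpa using (hgd i j).hasFDerivAt) hc
  have h5 := ((h3.mul ((h2.neg.div_const 2).exp)).const_mul c)
  rw [h1.unique h5, trace_fderiv_spray hs hF, Matrix.trace_mul_comm]
  simp [density]
  ring

end Smooth

end LocalMetric

open LocalMetric

namespace GeodesicWalk

/-! ### Charts of the tangent bundle -/

section PhaseChart

variable {n : ℕ} {M : Type*} [TopologicalSpace M] [ChartedSpace (EuclideanSpace ℝ (Fin n)) M]

/-- The change of coordinates from the chart at `x₀` to the chart at `x₁`. -/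
def transition (x₀ x₁ : M) (y : Coord n) : Coord n :=
  extChartAt (𝓡 n) x₁ ((extChartAt (𝓡 n) x₀).symm y)

theorem transition_extChartAt {x₀ x₁ x : M} (hx : x ∈ (extChartAt (𝓡 n) x₀).source) :
    transition x₀ x₁ (extChartAt (𝓡 n) x₀ x) = extChartAt (𝓡 n) x₁ x := by
  simp only [transition, (extChartAt (𝓡 n) x₀).left_inv hx]

theorem eventually_mem_source {x₀ x₁ x : M} (h₀ : x ∈ (extChartAt (𝓡 n) x₀).source)
    (h₁ : x ∈ (extChartAt (𝓡 n) x₁).source) :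
    ∀ᶠ y in 𝓝 (extChartAt (𝓡 n) x₀ x), y ∈ (extChartAt (𝓡 n) x₀).target ∧
      (extChartAt (𝓡 n) x₀).symm y ∈ (extChartAt (𝓡 n) x₁).source := by
  have hc : ContinuousAt (extChartAt (𝓡 n) x₀).symm (extChartAt (𝓡 n) x₀ x) :=
    continuousAt_extChartAt_symm' h₀
  rw [ContinuousAt, (extChartAt (𝓡 n) x₀).left_inv h₀] at hc
  refine Filter.Eventually.and ?_ (hc ((isOpen_extChartAt_source (I := 𝓡 n) x₁).mem_nhds h₁))
  exact (isOpen_extChartAt_target (I := 𝓡 n) x₀).mem_nhds ((extChartAt (𝓡 n) x₀).map_source h₀)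

variable [IsManifold (𝓡 n) ∞ M]

/-- The chart of the tangent bundle induced by the chart of `M` at `x₀`. -/
def phaseChart (x₀ : M) : OpenPartialHomeomorph (TangentBundle (𝓡 n) M) (Coord n × Coord n) :=
  (trivializationAt (Coord n) (TangentSpace (𝓡 n) : M → Type _) x₀).toOpenPartialHomeomorph ≫ₕ
    (chartAt (Coord n) x₀).prod (OpenPartialHomeomorph.refl (Coord n))

theorem mem_phaseChart_source {x₀ : M} {p : TangentBundle (𝓡 n) M} :
    p ∈ (phaseChart x₀).source ↔ p.1 ∈ (extChartAt (𝓡 n) x₀).source := by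
  simp [phaseChart]

theorem phaseChart_target (x₀ : M) :
    (phaseChart (n := n) x₀).target = (extChartAt (𝓡 n) x₀).target ×ˢ univ := by
  ext z
  simp +contextual [phaseChart]

theorem mem_phaseChart_target {x₀ : M} {z : Coord n × Coord n} :
    z ∈ (phaseChart x₀).target ↔ z.1 ∈ (extChartAt (𝓡 n) x₀).target := by
  simp [phaseChart_target]

theorem phaseChart_apply (x₀ : M) (p : TangentBundle (𝓡 n) M) :
    phaseChart x₀ p = (extChartAt (𝓡 n) x₀ p.1, tangentCoordChange (𝓡 n) p.1 x₀ p.1 p.2) :=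
  rfl

theorem phaseChart_symm_apply (x₀ : M) (z : Coord n × Coord n) :
    (phaseChart x₀).symm z = ⟨(extChartAt (𝓡 n) x₀).symm z.1,
      tangentCoordChange (𝓡 n) x₀ ((extChartAt (𝓡 n) x₀).symm z.1)
        ((extChartAt (𝓡 n) x₀).symm z.1) z.2⟩ :=
  rfl

theorem tangentCoordChange_eq_fderiv (x₀ x₁ x : M) :
    tangentCoordChange (𝓡 n) x₀ x₁ x =
      fderiv ℝ (transition (n := n) x₀ x₁) (extChartAt (𝓡 n) x₀ x) := by
  rw [tangentCoordChange_def]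
  simp only [modelWithCornersSelf_coe, range_id, fderivWithin_univ]
  rfl

theorem contDiffAt_transition {x₀ x₁ x : M} (h₀ : x ∈ (extChartAt (𝓡 n) x₀).source)
    (h₁ : x ∈ (extChartAt (𝓡 n) x₁).source) :
    ContDiffAt ℝ ∞ (transition (n := n) x₀ x₁) (extChartAt (𝓡 n) x₀ x) := by
  have h := contDiffWithinAt_ext_coord_change (I := 𝓡 n) (n := ∞) x₁ x₀
    (y := extChartAt (𝓡 n) x₀ x) (by
      rw [PartialEquiv.trans_source'', PartialEquiv.symm_symm, PartialEquiv.symm_target]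
      exact mem_image_of_mem _ ⟨h₀, h₁⟩)
  simp only [modelWithCornersSelf_coe, range_id, contDiffWithinAt_univ] at h
  exact h

/-- The fibre over `x` is identified with the coordinate space through the chart at `x` itself; the
cocycle identity through this intermediate chart leaves the derivative of the transition. -/
theorem phaseChart_phaseChart_symm {x₀ x₁ : M} {z : Coord n × Coord n}
    (h₀ : z.1 ∈ (extChartAt (𝓡 n) x₀).target)
    (h₁ : (extChartAt (𝓡 n) x₀).symm z.1 ∈ (extChartAt (𝓡 n) x₁).source) :
    phaseChart x₁ ((phaseChart x₀).symm z) =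
      (transition x₀ x₁ z.1, fderiv ℝ (transition (n := n) x₀ x₁) z.1 z.2) := by
  set x := (extChartAt (𝓡 n) x₀).symm z.1 with hx
  have hx₀ : x ∈ (extChartAt (𝓡 n) x₀).source := (extChartAt (𝓡 n) x₀).map_target h₀
  have hz : extChartAt (𝓡 n) x₀ x = z.1 := (extChartAt (𝓡 n) x₀).right_inv h₀
  rw [phaseChart_symm_apply, phaseChart_apply]
  refine Prod.ext rfl ?_
  have := tangentCoordChange_comp (I := 𝓡 n) (w := x₀) (x := x) (y := x₁) (z := x) (v := z.2)
    ⟨⟨hx₀, mem_extChartAt_source (I := 𝓡 n) x⟩, h₁⟩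
  rw [tangentCoordChange_eq_fderiv x₀ x₁, hz] at this
  exact this

/-- The tangent vector at `x` with the given coordinates in the chart at `x₀`. -/
def toTangent (x₀ x : M) : Coord n →L[ℝ] TangentSpace (𝓡 n) x := tangentCoordChange (𝓡 n) x₀ x x

/-- The coordinates of a tangent vector at `x` in the chart at `x₀`. -/
def ofTangent (x₀ x : M) : TangentSpace (𝓡 n) x →L[ℝ] Coord n := tangentCoordChange (𝓡 n) x x₀ x

theorem phaseChart_mk (x₀ x : M) (v : TangentSpace (𝓡 n) x) :
    phaseChart x₀ ⟨x, v⟩ = (extChartAt (𝓡 n) x₀ x, ofTangent x₀ x v) :=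
  rfl

theorem ofTangent_toTangent {x₀ x : M} (hx : x ∈ (extChartAt (𝓡 n) x₀).source) (x₁ : M)
    (hx₁ : x ∈ (extChartAt (𝓡 n) x₁).source) (u : Coord n) :
    ofTangent x₁ x (toTangent x₀ x u) =
      fderiv ℝ (transition (n := n) x₀ x₁) (extChartAt (𝓡 n) x₀ x) u := by
  rw [← tangentCoordChange_eq_fderiv]
  exact tangentCoordChange_comp (I := 𝓡 n) ⟨⟨hx, mem_extChartAt_source (I := 𝓡 n) x⟩, hx₁⟩

theorem ofTangent_toTangent_self {x₀ x : M} (hx : x ∈ (extChartAt (𝓡 n) x₀).source) (u : Coord n) :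
    ofTangent x₀ x (toTangent x₀ x u) = u := by
  rw [ofTangent_toTangent hx x₀ hx, ← tangentCoordChange_eq_fderiv, tangentCoordChange_self hx]

theorem toTangent_ofTangent {x₀ x : M} (hx : x ∈ (extChartAt (𝓡 n) x₀).source)
    (v : TangentSpace (𝓡 n) x) : toTangent x₀ x (ofTangent x₀ x v) = v :=
  (tangentCoordChange_comp (I := 𝓡 n) (w := x) (x := x₀) (y := x) (z := x) (v := v)
    ⟨⟨mem_extChartAt_source (I := 𝓡 n) x, hx⟩, mem_extChartAt_source (I := 𝓡 n) x⟩).trans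
    (tangentCoordChange_self (mem_extChartAt_source (I := 𝓡 n) x))

theorem mfderiv_extChartAt_symm {x₀ : M} {y : Coord n} (hy : y ∈ (extChartAt (𝓡 n) x₀).target)
    (u : Coord n) :
    mfderiv 𝓘(ℝ, Coord n) (𝓡 n) (extChartAt (𝓡 n) x₀).symm y u =
      toTangent x₀ ((extChartAt (𝓡 n) x₀).symm y) u := by
  have hd : MDifferentiableAt 𝓘(ℝ, Coord n) (𝓡 n) (extChartAt (𝓡 n) x₀).symm y := by
    have := mdifferentiableWithinAt_extChartAt_symm (I := 𝓡 n) hy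
    simpa using! this
  refine (DFunLike.congr_fun hd.mfderiv u).trans ?_
  rw [toTangent, tangentCoordChange_eq_fderiv, (extChartAt (𝓡 n) x₀).right_inv hy]
  simp only [writtenInExtChartAt, modelWithCornersSelf_coe, range_id, fderivWithin_univ]
  rfl

end PhaseChart

/-! ### The metric in coordinates: symmetry, positivity and smoothness -/

section Metric

variable {n : ℕ} {M : Type*} [TopologicalSpace M] [ChartedSpace (EuclideanSpace ℝ (Fin n)) M]
  [RiemannianBundle (fun x : M ↦ TangentSpace (𝓡 n) x)]

theorem metricMatrix_isSymm (x₀ : M) (y : Coord n) : (metricMatrix x₀ y).IsSymm := by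
  ext i j
  exact real_inner_comm (coordField x₀ i y) (coordField x₀ j y)

theorem form_metricMatrix' (x₀ : M) (y u w : Coord n) :
    form (metricMatrix x₀ y) u w =
      inner ℝ (mfderiv 𝓘(ℝ, Coord n) (𝓡 n) (extChartAt (𝓡 n) x₀).symm y u)
        (mfderiv 𝓘(ℝ, Coord n) (𝓡 n) (extChartAt (𝓡 n) x₀).symm y w) := by
  have hv : ∀ v : Coord n, v = ∑ k, v k • (EuclideanSpace.single k 1 : Coord n) := by
    intro v
    ext m
    simp [Finset.sum_apply, Pi.single_apply]
  set D : Coord n →L[ℝ] TangentSpace (𝓡 n) ((extChartAt (𝓡 n) x₀).symm y) :=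
    mfderiv 𝓘(ℝ, Coord n) (𝓡 n) (extChartAt (𝓡 n) x₀).symm y
  have hD : ∀ v : Coord n, D v = ∑ k, v k • D (EuclideanSpace.single k 1) := fun v ↦ by
    conv_lhs => rw [hv v]
    simp only [map_sum, map_smul]
  change _ = inner ℝ (D u) (D w)
  rw [hD u, hD w, sum_inner]
  simp only [inner_sum, inner_smul_left, inner_smul_right, form]
  refine Finset.sum_congr rfl fun i _ ↦ Finset.sum_congr rfl fun j _ ↦ ?_
  have : metricMatrix x₀ y i j =
    inner ℝ (D (EuclideanSpace.single i 1)) (D (EuclideanSpace.single j 1)) := rfl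
  rw [this]
  simp
  ring

variable [IsManifold (𝓡 n) ∞ M]

theorem form_metricMatrix {x₀ x : M} (hx : x ∈ (extChartAt (𝓡 n) x₀).source) (u w : Coord n) :
    form (metricMatrix x₀ (extChartAt (𝓡 n) x₀ x)) u w =
      inner ℝ (toTangent x₀ x u) (toTangent x₀ x w) := by
  have hy := (extChartAt (𝓡 n) x₀).map_source hx
  rw [form_metricMatrix', mfderiv_extChartAt_symm hy, mfderiv_extChartAt_symm hy,
    (extChartAt (𝓡 n) x₀).left_inv hx]

theorem eq_zero_of_form_metricMatrix {x₀ x : M} (hx : x ∈ (extChartAt (𝓡 n) x₀).source)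
    {u : Coord n} (h : form (metricMatrix x₀ (extChartAt (𝓡 n) x₀ x)) u u = 0) : u = 0 := by
  rw [form_metricMatrix hx, inner_self_eq_zero] at h
  rw [← ofTangent_toTangent_self hx u, h, map_zero]

theorem posDef_metricMatrix {x₀ : M} {y : Coord n} (hy : y ∈ (extChartAt (𝓡 n) x₀).target) :
    (metricMatrix x₀ y).PosDef := by
  have hx := (extChartAt (𝓡 n) x₀).map_target hy
  have hyx := (extChartAt (𝓡 n) x₀).right_inv hy
  refine Matrix.PosDef.of_dotProduct_mulVec_pos ?_ fun {v} hv ↦ ?_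
  · rw [Matrix.IsHermitian, Matrix.conjTranspose_eq_transpose_of_trivial]
    exact metricMatrix_isSymm x₀ y
  · have h1 : star v ⬝ᵥ (metricMatrix x₀ y).mulVec v =
        form (metricMatrix x₀ y) (WithLp.toLp 2 v) (WithLp.toLp 2 v) := by
      simp only [form, dotProduct, Matrix.mulVec, star_trivial, Finset.mul_sum]
      refine Finset.sum_congr rfl fun i _ ↦ Finset.sum_congr rfl fun j _ ↦ ?_
      ring
    rw [h1]
    refine lt_of_le_of_ne ?_ fun h0 ↦ hv ?_
    · rw [← hyx, form_metricMatrix hx]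
      exact real_inner_self_nonneg
    · rw [← hyx] at h0
      have := eq_zero_of_form_metricMatrix hx h0.symm
      simpa using this

theorem det_metricMatrix_pos {x₀ : M} {y : Coord n} (hy : y ∈ (extChartAt (𝓡 n) x₀).target) :
    0 < (metricMatrix x₀ y).det := (posDef_metricMatrix hy).det_pos

variable [IsContMDiffRiemannianBundle (𝓡 n) ∞ (EuclideanSpace ℝ (Fin n))
      (fun x : M ↦ TangentSpace (𝓡 n) x)]

/-- The coordinate fields are constant in the trivialization at `x₀`, hence smooth sections, and the
metric pairs smooth sections to smooth functions. -/
theorem contDiffOn_metricMatrix (x₀ : M) (i j : Fin n) :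
    ContDiffOn ℝ ∞ (fun y ↦ metricMatrix x₀ y i j) (extChartAt (𝓡 n) x₀).target := by
  have hsec : ∀ i, ContMDiffOn 𝓘(ℝ, Coord n) (𝓡 n).tangent ∞
      (fun y ↦ (⟨(extChartAt (𝓡 n) x₀).symm y, coordField x₀ i y⟩ : TangentBundle (𝓡 n) M))
      (extChartAt (𝓡 n) x₀).target := by
    intro i
    set e := trivializationAt (Coord n) (TangentSpace (𝓡 n) : M → Type _) x₀
    have hmem : ∀ y ∈ (extChartAt (𝓡 n) x₀).target,
        (extChartAt (𝓡 n) x₀).symm y ∈ (extChartAt (𝓡 n) x₀).source := fun y hy ↦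
      (extChartAt (𝓡 n) x₀).map_target hy
    rw [e.contMDiffOn_iff]
    · refine ⟨contMDiffOn_extChartAt_symm x₀, ?_⟩
      refine (contMDiffOn_const (c := (EuclideanSpace.single i 1 : Coord n))).congr fun y hy ↦ ?_
      rw [← ofTangent_toTangent_self (hmem y hy) (EuclideanSpace.single i 1)]
      exact congrArg (ofTangent x₀ ((extChartAt (𝓡 n) x₀).symm y))
        (mfderiv_extChartAt_symm hy (EuclideanSpace.single i 1))
    · intro y hy
      have := hmem y hy
      simpa [e] using this
  have := ContMDiffOn.inner_bundle (IB := 𝓡 n) (F := Coord n)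
    (E := fun x : M ↦ TangentSpace (𝓡 n) x) (hsec i) (hsec j)
  exact this.contDiffOn

end Metric

end GeodesicWalk

namespace GeodesicWalk

theorem two_le_infty : (2 : ℕ∞ω) ≤ (∞ : ℕ∞ω) :=
  show ((2 : ℕ∞) : ℕ∞ω) ≤ ((⊤ : ℕ∞) : ℕ∞ω) from WithTop.coe_le_coe.2 le_top

/-! ### Separation and countability of the tangent bundle -/

section TangentTopology

variable {n : ℕ} {M : Type*} [TopologicalSpace M] [ChartedSpace (EuclideanSpace ℝ (Fin n)) M]
  [IsManifold (𝓡 n) ∞ M]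

theorem mem_phaseChart_source_self (p : TangentBundle (𝓡 n) M) : p ∈ (phaseChart p.1).source :=
  mem_phaseChart_source.2 (mem_extChartAt_source (I := 𝓡 n) p.1)

/-- Vectors at different points are separated by the projection; vectors at the same point lie in a
common chart. -/
instance instT2SpaceTangentBundle [T2Space M] : T2Space (TangentBundle (𝓡 n) M) := by
  rw [t2Space_iff_disjoint_nhds]
  intro p q hpq
  by_cases h : p.1 = q.1
  · have hp := mem_phaseChart_source_self p
    have hq : q ∈ (phaseChart p.1).source := by
      rw [h]
      exact mem_phaseChart_source_self q
    exact Tendsto.disjoint ((phaseChart p.1).continuousAt hp)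
      (disjoint_nhds_nhds.2 fun he ↦ hpq ((phaseChart p.1).injOn hp hq he))
      ((phaseChart p.1).continuousAt hq)
  · have hc : Continuous fun p : TangentBundle (𝓡 n) M ↦ p.1 :=
      FiberBundle.continuous_proj (Coord n) (TangentSpace (𝓡 n) : M → Type _)
    exact Tendsto.disjoint hc.continuousAt (disjoint_nhds_nhds.2 h) hc.continuousAt

instance instSecondCountableTangentBundle [SecondCountableTopology M] :
    SecondCountableTopology (TangentBundle (𝓡 n) M) := by
  obtain ⟨s, hs, hU⟩ := TopologicalSpace.countable_cover_nhds
    (fun x : M ↦ chart_source_mem_nhds (EuclideanSpace ℝ (Fin n)) x)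
  have := hs.to_subtype
  have (i : s) : SecondCountableTopology (phaseChart (n := n) (i : M)).source :=
    (phaseChart (n := n) (i : M)).secondCountableTopology_source
  refine TopologicalSpace.secondCountableTopology_of_countable_cover
    (U := fun i : s ↦ (phaseChart (n := n) (i : M)).source)
    (fun i ↦ (phaseChart (i : M)).open_source) (eq_univ_of_forall fun p ↦ ?_)
  have hp : p.1 ∈ ⋃ x ∈ s, (chartAt (EuclideanSpace ℝ (Fin n)) x).source := hU ▸ mem_univ _
  simp only [mem_iUnion] at hp ⊢
  obtain ⟨x, hx, hp⟩ := hp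
  exact ⟨⟨x, hx⟩, mem_phaseChart_source.2 (by simpa using hp)⟩

/-- The tangent bundle carries its Borel σ-algebra. -/
instance instMeasurableSpaceTangentBundle : MeasurableSpace (TangentBundle (𝓡 n) M) := borel _

instance instBorelSpaceTangentBundle : BorelSpace (TangentBundle (𝓡 n) M) := ⟨rfl⟩

end TangentTopology

/-! ### The geodesic field on the tangent bundle -/

section Atlas

variable {n : ℕ} {M : Type*} [TopologicalSpace M] [ChartedSpace (EuclideanSpace ℝ (Fin n)) M]
  [IsManifold (𝓡 n) ∞ M]

theorem toTangent_fderiv_transition {x₀ x₁ x : M} (h₀ : x ∈ (extChartAt (𝓡 n) x₀).source)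
    (h₁ : x ∈ (extChartAt (𝓡 n) x₁).source) (u : Coord n) :
    toTangent x₁ x (fderiv ℝ (transition (n := n) x₀ x₁) (extChartAt (𝓡 n) x₀ x) u) =
      toTangent x₀ x u := by
  rw [← ofTangent_toTangent h₀ x₁ h₁, toTangent_ofTangent h₁]

theorem surjective_fderiv_transition {x₀ x₁ x : M} (h₀ : x ∈ (extChartAt (𝓡 n) x₀).source)
    (h₁ : x ∈ (extChartAt (𝓡 n) x₁).source) :
    Function.Surjective (fderiv ℝ (transition (n := n) x₀ x₁) (extChartAt (𝓡 n) x₀ x)) := fun v ↦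
  ⟨ofTangent x₀ x (toTangent x₁ x v), by
    rw [← ofTangent_toTangent h₀ x₁ h₁, toTangent_ofTangent h₀, ofTangent_toTangent_self h₁]⟩

variable [RiemannianBundle (fun x : M ↦ TangentSpace (𝓡 n) x)]

theorem form_metricMatrix_transition {x₀ x₁ x : M} (h₀ : x ∈ (extChartAt (𝓡 n) x₀).source)
    (h₁ : x ∈ (extChartAt (𝓡 n) x₁).source) (u w : Coord n) :
    form (metricMatrix x₀ (extChartAt (𝓡 n) x₀ x)) u w =
      form (metricMatrix x₁ (transition x₀ x₁ (extChartAt (𝓡 n) x₀ x)))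
        (fderiv ℝ (transition (n := n) x₀ x₁) (extChartAt (𝓡 n) x₀ x) u)
        (fderiv ℝ (transition (n := n) x₀ x₁) (extChartAt (𝓡 n) x₀ x) w) := by
  rw [transition_extChartAt h₀, form_metricMatrix h₀, form_metricMatrix h₁,
    toTangent_fderiv_transition h₀ h₁, toTangent_fderiv_transition h₀ h₁]

variable [IsContMDiffRiemannianBundle (𝓡 n) ∞ (EuclideanSpace ℝ (Fin n))
      (fun x : M ↦ TangentSpace (𝓡 n) x)]

theorem differentiableAt_metricMatrix {x₀ : M} {y : Coord n}
    (hy : y ∈ (extChartAt (𝓡 n) x₀).target) (i j : Fin n) :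
    DifferentiableAt ℝ (fun z ↦ metricMatrix x₀ z i j) y :=
  ((contDiffOn_metricMatrix x₀ i j).contDiffAt
    ((isOpen_extChartAt_target (I := 𝓡 n) x₀).mem_nhds hy)).differentiableAt (by simp)

variable (n M) in
/-- The geodesic vector field on the tangent bundle. -/
def geodesicAtlas : FieldAtlas (TangentBundle (𝓡 n) M) (Coord n × Coord n) M where
  chart := phaseChart
  field x₀ := spray (metricMatrix x₀)
  exists_mem_source p := ⟨p.1, mem_phaseChart_source_self p⟩
  contDiffOn_field x₀ := by
    rw [phaseChart_target]
    exact (contDiffOn_spray (isOpen_extChartAt_target (I := 𝓡 n) x₀) (contDiffOn_metricMatrix x₀)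
      fun y hy ↦ (det_metricMatrix_pos hy).ne').of_le two_le_infty
  exists_hasFDerivAt x₀ x₁ p h₀ h₁ := by
    rw [mem_phaseChart_source] at h₀ h₁
    set y := extChartAt (𝓡 n) x₀ p.1 with hy
    set ψ := transition (n := n) x₀ x₁ with hψ
    have hev := eventually_mem_source h₀ h₁
    have hyt : y ∈ (extChartAt (𝓡 n) x₀).target := (extChartAt (𝓡 n) x₀).map_source h₀
    have hyt₁ : ψ y ∈ (extChartAt (𝓡 n) x₁).target := by
      rw [hψ, hy, transition_extChartAt h₀]
      exact (extChartAt (𝓡 n) x₁).map_source h₁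
    have hd : ContDiffAt ℝ 2 ψ y := (contDiffAt_transition h₀ h₁).of_le two_le_infty
    refine ⟨_, (hasFDerivAt_tangent (z := phaseChart x₀ p) hd).congr_of_eventuallyEq ?_, ?_⟩
    · have : ∀ᶠ z : Coord n × Coord n in 𝓝 (phaseChart x₀ p),
          z.1 ∈ (extChartAt (𝓡 n) x₀).target ∧
          (extChartAt (𝓡 n) x₀).symm z.1 ∈ (extChartAt (𝓡 n) x₁).source :=
        (continuous_fst.tendsto (phaseChart x₀ p)).eventually hev
      filter_upwards [this] with z hz
      exact phaseChart_phaseChart_symm hz.1 hz.2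
    · have hval : phaseChart x₁ p = (ψ y, fderiv ℝ ψ y (phaseChart x₀ p).2) := by
        conv_lhs => rw [← (phaseChart x₀).left_inv (mem_phaseChart_source.2 h₀)]
        exact phaseChart_phaseChart_symm hyt
          (by rw [phaseChart_apply, (extChartAt (𝓡 n) x₀).left_inv h₀]; exact h₁)
      -- Compatibility of the velocity components is the transformation law of the Christoffel
      -- symbols, which applies because changes of charts are isometries for the two metric
      -- matrices.
      have htr := gam_transform (g := metricMatrix x₀) (G := metricMatrix x₁) (ψ := ψ) (y := y)
        (metricMatrix_isSymm x₀) (metricMatrix_isSymm x₁)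
        (isUnit_iff_ne_zero.2 (det_metricMatrix_pos hyt).ne')
        (isUnit_iff_ne_zero.2 (det_metricMatrix_pos hyt₁).ne')
        (fun u hu ↦ eq_zero_of_form_metricMatrix h₁
          (by rwa [hψ, hy, transition_extChartAt h₀] at hu))
        (differentiableAt_metricMatrix hyt) (differentiableAt_metricMatrix hyt₁) hd
        (surjective_fderiv_transition h₀ h₁) (by
          filter_upwards [hev] with z hz u w
          have := form_metricMatrix_transition (x₀ := x₀) (x₁ := x₁)
            ((extChartAt (𝓡 n) x₀).map_target hz.1) hz.2 u w
          rwa [(extChartAt (𝓡 n) x₀).right_inv hz.1] at this) (phaseChart x₀ p).2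
      rw [hval]
      have h1 : (phaseChart x₀ p).1 = y := rfl
      refine Prod.ext ?_ ?_
      · simp [spray, h1]
      · simp only [spray, h1, ContinuousLinearMap.prod_apply, add_apply,
          ContinuousLinearMap.comp_apply, ContinuousLinearMap.coe_fst', ContinuousLinearMap.coe_snd',
          ContinuousLinearMap.flip_apply, map_neg, htr]
        abel

end Atlas

end GeodesicWalk

/-- Solutions of a smooth autonomous differential equation are smooth. -/
theorem contDiffOn_of_hasDerivAt {V : Type*} [NormedAddCommGroup V] [NormedSpace ℝ V]
    {F : V → V} {Ω : Set V} (hF : ContDiffOn ℝ ∞ F Ω) {z : ℝ → V} {U : Set ℝ} (hU : IsOpen U)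
    (hz : ∀ t ∈ U, HasDerivAt z (F (z t)) t) (hΩ : MapsTo z U Ω) : ContDiffOn ℝ ∞ z U := by
  rw [contDiffOn_infty]
  intro k
  induction k with
  | zero =>
    exact contDiffOn_zero.2 fun t ht ↦ (hz t ht).continuousAt.continuousWithinAt
  | succ k ih =>
    have : ((k + 1 : ℕ) : ℕ∞ω) = (k : ℕ∞ω) + 1 := by norm_cast
    rw [this, contDiffOn_succ_iff_deriv_of_isOpen hU]
    refine ⟨fun t ht ↦ (hz t ht).differentiableAt.differentiableWithinAt, by simp, ?_⟩
    exact (((contDiffOn_infty.1 hF k).comp ih hΩ)).congr fun t ht ↦ (hz t ht).deriv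

namespace GeodesicWalk

variable {n : ℕ} {M : Type*}

/-! ### Velocities of curves in coordinates -/

section Velocity

variable [TopologicalSpace M] [ChartedSpace (EuclideanSpace ℝ (Fin n)) M] [IsManifold (𝓡 n) ∞ M]

theorem hasDerivAt_extChartAt_comp {γ : ℝ → M} {t : ℝ} {v : TangentSpace (𝓡 n) (γ t)}
    (h : HasMFDerivAt 𝓘(ℝ, ℝ) (𝓡 n) γ t (ContinuousLinearMap.toSpanSingleton ℝ v)) {x₀ : M}
    (hx : γ t ∈ (extChartAt (𝓡 n) x₀).source) :
    HasDerivAt (fun s ↦ extChartAt (𝓡 n) x₀ (γ s)) (ofTangent x₀ (γ t) v) t := by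
  have h1 : HasDerivAt (fun s ↦ extChartAt (𝓡 n) (γ t) (γ s)) (v : Coord n) t := by
    have h2 : HasFDerivWithinAt (fun s : ℝ ↦ extChartAt (𝓡 n) (γ t) (γ s))
        (ContinuousLinearMap.toSpanSingleton ℝ (v : Coord n)) (range (id : ℝ → ℝ)) t := h.2
    rw [range_id, hasFDerivWithinAt_univ] at h2
    exact h2.hasDerivAt.congr_deriv (one_smul ℝ (v : Coord n))
  have hs := mem_extChartAt_source (I := 𝓡 n) (γ t)
  have h2 : HasFDerivAt (transition (n := n) (γ t) x₀) (tangentCoordChange (𝓡 n) (γ t) x₀ (γ t))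
      (extChartAt (𝓡 n) (γ t) (γ t)) := by
    rw [tangentCoordChange_eq_fderiv]
    exact ((contDiffAt_transition hs hx).differentiableAt (by simp)).hasFDerivAt
  refine (HasFDerivAt.comp_hasDerivAt t h2 h1).congr_of_eventuallyEq ?_
  filter_upwards [h.1 ((isOpen_extChartAt_source (I := 𝓡 n) (γ t)).mem_nhds hs)] with s hs'
  exact (transition_extChartAt hs').symm

theorem hasMFDerivAt_of_hasDerivAt {γ : ℝ → M} {t : ℝ} (hc : ContinuousAt γ t)
    {v : TangentSpace (𝓡 n) (γ t)}
    (h : HasDerivAt (fun s ↦ extChartAt (𝓡 n) (γ t) (γ s)) (ofTangent (γ t) (γ t) v) t) :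
    HasMFDerivAt 𝓘(ℝ, ℝ) (𝓡 n) γ t (ContinuousLinearMap.toSpanSingleton ℝ v) := by
  have hv : ofTangent (γ t) (γ t) v = v :=
    tangentCoordChange_self (mem_extChartAt_source (I := 𝓡 n) (γ t))
  rw [hv] at h
  exact ⟨hc, h.hasFDerivAt.hasFDerivWithinAt (s := range (id : ℝ → ℝ))⟩

theorem phaseChart_velocity {γ : ℝ → M} {t : ℝ} (h : MDifferentiableAt 𝓘(ℝ, ℝ) (𝓡 n) γ t) {x₀ : M}
    (hx : γ t ∈ (extChartAt (𝓡 n) x₀).source) :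
    phaseChart x₀ (velocity (n := n) γ t) = (extChartAt (𝓡 n) x₀ (γ t),
      deriv (fun s ↦ extChartAt (𝓡 n) x₀ (γ s)) t) := by
  refine Prod.ext rfl ?_
  have h1 : HasMFDerivAt 𝓘(ℝ, ℝ) (𝓡 n) γ t (ContinuousLinearMap.toSpanSingleton ℝ
      (mfderiv 𝓘(ℝ, ℝ) (𝓡 n) γ t 1 : TangentSpace (𝓡 n) (γ t))) := by
    have e : ∀ L : ℝ →L[ℝ] TangentSpace (𝓡 n) (γ t),
        ContinuousLinearMap.toSpanSingleton ℝ (L 1) = L := fun L ↦ by ext; simp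
    exact Eq.mpr (congrArg (HasMFDerivAt 𝓘(ℝ, ℝ) (𝓡 n) γ t) (e _)) h.hasMFDerivAt
  exact (hasDerivAt_extChartAt_comp h1 hx).deriv.symm

theorem continuous_base : Continuous fun p : TangentBundle (𝓡 n) M ↦ p.1 :=
  FiberBundle.continuous_proj (Coord n) (TangentSpace (𝓡 n) : M → Type _)

/-- The fibrewise dilation of the tangent bundle. -/
def dilate (a : ℝ) (p : TangentBundle (𝓡 n) M) : TangentBundle (𝓡 n) M := ⟨p.1, a • p.2⟩

theorem phaseChart_dilate (x₀ : M) (a : ℝ) (p : TangentBundle (𝓡 n) M) :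
    phaseChart x₀ (dilate a p) = ((phaseChart x₀ p).1, a • (phaseChart x₀ p).2) :=
  Prod.ext rfl (map_smul (ofTangent x₀ p.1) a p.2)

theorem continuous_dilate (a : ℝ) : Continuous (dilate (n := n) (M := M) a) := by
  rw [continuous_iff_continuousAt]
  intro p
  have hp := mem_phaseChart_source_self p
  have hp' : dilate a p ∈ (phaseChart p.1).source := mem_phaseChart_source_self (dilate a p)
  have h1 : ContinuousAt (fun q ↦ (phaseChart p.1).symm ((phaseChart p.1 q).1,
      a • (phaseChart p.1 q).2)) p := by
    refine ContinuousAt.comp (g := (phaseChart p.1).symm) ?_ ?_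
    · rw [← phaseChart_dilate]
      exact (phaseChart p.1).continuousAt_symm ((phaseChart p.1).map_source hp')
    · have := (phaseChart p.1).continuousAt hp
      fun_prop
  refine h1.congr ?_
  filter_upwards [(phaseChart p.1).open_source.mem_nhds hp] with q hq
  rw [← phaseChart_dilate]
  exact (phaseChart p.1).left_inv (mem_phaseChart_source.2 (mem_phaseChart_source.1 hq))

end Velocity

/-! ### Geodesics and integral curves of the geodesic field -/

section Solution

variable [TopologicalSpace M] [ChartedSpace (EuclideanSpace ℝ (Fin n)) M] [IsManifold (𝓡 n) ∞ M]
  [RiemannianBundle (fun x : M ↦ TangentSpace (𝓡 n) x)]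
  [IsContMDiffRiemannianBundle (𝓡 n) ∞ (EuclideanSpace ℝ (Fin n))
      (fun x : M ↦ TangentSpace (𝓡 n) x)]

theorem hasDerivAt_phaseChart {p : ℝ → TangentBundle (𝓡 n) M} {t : ℝ}
    (h : (geodesicAtlas n M).IsSolAt p t) {x₀ : M} (hx : (p t).1 ∈ (extChartAt (𝓡 n) x₀).source) :
    HasDerivAt (fun s ↦ phaseChart x₀ (p s)) (spray (metricMatrix x₀) (phaseChart x₀ (p t))) t :=
  h.2 x₀ (mem_phaseChart_source.2 hx)

theorem hasMFDerivAt_base {p : ℝ → TangentBundle (𝓡 n) M} {t : ℝ}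
    (h : (geodesicAtlas n M).IsSolAt p t) :
    HasMFDerivAt 𝓘(ℝ, ℝ) (𝓡 n) (fun s ↦ (p s).1) t
      (ContinuousLinearMap.toSpanSingleton ℝ (p t).2) := by
  refine hasMFDerivAt_of_hasDerivAt (continuous_base.continuousAt.comp h.1) ?_
  exact (hasDerivAt_phaseChart h (mem_extChartAt_source (I := 𝓡 n) (p t).1)).fst

theorem velocity_base {p : ℝ → TangentBundle (𝓡 n) M} {t : ℝ}
    (h : (geodesicAtlas n M).IsSolAt p t) : velocity (fun s ↦ (p s).1) t = p t := by
  have h1 : (mfderiv 𝓘(ℝ, ℝ) (𝓡 n) (fun s ↦ (p s).1) t 1 : TangentSpace (𝓡 n) (p t).1) = (p t).2 :=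
    (DFunLike.congr_fun (hasMFDerivAt_base h).mfderiv (1 : ℝ)).trans (one_smul ℝ (p t).2)
  exact congrArg (TotalSpace.mk (p t).1) h1

theorem contDiffAt_phaseChart {p : ℝ → TangentBundle (𝓡 n) M} {t : ℝ}
    (h : ∀ᶠ s in 𝓝 t, (geodesicAtlas n M).IsSolAt p s) {x₀ : M}
    (hx : (p t).1 ∈ (extChartAt (𝓡 n) x₀).source) :
    ContDiffAt ℝ ∞ (fun s ↦ phaseChart x₀ (p s)) t := by
  have h1 : ∀ᶠ s in 𝓝 t, (geodesicAtlas n M).IsSolAt p s ∧ p s ∈ (phaseChart x₀).source :=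
    h.and (h.self_of_nhds.1
      ((phaseChart x₀).open_source.mem_nhds (mem_phaseChart_source.2 hx)))
  obtain ⟨U, hU, hUo, htU⟩ := _root_.eventually_nhds_iff.1 h1
  refine (contDiffOn_of_hasDerivAt (contDiffOn_spray (isOpen_extChartAt_target (I := 𝓡 n) x₀)
    (contDiffOn_metricMatrix x₀) fun y hy ↦ (det_metricMatrix_pos hy).ne') hUo (fun s hs ↦
      hasDerivAt_phaseChart (hU s hs).1 (mem_phaseChart_source.1 (hU s hs).2)) fun s hs ↦ ?_).contDiffAt
    (hUo.mem_nhds htU)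
  rw [← phaseChart_target]
  exact (phaseChart x₀).map_source (hU s hs).2

theorem contMDiffAt_base {p : ℝ → TangentBundle (𝓡 n) M} {t : ℝ}
    (h : ∀ᶠ s in 𝓝 t, (geodesicAtlas n M).IsSolAt p s) :
    ContMDiffAt 𝓘(ℝ, ℝ) (𝓡 n) ∞ (fun s ↦ (p s).1) t := by
  rw [contMDiffAt_iff]
  refine ⟨continuous_base.continuousAt.comp h.self_of_nhds.1, ?_⟩
  have := (contDiffAt_phaseChart h (mem_extChartAt_source (I := 𝓡 n) (p t).1)).fst
  simp only [mfld_simps, contDiffWithinAt_univ]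
  exact this

/-- The first component of the field says that the second coordinate is the velocity of the base
curve; the second component is then the geodesic equation. -/
theorem isGeodesic_base {p : ℝ → TangentBundle (𝓡 n) M}
    (h : ∀ t, (geodesicAtlas n M).IsSolAt p t) : IsGeodesic (n := n) fun s ↦ (p s).1 := by
  refine ⟨fun t ↦ contMDiffAt_base (Eventually.of_forall h), fun t x₀ hx k ↦ ?_⟩
  have hev : ∀ᶠ s in 𝓝 t, (p s).1 ∈ (extChartAt (𝓡 n) x₀).source :=
    (continuous_base.continuousAt.comp (h t).1)
      ((isOpen_extChartAt_source (I := 𝓡 n) x₀).mem_nhds hx)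
  have h1 : ∀ s, (p s).1 ∈ (extChartAt (𝓡 n) x₀).source → ∀ i,
      HasDerivAt (fun s ↦ extChartAt (𝓡 n) x₀ (p s).1 i) ((phaseChart x₀ (p s)).2 i) s :=
    fun s hs i ↦ (EuclideanSpace.proj (𝕜 := ℝ) i).hasFDerivAt.comp_hasDerivAt s
      (hasDerivAt_phaseChart (h s) hs).fst
  have h2 : HasDerivAt (fun s ↦ (phaseChart x₀ (p s)).2 k) _ t :=
    (EuclideanSpace.proj (𝕜 := ℝ) k).hasFDerivAt.comp_hasDerivAt t
      (hasDerivAt_phaseChart (h t) hx).snd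
  have h3 : deriv (fun s ↦ extChartAt (𝓡 n) x₀ (p s).1 k) =ᶠ[𝓝 t]
      fun s ↦ (phaseChart x₀ (p s)).2 k := by
    filter_upwards [hev] with s hs using (h1 s hs k).deriv
  rw [h3.deriv_eq, h2.deriv]
  simp only [(h1 t hx _).deriv]
  exact neg_add_cancel _

/-- Converse passage from the second-order equation to the first-order system. The chart at `γ t`
suffices, and continuity of the velocity is read off from its expression there. -/
theorem isSolAt_velocity {γ : ℝ → M} (h : IsGeodesic (n := n) γ) (t : ℝ) :
    (geodesicAtlas n M).IsSolAt (velocity γ) t := by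
  set x₀ := γ t
  have hx : γ t ∈ (extChartAt (𝓡 n) x₀).source := mem_extChartAt_source (I := 𝓡 n) (γ t)
  have hd : ∀ s, MDifferentiableAt 𝓘(ℝ, ℝ) (𝓡 n) γ s := fun s ↦
    (h.1 s).mdifferentiableAt (by simp)
  have hev : ∀ᶠ s in 𝓝 t, γ s ∈ (extChartAt (𝓡 n) x₀).source :=
    h.1.continuous.continuousAt ((isOpen_extChartAt_source (I := 𝓡 n) x₀).mem_nhds hx)
  set c : ℝ → Coord n := fun s ↦ extChartAt (𝓡 n) x₀ (γ s)
  have hcs : ContDiffAt ℝ ∞ c t := by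
    have h1 := (contMDiffAt_iff.1 (h.1 t)).2
    simp only [mfld_simps, contDiffWithinAt_univ] at h1
    exact h1
  have hev2 : (fun s ↦ phaseChart x₀ (velocity (n := n) γ s)) =ᶠ[𝓝 t] fun s ↦ (c s, deriv c s) := by
    filter_upwards [hev] with s hs using phaseChart_velocity (hd s) hs
  have hc1 : HasDerivAt c (deriv c t) t := (hcs.differentiableAt (by simp)).hasDerivAt
  have hcs' : ContDiffAt ℝ ∞ (deriv c) t := by
    have := (hcs.fderiv_right (m := ∞) (by simp)).clm_apply (contDiffAt_const (c := (1 : ℝ)))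
    simpa using! this
  have hc2 : HasDerivAt (deriv c) (deriv (deriv c) t) t :=
    (hcs'.differentiableAt (by simp)).hasDerivAt
  have hcomp : ∀ᶠ s in 𝓝 t, ∀ i : Fin n, deriv (fun s ↦ c s i) s = deriv c s i := by
    have : ∀ᶠ s in 𝓝 t, ContDiffAt ℝ 1 c s :=
      (hcs.of_le (m := 1) (by simp)).eventually (by simp)
    filter_upwards [this] with s hs i
    exact ((EuclideanSpace.proj (𝕜 := ℝ) i).hasFDerivAt.comp_hasDerivAt s
      (hs.differentiableAt (by simp)).hasDerivAt).deriv
  have hode : deriv (deriv c) t = -gam (metricMatrix x₀) (c t) (deriv c t) (deriv c t) := by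
    ext k
    have h1 := h.2 t x₀ hx k
    have h2 : deriv (deriv fun s ↦ c s k) t = deriv (deriv c) t k := by
      have h3 : deriv (fun s ↦ c s k) =ᶠ[𝓝 t] fun s ↦ deriv c s k := by
        filter_upwards [hcomp] with s hs using hs k
      rw [h3.deriv_eq]
      exact ((EuclideanSpace.proj (𝕜 := ℝ) k).hasFDerivAt.comp_hasDerivAt t hc2).deriv
    change deriv (deriv fun s ↦ c s k) t + ∑ i, ∑ j, christoffel x₀ k i j (c t) *
      deriv (fun s ↦ c s i) t * deriv (fun s ↦ c s j) t = 0 at h1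
    rw [h2] at h1
    simp only [hcomp.self_of_nhds] at h1
    exact eq_neg_of_add_eq_zero_left h1
  have hsol : HasDerivAt (fun s ↦ phaseChart x₀ (velocity (n := n) γ s))
      (spray (metricMatrix x₀) (phaseChart x₀ (velocity (n := n) γ t))) t := by
    refine HasDerivAt.congr_of_eventuallyEq ?_ hev2
    rw [phaseChart_velocity (hd t) hx, spray]
    change HasDerivAt _ (deriv c t, -gam (metricMatrix x₀) (c t) (deriv c t) (deriv c t)) t
    rw [← hode]
    exact hc1.prodMk hc2
  refine FieldAtlas.isSolAt_of_chart (𝓐 := geodesicAtlas n M) (i := x₀) ?_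
    (mem_phaseChart_source (n := n).2 hx) hsol
  have h1 : ContinuousAt ((phaseChart x₀).symm ∘ fun s ↦ phaseChart x₀ (velocity (n := n) γ s)) t :=
    ContinuousAt.comp (f := fun s ↦ phaseChart x₀ (velocity (n := n) γ s))
      ((phaseChart x₀).continuousAt_symm ((phaseChart x₀).map_source
        (mem_phaseChart_source.2 hx))) hsol.continuousAt
  refine h1.congr ?_
  filter_upwards [hev] with s hs using
    (phaseChart x₀).left_inv (mem_phaseChart_source (n := n).2 hs)

/-- The Christoffel term is quadratic in the velocity, so running a geodesic `a` times as fast gives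
a geodesic. -/
theorem isSolAt_dilate {p : ℝ → TangentBundle (𝓡 n) M} {a t : ℝ}
    (h : (geodesicAtlas n M).IsSolAt p (a * t)) :
    (geodesicAtlas n M).IsSolAt (fun s ↦ dilate a (p (a * s))) t := by
  have hmul : HasDerivAt (fun s : ℝ ↦ a * s) a t := by simpa using (hasDerivAt_id t).const_mul a
  refine ⟨(continuous_dilate a).continuousAt.comp
    (ContinuousAt.comp (g := p) h.1 hmul.continuousAt), fun x₀ hx ↦ ?_⟩
  have hx' : (p (a * t)).1 ∈ (extChartAt (𝓡 n) x₀).source := mem_phaseChart_source.1 hx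
  have h1 : HasDerivAt (fun s ↦ phaseChart x₀ (p (a * s))) _ t :=
    HasDerivAt.scomp (g₁ := fun s ↦ phaseChart x₀ (p s)) (h := fun s ↦ a * s) t (hasDerivAt_phaseChart h hx') hmul
  have hw : HasDerivAt (fun s ↦ (phaseChart x₀ (p (a * s))).2)
      (a • spray (metricMatrix x₀) (phaseChart x₀ (p (a * t)))).2 t := h1.snd
  have h2 : HasDerivAt (fun s ↦ ((phaseChart x₀ (p (a * s))).1, a • (phaseChart x₀ (p (a * s))).2))
      ((a • spray (metricMatrix x₀) (phaseChart x₀ (p (a * t)))).1,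
        a • (a • spray (metricMatrix x₀) (phaseChart x₀ (p (a * t)))).2) t :=
    HasDerivAt.prodMk h1.fst (hw.const_smul a)
  refine (h2.congr_deriv ?_).congr_of_eventuallyEq
    (Eventually.of_forall fun s ↦ phaseChart_dilate x₀ a (p (a * s)))
  change _ = spray (metricMatrix x₀) (phaseChart x₀ (dilate a (p (a * t))))
  rw [phaseChart_dilate]
  refine Prod.ext rfl ?_
  ext k
  simp only [spray, gam, Prod.smul_mk, PiLp.smul_apply, PiLp.neg_apply, smul_eq_mul, mul_neg,
    Finset.mul_sum]
  congr 1
  exact Finset.sum_congr rfl fun i _ ↦ Finset.sum_congr rfl fun j _ ↦ by ring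

end Solution

end GeodesicWalk

namespace GeodesicWalk

variable {n : ℕ} {M : Type*}

/-! ### Constant speed and uniform lifetimes -/

section Energy

variable [TopologicalSpace M] [ChartedSpace (EuclideanSpace ℝ (Fin n)) M] [IsManifold (𝓡 n) ∞ M]
  [RiemannianBundle (fun x : M ↦ TangentSpace (𝓡 n) x)]

theorem form_phaseChart {x₀ : M} {p : TangentBundle (𝓡 n) M}
    (hp : p.1 ∈ (extChartAt (𝓡 n) x₀).source) :
    form (metricMatrix x₀ (phaseChart x₀ p).1) (phaseChart x₀ p).2 (phaseChart x₀ p).2 =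
      ‖p.2‖ ^ 2 := by
  have h : phaseChart x₀ p = (extChartAt (𝓡 n) x₀ p.1, ofTangent x₀ p.1 p.2) := rfl
  rw [h, form_metricMatrix hp, toTangent_ofTangent hp, real_inner_self_eq_norm_sq]

variable [IsContMDiffRiemannianBundle (𝓡 n) ∞ (EuclideanSpace ℝ (Fin n))
      (fun x : M ↦ TangentSpace (𝓡 n) x)]

theorem hasDerivAt_norm_sq {p : ℝ → TangentBundle (𝓡 n) M} {t : ℝ}
    (h : (geodesicAtlas n M).IsSolAt p t) : HasDerivAt (fun s ↦ ‖(p s).2‖ ^ 2) 0 t := by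
  set x₀ := (p t).1
  have hx : (p t).1 ∈ (extChartAt (𝓡 n) x₀).source := mem_extChartAt_source (I := 𝓡 n) _
  have hy : (phaseChart x₀ (p t)).1 ∈ (extChartAt (𝓡 n) x₀).target :=
    (extChartAt (𝓡 n) x₀).map_source hx
  have hz := hasDerivAt_phaseChart h hx
  refine (hasDerivAt_energy (g := metricMatrix x₀) (c := fun s ↦ (phaseChart x₀ (p s)).1)
    (w := fun s ↦ (phaseChart x₀ (p s)).2) (metricMatrix_isSymm x₀)
    (isUnit_iff_ne_zero.2 (det_metricMatrix_pos hy).ne') (differentiableAt_metricMatrix hy)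
    hz.fst hz.snd).congr_of_eventuallyEq ?_
  filter_upwards [(continuous_base.continuousAt.comp h.1)
    ((isOpen_extChartAt_source (I := 𝓡 n) x₀).mem_nhds hx)] with s hs
  exact (form_phaseChart hs).symm

theorem norm_eq_of_isSolAt {p : ℝ → TangentBundle (𝓡 n) M} {D : Set ℝ} (hD : IsOpen D)
    (hc : IsPreconnected D) (h : ∀ t ∈ D, (geodesicAtlas n M).IsSolAt p t) {s t : ℝ} (hs : s ∈ D)
    (ht : t ∈ D) : ‖(p s).2‖ = ‖(p t).2‖ := by
  have := hD.is_const_of_deriv_eq_zero hc (f := fun s ↦ ‖(p s).2‖ ^ 2)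
    (fun r hr ↦ (hasDerivAt_norm_sq (h r hr)).differentiableAt.differentiableWithinAt)
    (fun r hr ↦ (hasDerivAt_norm_sq (h r hr)).deriv) hs ht
  exact (pow_left_inj₀ (norm_nonneg _) (norm_nonneg _) two_ne_zero).1 this

/-- Continuity of the metric bounds the trivialization at `x` near `x`, so Riemannian bounds on
vectors put their coordinates in a fixed compact ball. -/
theorem eventually_norm_ofTangent_le (x : M) :
    ∃ C > 0, ∀ᶠ y in 𝓝 x, ∀ v : TangentSpace (𝓡 n) y, ‖ofTangent x y v‖ ≤ C * ‖v‖ := by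
  have : IsContinuousRiemannianBundle (EuclideanSpace ℝ (Fin n))
      (fun x : M ↦ TangentSpace (𝓡 n) x) := by
    obtain ⟨g, hg, h⟩ := IsContMDiffRiemannianBundle.exists_contMDiff (IB := 𝓡 n) (n := ∞)
      (F := EuclideanSpace ℝ (Fin n)) (E := fun x : M ↦ TangentSpace (𝓡 n) x)
    exact ⟨g, hg.continuous, h⟩
  obtain ⟨C, hC, h⟩ := eventually_norm_trivializationAt_lt (EuclideanSpace ℝ (Fin n))
    (fun x : M ↦ TangentSpace (𝓡 n) x) x
  refine ⟨C, hC, ?_⟩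
  filter_upwards [h, (trivializationAt (EuclideanSpace ℝ (Fin n))
    (fun x : M ↦ TangentSpace (𝓡 n) x) x).open_baseSet.mem_nhds
      (FiberBundle.mem_baseSet_trivializationAt' x)] with y hy hyx v
  have h1 := (ContinuousLinearMap.le_opNorm ((trivializationAt (EuclideanSpace ℝ (Fin n))
    (fun x : M ↦ TangentSpace (𝓡 n) x) x).continuousLinearMapAt ℝ y) v).trans
    (mul_le_mul_of_nonneg_right hy.le (norm_nonneg v))
  rw [Trivialization.continuousLinearMapAt_apply, Trivialization.coe_linearMapAt_of_mem _ hyx] at h1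
  exact h1

/-- Local solutions near each vector over `x` have a common lifetime on a product neighbourhood;
finitely many of these cover the compact ball of coordinate velocities. -/
theorem exists_uniform_time (x : M) (R : ℝ) : ∃ U ∈ 𝓝 x, ∃ ε > 0, ∀ y ∈ U,
    ∀ v : TangentSpace (𝓡 n) y, ‖v‖ ≤ R → ∃ p : ℝ → TangentBundle (𝓡 n) M,
      p 0 = ⟨y, v⟩ ∧ ∀ t ∈ Ioo (-ε) ε, (geodesicAtlas n M).IsSolAt p t := by
  obtain ⟨C, hC, hbound⟩ := eventually_norm_ofTangent_le (n := n) x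
  set φ := extChartAt (𝓡 n) x
  have hxs : x ∈ φ.source := mem_extChartAt_source (I := 𝓡 n) x
  have hcpt : IsCompact (closedBall (0 : Coord n) (C * R)) := isCompact_closedBall _ _
  have key : ∃ W ∈ 𝓝 (φ x), ∃ ε > 0, ∀ y ∈ W, ∀ w ∈ closedBall (0 : Coord n) (C * R),
      ∃ p : ℝ → TangentBundle (𝓡 n) M, p 0 = (phaseChart x).symm (y, w) ∧
        ∀ t ∈ Ioo (-ε) ε, (geodesicAtlas n M).IsSolAt p t := by
    refine hcpt.induction_on (p := fun S ↦ ∃ W ∈ 𝓝 (φ x), ∃ ε > 0, ∀ y ∈ W, ∀ w ∈ S,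
      ∃ p : ℝ → TangentBundle (𝓡 n) M, p 0 = (phaseChart x).symm (y, w) ∧
        ∀ t ∈ Ioo (-ε) ε, (geodesicAtlas n M).IsSolAt p t) ?_ ?_ ?_ ?_
    · exact ⟨univ, univ_mem, 1, one_pos, by simp⟩
    · rintro S S' hS ⟨W, hW, ε, hε, h⟩
      exact ⟨W, hW, ε, hε, fun y hy w hw ↦ h y hy w (hS hw)⟩
    · rintro S S' ⟨W, hW, ε, hε, h⟩ ⟨W', hW', ε', hε', h'⟩
      refine ⟨W ∩ W', inter_mem hW hW', min ε ε', lt_min hε hε', fun y hy w hw ↦ ?_⟩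
      rcases hw with hw | hw
      · obtain ⟨p, hp0, hp⟩ := h y hy.1 w hw
        exact ⟨p, hp0, fun t ht ↦ hp t (Ioo_subset_Ioo (neg_le_neg (min_le_left _ _))
          (min_le_left _ _) ht)⟩
      · obtain ⟨p, hp0, hp⟩ := h' y hy.2 w hw
        exact ⟨p, hp0, fun t ht ↦ hp t (Ioo_subset_Ioo (neg_le_neg (min_le_right _ _))
          (min_le_right _ _) ht)⟩
    · intro w _
      obtain ⟨U, hU, ε, hε, h⟩ := (geodesicAtlas n M).exists_local_isSolAt
        ((phaseChart x).symm (φ x, w))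
      have hc : ContinuousAt (phaseChart (n := n) x).symm (φ x, w) :=
        (phaseChart x).continuousAt_symm (mem_phaseChart_target.2 (φ.map_source hxs))
      have h1 := hc hU
      rw [Filter.mem_map, nhds_prod_eq, mem_prod_iff] at h1
      obtain ⟨W, hW, S, hS, hsub⟩ := h1
      exact ⟨S, mem_nhdsWithin_of_mem_nhds hS, W, hW, ε, hε, fun y hy w hw ↦ h _ (hsub ⟨hy, hw⟩)⟩
  obtain ⟨W, hW, ε, hε, h⟩ := key
  refine ⟨_, inter_mem (inter_mem hbound ((isOpen_extChartAt_source (I := 𝓡 n) x).mem_nhds hxs))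
    (continuousAt_extChartAt (I := 𝓡 n) x hW), ε, hε, ?_⟩
  rintro y ⟨⟨hyb, hys⟩, hyW⟩ v hv
  obtain ⟨p, hp0, hp⟩ := h _ hyW (ofTangent x y v) (by
    rw [mem_closedBall_zero_iff]
    exact (hyb v).trans (mul_le_mul_of_nonneg_left hv hC.le))
  refine ⟨p, ?_, hp⟩
  rw [hp0]
  exact (phaseChart x).left_inv (x := ⟨y, v⟩) (mem_phaseChart_source.2 hys)

end Energy

/-! ### Geodesic completeness and the exponential map -/

section Complete

variable [MetricSpace M] [ChartedSpace (EuclideanSpace ℝ (Fin n)) M] [IsManifold (𝓡 n) ∞ M]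
  [RiemannianBundle (fun x : M ↦ TangentSpace (𝓡 n) x)]
  [IsContMDiffRiemannianBundle (𝓡 n) ∞ (EuclideanSpace ℝ (Fin n))
      (fun x : M ↦ TangentSpace (𝓡 n) x)]
  [IsRiemannianManifold (𝓡 n) M]

theorem dist_base_le {p : ℝ → TangentBundle (𝓡 n) M} {s t R : ℝ} (hst : s ≤ t) {D : Set ℝ}
    (hD : IsOpen D) (hsub : Icc s t ⊆ D) (h : ∀ r ∈ D, (geodesicAtlas n M).IsSolAt p r)
    (hR : ∀ r ∈ D, ‖(p r).2‖ ≤ R) : dist (p s).1 (p t).1 ≤ R * (t - s) := by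
  have hR0 : 0 ≤ R := (norm_nonneg _).trans (hR s (hsub (left_mem_Icc.2 hst)))
  have h1 : edist (p s).1 (p t).1 ≤ pathELength (𝓡 n) (fun r ↦ (p r).1) s t := by
    rw [IsRiemannianManifold.out (I := 𝓡 n)]
    refine riemannianEDist_le_pathELength (fun r hr ↦ ?_) rfl rfl hst
    refine ((contMDiffAt_base ?_).of_le (by simp)).contMDiffWithinAt
    filter_upwards [hD.mem_nhds (hsub hr)] with r' hr' using h r' hr'
  have h2 : pathELength (𝓡 n) (fun r ↦ (p r).1) s t ≤ ENNReal.ofReal R * ENNReal.ofReal (t - s) := by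
    rw [pathELength_eq_lintegral_mfderiv_Icc]
    refine (setLIntegral_mono measurable_const (g := fun _ ↦ ENNReal.ofReal R)
      fun r hr ↦ ?_).trans (by simp)
    have h3 : (mfderiv 𝓘(ℝ, ℝ) (𝓡 n) (fun s ↦ (p s).1) r 1 : TangentSpace (𝓡 n) (p r).1) =
        (p r).2 :=
      (DFunLike.congr_fun (hasMFDerivAt_base (h r (hsub hr))).mfderiv (1 : ℝ)).trans
        (one_smul ℝ (p r).2)
    have h4 : ‖(p r).2‖ₑ ≤ ENNReal.ofReal R := by
      rw [← ofReal_norm]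
      exact ENNReal.ofReal_le_ofReal (hR r (hsub hr))
    exact (congrArg (fun v : TangentSpace (𝓡 n) (p r).1 ↦ ‖v‖ₑ) h3).le.trans h4
  rw [← ENNReal.ofReal_mul hR0] at h2
  have h3 := h1.trans h2
  rw [edist_dist] at h3
  exact (ENNReal.ofReal_le_ofReal_iff (mul_nonneg hR0 (sub_nonneg.2 hst))).1 h3

variable (n M) in
-- The Hopf–Rinow argument. Constant speed makes the base curve Lipschitz on `(-T, T)`, so its image
-- is totally bounded and, `M` being complete, has compact closure. A finite subcover by the
-- neighbourhoods of `exists_uniform_time` gives the lifetime needed for continuation.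
theorem complete_geodesicAtlas [CompleteSpace M] : (geodesicAtlas n M).Complete := by
  refine FieldAtlas.complete_of_uniform_time fun p T hT hp ↦ ?_
  set R := ‖(p 0).2‖
  have hR : ∀ r ∈ Ioo (-T) T, ‖(p r).2‖ ≤ R := fun r hr ↦
    (norm_eq_of_isSolAt isOpen_Ioo isPreconnected_Ioo hp hr ⟨neg_lt_zero.2 hT, hT⟩).le
  have hdist : ∀ s ∈ Ioo (-T) T, ∀ t ∈ Ioo (-T) T, dist (p s).1 (p t).1 ≤ R * dist s t := by
    have aux : ∀ s ∈ Ioo (-T) T, ∀ t ∈ Ioo (-T) T, s ≤ t → dist (p s).1 (p t).1 ≤ R * dist s t := by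
      intro s hs t ht hst
      rw [dist_comm s t, Real.dist_eq, abs_of_nonneg (sub_nonneg.2 hst)]
      exact dist_base_le hst isOpen_Ioo (fun r hr ↦ ⟨hs.1.trans_le hr.1, hr.2.trans_lt ht.2⟩) hp hR
    intro s hs t ht
    rcases le_total s t with hst | hst
    · exact aux s hs t ht hst
    · rw [dist_comm, dist_comm s t]
      exact aux t ht s hs hst
  have hlip : LipschitzWith R.toNNReal fun s : Ioo (-T) T ↦ (p s).1 :=
    LipschitzWith.of_dist_le_mul fun s t ↦ by
      rw [Real.coe_toNNReal _ (norm_nonneg _)]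
      exact hdist s s.2 t t.2
  have htb : TotallyBounded ((fun r ↦ (p r).1) '' Ioo (-T) T) := by
    have h1 : TotallyBounded (univ : Set (Ioo (-T) T)) := by
      have := totallyBounded_preimage (f := ((↑) : Ioo (-T) T → ℝ))
        isUniformEmbedding_subtype_val.isUniformInducing (totallyBounded_Ioo (-T) T)
      simpa using this
    have h2 := h1.image hlip.uniformContinuous
    rwa [image_univ, ← image_eq_range (fun r ↦ (p r).1)] at h2
  have hcpt : IsCompact (closure ((fun r ↦ (p r).1) '' Ioo (-T) T)) :=
    htb.closure.isCompact_of_isClosed isClosed_closure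
  obtain ⟨ε, hε, h⟩ : ∃ ε > 0, ∀ y ∈ closure ((fun r ↦ (p r).1) '' Ioo (-T) T),
      ∀ v : TangentSpace (𝓡 n) y, ‖v‖ ≤ R → ∃ q : ℝ → TangentBundle (𝓡 n) M,
        q 0 = ⟨y, v⟩ ∧ ∀ t ∈ Ioo (-ε) ε, (geodesicAtlas n M).IsSolAt q t := by
    refine hcpt.induction_on (p := fun S ↦ ∃ ε > 0, ∀ y ∈ S,
      ∀ v : TangentSpace (𝓡 n) y, ‖v‖ ≤ R → ∃ q : ℝ → TangentBundle (𝓡 n) M,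
        q 0 = ⟨y, v⟩ ∧ ∀ t ∈ Ioo (-ε) ε, (geodesicAtlas n M).IsSolAt q t) ?_ ?_ ?_ ?_
    · exact ⟨1, one_pos, by simp⟩
    · rintro S S' hS ⟨ε, hε, h⟩
      exact ⟨ε, hε, fun y hy ↦ h y (hS hy)⟩
    · rintro S S' ⟨ε, hε, h⟩ ⟨ε', hε', h'⟩
      refine ⟨min ε ε', lt_min hε hε', fun y hy v hv ↦ ?_⟩
      rcases hy with hy | hy
      · obtain ⟨q, hq0, hq⟩ := h y hy v hv
        exact ⟨q, hq0, fun t ht ↦ hq t (Ioo_subset_Ioo (neg_le_neg (min_le_left _ _))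
          (min_le_left _ _) ht)⟩
      · obtain ⟨q, hq0, hq⟩ := h' y hy v hv
        exact ⟨q, hq0, fun t ht ↦ hq t (Ioo_subset_Ioo (neg_le_neg (min_le_right _ _))
          (min_le_right _ _) ht)⟩
    · intro x _
      obtain ⟨U, hU, ε, hε, h⟩ := exists_uniform_time (n := n) x R
      exact ⟨U, mem_nhdsWithin_of_mem_nhds hU, ε, hε, h⟩
  exact ⟨ε, hε, fun t ht ↦ h _ (subset_closure (mem_image_of_mem _ ht)) (p t).2 (hR t ht)⟩

variable [CompleteSpace M]

variable (n M) in
/-- The geodesic flow on the tangent bundle of a complete Riemannian manifold. -/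
def geodesicFlow (t : ℝ) (p : TangentBundle (𝓡 n) M) : TangentBundle (𝓡 n) M :=
  FieldAtlas.flow (complete_geodesicAtlas n M) t p

/-- The flow supplies a geodesic with the prescribed initial velocity, so the dummy branch never
occurs; by uniqueness the chosen geodesic agrees with the flow. -/
theorem expMap_eq (x : M) (v : TangentSpace (𝓡 n) x) :
    expMap x v = (geodesicFlow n M 1 ⟨x, v⟩).1 := by
  have hsol := FieldAtlas.isSolAt_flow (complete_geodesicAtlas n M) ⟨x, v⟩
  have hex : ∃ γ : ℝ → M, IsGeodesic (n := n) γ ∧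
      velocity γ 0 = (⟨x, v⟩ : TangentBundle (𝓡 n) M) :=
    ⟨fun s ↦ (geodesicFlow n M s ⟨x, v⟩).1, isGeodesic_base hsol,
      (velocity_base (hsol 0)).trans (FieldAtlas.flow_zero _ _)⟩
  rw [expMap, dif_pos hex]
  obtain ⟨h1, h2⟩ := hex.choose_spec
  have := FieldAtlas.flow_eq (complete_geodesicAtlas n M) (p := velocity hex.choose) isOpen_univ
    isPreconnected_univ (mem_univ _) h2 (fun t _ ↦ isSolAt_velocity h1 t) (mem_univ 1)
  rw [geodesicFlow, this]
  rfl

theorem geodesicFlow_dilate (a t : ℝ) (p : TangentBundle (𝓡 n) M) :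
    geodesicFlow n M t (dilate a p) = dilate a (geodesicFlow n M (a * t) p) :=
  FieldAtlas.flow_eq (complete_geodesicAtlas n M)
    (p := fun t ↦ dilate a (geodesicFlow n M (a * t) p)) isOpen_univ isPreconnected_univ
    (mem_univ _) (by simp [geodesicFlow, FieldAtlas.flow_zero])
    (fun s _ ↦ isSolAt_dilate (FieldAtlas.isSolAt_flow (complete_geodesicAtlas n M) p (a * s)))
    (mem_univ t)

theorem expMap_smul (δ : ℝ) (x : M) (u : TangentSpace (𝓡 n) x) :
    expMap x (δ • u) = (geodesicFlow n M δ ⟨x, u⟩).1 := by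
  rw [expMap_eq, show (⟨x, δ • u⟩ : TangentBundle (𝓡 n) M) = dilate δ ⟨x, u⟩ from rfl,
    geodesicFlow_dilate, mul_one]
  rfl

/-- Of convexity only the geodesic joining the two points is used; `v` is its initial velocity. -/
theorem exists_expMap_eq {K : Set M} (hK : GeodesicallyConvex n K) {x y : M} (hx : x ∈ K)
    (hy : y ∈ K) : ∃ v : TangentSpace (𝓡 n) x, expMap x v = y := by
  obtain ⟨γ, hγ, ⟨-, rfl, rfl, -⟩, -⟩ := hK x hx y hy
  refine ⟨mfderiv 𝓘(ℝ, ℝ) (𝓡 n) γ 0 1, (expMap_eq (γ 0) _).trans ?_⟩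
  have := FieldAtlas.flow_eq (complete_geodesicAtlas n M) (p := velocity γ) isOpen_univ
    isPreconnected_univ (mem_univ _) rfl (fun t _ ↦ isSolAt_velocity hγ t) (mem_univ 1)
  exact congrArg (fun q : TangentBundle (𝓡 n) M ↦ q.1) this

end Complete

end GeodesicWalk

/-! ### Gaussian measures on tangent spaces in coordinates -/

namespace LocalMetric

variable {n : ℕ}

theorem det_eq_of_form_eq {A B : Matrix (Fin n) (Fin n) ℝ} {L : Coord n →L[ℝ] Coord n}
    (h : ∀ u w, form A u w = form B (L u) (L w)) : A.det = L.det ^ 2 * B.det := by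
  set D := LinearMap.toMatrix (EuclideanSpace.basisFun (Fin n) ℝ).toBasis
    (EuclideanSpace.basisFun (Fin n) ℝ).toBasis (L : Coord n →ₗ[ℝ] Coord n)
  have hD : ∀ k i, D k i = L (EuclideanSpace.single i 1) k := fun k i ↦ by
    simp [D, LinearMap.toMatrix_apply]
  have hdet : D.det = L.det := LinearMap.det_toMatrix _ _
  have hA : A = D.transpose * B * D := by
    ext i j
    rw [← form_single_single A i j, h]
    simp only [form, Matrix.mul_apply, Matrix.transpose_apply, hD, Finset.sum_mul]
    rw [Finset.sum_comm]
    exact Finset.sum_congr rfl fun k _ ↦ Finset.sum_congr rfl fun l _ ↦ by ring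
  rw [hA, Matrix.det_mul, Matrix.det_mul, Matrix.det_transpose, hdet]
  ring

theorem form_one (u w : Coord n) : form 1 u w = inner ℝ u w := by
  simp [form, Matrix.one_apply, PiLp.inner_apply, mul_comm]

end LocalMetric

/-- The constant of the density of the standard Gaussian. -/
def gaussianConst (n : ℕ) : ℝ := ((2 * Real.pi) ^ ((n : ℝ) / 2))⁻¹

theorem gaussianConst_pos (n : ℕ) : 0 < gaussianConst n := by
  unfold gaussianConst
  positivity

/-- Both are finite measures with characteristic function `exp (-‖t‖² / 2)`. -/
theorem stdGaussian_eq_withDensity (n : ℕ) : stdGaussian (Coord n) =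
    volume.withDensity fun v ↦ ENNReal.ofReal (gaussianConst n * Real.exp (-‖v‖ ^ 2 / 2)) := by
  have hmeas : Measurable fun v : Coord n ↦
      ENNReal.ofReal (gaussianConst n * Real.exp (-‖v‖ ^ 2 / 2)) := by fun_prop
  have hintegrable : Integrable fun v : Coord n ↦ gaussianConst n * Real.exp (-‖v‖ ^ 2 / 2) := by
    refine Integrable.const_mul ?_ _
    have := (GaussianFourier.integrable_cexp_neg_mul_sq_norm_add (V := Coord n) (b := 1 / 2)
      (by norm_num) 0 0).norm
    refine this.congr (Eventually.of_forall fun v ↦ ?_)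
    simp only [Complex.norm_exp]
    congr 1
    simp [← Complex.ofReal_pow]
    ring
  have : IsFiniteMeasure ((volume : Measure (Coord n)).withDensity fun v ↦
      ENNReal.ofReal (gaussianConst n * Real.exp (-‖v‖ ^ 2 / 2))) :=
    isFiniteMeasure_withDensity_ofReal hintegrable.2
  refine Measure.ext_of_charFun ?_
  ext t
  rw [charFun_stdGaussian, charFun_apply, integral_withDensity_eq_integral_toReal_smul hmeas
    (Eventually.of_forall fun v ↦ ENNReal.ofReal_lt_top)]
  have h1 : ∀ v : Coord n, (ENNReal.ofReal (gaussianConst n *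
      Real.exp (-‖v‖ ^ 2 / 2))).toReal • Complex.exp (inner ℝ v t * Complex.I) =
      (gaussianConst n : ℂ) * Complex.exp (-(1 / 2 : ℂ) * ‖v‖ ^ 2 + Complex.I * inner ℝ t v) := by
    intro v
    rw [ENNReal.toReal_ofReal (mul_nonneg (gaussianConst_pos n).le (Real.exp_pos _).le),
      Complex.real_smul, Complex.ofReal_mul, mul_assoc, Complex.ofReal_exp, ← Complex.exp_add,
      real_inner_comm]
    congr 2
    push_cast
    ring
  simp_rw [h1]
  rw [integral_const_mul, GaussianFourier.integral_cexp_neg_mul_sq_norm_add (by norm_num)]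
  have h2 : ((Real.pi : ℂ) / (1 / 2)) ^ ((Module.finrank ℝ (Coord n) : ℂ) / 2) =
      (((2 * Real.pi) ^ ((n : ℝ) / 2) : ℝ) : ℂ) := by
    rw [finrank_euclideanSpace, Fintype.card_fin, Complex.ofReal_cpow (by positivity)]
    congr 1
    · push_cast; ring
    · push_cast; ring
  rw [h2, ← mul_assoc, ← Complex.ofReal_mul, gaussianConst, inv_mul_cancel₀ (by positivity)]
  rw [Complex.ofReal_one, one_mul, Complex.I_sq]
  congr 1
  ring

namespace GeodesicWalk

section Gaussian

variable {n : ℕ} {M : Type*} [TopologicalSpace M] [ChartedSpace (EuclideanSpace ℝ (Fin n)) M]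

theorem finrank_tangentSpace (x : M) : Module.finrank ℝ (TangentSpace (𝓡 n) x) = n :=
  finrank_euclideanSpace_fin (𝕜 := ℝ) (n := n)

variable [RiemannianBundle (fun x : M ↦ TangentSpace (𝓡 n) x)]

variable (n) in
/-- Orthonormal coordinates on a tangent space. -/
def orthoCoord (x : M) : TangentSpace (𝓡 n) x ≃ₗᵢ[ℝ] Coord n :=
  ((stdOrthonormalBasis ℝ (TangentSpace (𝓡 n) x)).reindex
    (finCongr (finrank_tangentSpace x))).repr

theorem tangentGaussian_neg (x : M) :
    (tangentGaussian (n := n) x).map (fun v ↦ -v) = tangentGaussian x :=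
  stdGaussian_map (LinearIsometryEquiv.neg ℝ)

variable [IsManifold (𝓡 n) ∞ M]

/-- The density of the Gaussian of the tangent space at `y`, in coordinates. -/
def fibreDensity (x₀ : M) (z : Coord n × Coord n) : ℝ≥0∞ :=
  ENNReal.ofReal (gaussianConst n * (Real.sqrt (metricMatrix x₀ z.1).det *
    Real.exp (-(form (metricMatrix x₀ z.1) z.2 z.2) / 2)))

theorem fibreDensity_ne_zero {x₀ : M} {z : Coord n × Coord n} (hz : z ∈ (phaseChart x₀).target) :
    fibreDensity x₀ z ≠ 0 := by
  have := Real.sqrt_pos.2 (det_metricMatrix_pos (mem_phaseChart_target.1 hz))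
  rw [fibreDensity, ENNReal.ofReal_ne_zero_iff]
  have := gaussianConst_pos n
  positivity

/-- The map `L` from orthonormal to chart coordinates pulls `g` back to the identity, hence `|det L|
· √(det g) = 1`; the change of variables along `L` produces the factor `√(det g)`. -/
theorem tangentGaussian_preimage {x₀ x : M} (hx : x ∈ (extChartAt (𝓡 n) x₀).source)
    {B : Set (Coord n)} (hB : MeasurableSet B) :
    tangentGaussian x (ofTangent x₀ x ⁻¹' B) =
      ∫⁻ w in B, fibreDensity x₀ (extChartAt (𝓡 n) x₀ x, w) := by
  set e := orthoCoord n x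
  set g := metricMatrix x₀ (extChartAt (𝓡 n) x₀ x)
  set L : Coord n →L[ℝ] Coord n :=
    (ofTangent x₀ x).comp (e.symm.toContinuousLinearEquiv : Coord n →L[ℝ] TangentSpace (𝓡 n) x)
  have hL : ∀ v, L v = ofTangent x₀ x (e.symm v) := fun v ↦ rfl
  have hform : ∀ u w, form g (L u) (L w) = inner ℝ u w := fun u w ↦ by
    rw [form_metricMatrix hx, hL, hL, toTangent_ofTangent hx, toTangent_ofTangent hx,
      LinearIsometryEquiv.inner_map_map]
  have hdet : 1 = L.det ^ 2 * g.det := by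
    rw [← det_eq_of_form_eq (A := 1) (B := g) (L := L) fun u w ↦ by rw [hform, form_one],
      Matrix.det_one]
  have hinj : Function.Injective L := fun u w huw ↦ by
    rw [hL, hL] at huw
    have := congrArg (toTangent x₀ x) huw
    rw [toTangent_ofTangent hx, toTangent_ofTangent hx] at this
    exact e.symm.injective this
  have hsurj : Function.Surjective L := LinearMap.surjective_of_injective (f := L.toLinearMap) hinj
  have h1 : tangentGaussian x (ofTangent x₀ x ⁻¹' B) = stdGaussian (Coord n) (L ⁻¹' B) := by
    have h2 : stdGaussian (Coord n) = (tangentGaussian x).map e := (stdGaussian_map e).symm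
    rw [h2, Measure.map_apply e.continuous.measurable (L.continuous.measurable hB)]
    congr 1
    ext v
    simp only [mem_preimage, hL, LinearIsometryEquiv.symm_apply_apply]
  have hdet' : |L.det| * Real.sqrt g.det = 1 := by
    rw [← Real.sqrt_sq_eq_abs, ← Real.sqrt_mul (sq_nonneg _), ← hdet, Real.sqrt_one]
  rw [h1, stdGaussian_eq_withDensity, withDensity_apply _ (L.continuous.measurable hB)]
  conv_rhs => rw [← image_preimage_eq B hsurj]
  rw [lintegral_image_eq_lintegral_abs_det_fderiv_mul volume (L.continuous.measurable hB)
    (fun v _ ↦ L.hasFDerivAt.hasFDerivWithinAt) hinj.injOn]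
  refine lintegral_congr fun v ↦ ?_
  have h3 : form g (L v) (L v) = ‖v‖ ^ 2 := by rw [hform, real_inner_self_eq_norm_sq]
  rw [fibreDensity, ← ENNReal.ofReal_mul (abs_nonneg _)]
  change _ = ENNReal.ofReal (|L.det| * (gaussianConst n * (Real.sqrt g.det *
    Real.exp (-(form g (L v) (L v)) / 2))))
  rw [h3]
  congr 1
  linear_combination (-gaussianConst n * Real.exp (-‖v‖ ^ 2 / 2)) * hdet'

end Gaussian

end GeodesicWalk

namespace GeodesicWalk

variable {n : ℕ} {M : Type*} [TopologicalSpace M] [ChartedSpace (EuclideanSpace ℝ (Fin n)) M]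

/-! ### The volume in one chart -/

section ChartVolume

theorem measurableSet_extChartAt_target (x₀ : M) : MeasurableSet (extChartAt (𝓡 n) x₀).target :=
  (isOpen_extChartAt_target (I := 𝓡 n) x₀).measurableSet

variable [MeasurableSpace M] [BorelSpace M]

theorem measurableSet_extChartAt_source (x₀ : M) : MeasurableSet (extChartAt (𝓡 n) x₀).source :=
  (isOpen_extChartAt_source (I := 𝓡 n) x₀).measurableSet

theorem measurableSet_extChartAt_image {x₀ : M} {A : Set M} (hA : MeasurableSet A)
    (hAs : A ⊆ (extChartAt (𝓡 n) x₀).source) : MeasurableSet (extChartAt (𝓡 n) x₀ '' A) :=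
  (chartAt (EuclideanSpace ℝ (Fin n)) x₀).measurableSet_image hA (by simpa using hAs)

variable [RiemannianBundle (fun x : M ↦ TangentSpace (𝓡 n) x)]

theorem lintegral_chartVolume (x₀ : M) {f : M → ℝ≥0∞} (hf : Measurable f)
    (hg : ContinuousOn (fun y ↦ (metricMatrix x₀ y).det) (extChartAt (𝓡 n) x₀).target) :
    ∫⁻ x, f x ∂chartVolume (n := n) x₀ = ∫⁻ y in (extChartAt (𝓡 n) x₀).target,
      ENNReal.ofReal (Real.sqrt (metricMatrix x₀ y).det) * f ((extChartAt (𝓡 n) x₀).symm y) := by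
  have ht := measurableSet_extChartAt_target (n := n) x₀
  have hs : AEMeasurable (extChartAt (𝓡 n) x₀).symm
      ((volume : Measure (Coord n)).restrict (extChartAt (𝓡 n) x₀).target) :=
    (continuousOn_extChartAt_symm (I := 𝓡 n) x₀).aemeasurable ht
  have hd : AEMeasurable (fun y ↦ ENNReal.ofReal (Real.sqrt (metricMatrix x₀ y).det))
      ((volume : Measure (Coord n)).restrict (extChartAt (𝓡 n) x₀).target) :=
    ((Real.continuous_sqrt.comp_continuousOn hg).aemeasurable ht).ennreal_ofReal
  rw [chartVolume, lintegral_map' hf.aemeasurable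
    (hs.mono_ac (withDensity_absolutelyContinuous _ _))]
  exact lintegral_withDensity_eq_lintegral_mul₀ hd (hf.comp_aemeasurable hs)

theorem chartVolume_compl_source (x₀ : M) :
    chartVolume (n := n) x₀ (extChartAt (𝓡 n) x₀).sourceᶜ = 0 := by
  have ht := measurableSet_extChartAt_target (n := n) x₀
  have hs : AEMeasurable (extChartAt (𝓡 n) x₀).symm
      ((volume : Measure (Coord n)).restrict (extChartAt (𝓡 n) x₀).target) :=
    (continuousOn_extChartAt_symm (I := 𝓡 n) x₀).aemeasurable ht
  rw [chartVolume, Measure.map_apply_of_aemeasurable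
    (hs.mono_ac (withDensity_absolutelyContinuous _ _))
    (measurableSet_extChartAt_source x₀).compl]
  refine withDensity_absolutelyContinuous _ _ ?_
  rw [Measure.restrict_apply' ht]
  refine measure_mono_null (fun y hy ↦ ?_) measure_empty
  exact hy.1 ((extChartAt (𝓡 n) x₀).map_target hy.2)

theorem chartVolume_apply {x₀ : M} {A : Set M} (hA : MeasurableSet A)
    (hAs : A ⊆ (extChartAt (𝓡 n) x₀).source)
    (hg : ContinuousOn (fun y ↦ (metricMatrix x₀ y).det) (extChartAt (𝓡 n) x₀).target) :
    chartVolume (n := n) x₀ A = ∫⁻ y in extChartAt (𝓡 n) x₀ '' A,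
      ENNReal.ofReal (Real.sqrt (metricMatrix x₀ y).det) := by
  have hI := measurableSet_extChartAt_image (n := n) hA hAs
  rw [← lintegral_indicator_one hA, lintegral_chartVolume x₀ (measurable_one.indicator hA) hg,
    ← lintegral_indicator (measurableSet_extChartAt_target x₀), ← lintegral_indicator hI]
  refine lintegral_congr fun y ↦ ?_
  by_cases hy : y ∈ (extChartAt (𝓡 n) x₀).target
  · have : (extChartAt (𝓡 n) x₀).symm y ∈ A ↔ y ∈ extChartAt (𝓡 n) x₀ '' A := by
      refine ⟨fun h ↦ ⟨_, h, (extChartAt (𝓡 n) x₀).right_inv hy⟩, ?_⟩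
      rintro ⟨x, hx, rfl⟩
      rwa [(extChartAt (𝓡 n) x₀).left_inv (hAs hx)]
    by_cases hyA : y ∈ extChartAt (𝓡 n) x₀ '' A
    · rw [indicator_of_mem hy, indicator_of_mem hyA, indicator_of_mem (this.2 hyA)]
      simp
    · rw [indicator_of_mem hy, indicator_of_notMem hyA, indicator_of_notMem (mt this.1 hyA)]
      simp
  · rw [indicator_of_notMem hy, indicator_of_notMem]
    rintro ⟨x, hx, rfl⟩
    exact hy ((extChartAt (𝓡 n) x₀).map_source (hAs hx))

end ChartVolume

/-! ### Gluing the Riemannian volume -/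

section Volume

variable (n M) in
theorem iUnion_chartCenter_source [SecondCountableTopology M] [Nonempty M] : ⋃ i, (chartAt (EuclideanSpace ℝ (Fin n))
    (chartCenter n M i)).source = univ :=
  (exists_chartCenter n M).choose_spec

variable [IsManifold (𝓡 n) ∞ M] [RiemannianBundle (fun x : M ↦ TangentSpace (𝓡 n) x)]
  [IsContMDiffRiemannianBundle (𝓡 n) ∞ (EuclideanSpace ℝ (Fin n))
      (fun x : M ↦ TangentSpace (𝓡 n) x)]

theorem continuousOn_det_metricMatrix (x₀ : M) :
    ContinuousOn (fun y ↦ (metricMatrix x₀ y).det) (extChartAt (𝓡 n) x₀).target :=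
  (contDiffOn_det (contDiffOn_metricMatrix x₀)).continuousOn

variable [MeasurableSpace M] [BorelSpace M]

/-- Under a change of charts `det g` acquires the square of the Jacobian, so `√(det g)` absorbs
exactly the factor of the change of variables. -/
theorem chartVolume_eq {x₀ x₁ : M} {A : Set M} (hA : MeasurableSet A)
    (h₀ : A ⊆ (extChartAt (𝓡 n) x₀).source) (h₁ : A ⊆ (extChartAt (𝓡 n) x₁).source) :
    chartVolume (n := n) x₀ A = chartVolume (n := n) x₁ A := by
  rw [chartVolume_apply hA h₀ (continuousOn_det_metricMatrix x₀),
    chartVolume_apply hA h₁ (continuousOn_det_metricMatrix x₁)]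
  have himg : extChartAt (𝓡 n) x₁ '' A =
      transition (n := n) x₀ x₁ '' (extChartAt (𝓡 n) x₀ '' A) := by
    rw [image_image]
    exact image_congr fun x hx ↦ (transition_extChartAt (h₀ hx)).symm
  rw [himg, lintegral_image_eq_lintegral_abs_det_fderiv_mul volume
    (measurableSet_extChartAt_image hA h₀) (f' := fderiv ℝ (transition (n := n) x₀ x₁))]
  · refine setLIntegral_congr_fun (measurableSet_extChartAt_image hA h₀) ?_
    rintro _ ⟨x, hx, rfl⟩
    simp only
    rw [← ENNReal.ofReal_mul (abs_nonneg _), ← Real.sqrt_sq_eq_abs, ← Real.sqrt_mul (sq_nonneg _),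
      ← det_eq_of_form_eq (form_metricMatrix_transition (h₀ hx) (h₁ hx))]
  · rintro _ ⟨x, hx, rfl⟩
    exact ((contDiffAt_transition (h₀ hx) (h₁ hx)).differentiableAt
      (by simp)).hasFDerivAt.hasFDerivWithinAt
  · rintro _ ⟨x, hx, rfl⟩ _ ⟨x', hx', rfl⟩ h
    rw [transition_extChartAt (h₀ hx), transition_extChartAt (h₀ hx')] at h
    rw [(extChartAt (𝓡 n) x₁).injOn (h₁ hx) (h₁ hx') h]

variable [SecondCountableTopology M] [Nonempty M]

theorem riemannianVolume_apply {x₀ : M} {A : Set M} (hA : MeasurableSet A)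
    (hAs : A ⊆ (extChartAt (𝓡 n) x₀).source) :
    riemannianVolume n A = chartVolume (n := n) x₀ A := by
  set D := disjointed (fun j ↦ (chartAt (EuclideanSpace ℝ (Fin n)) (chartCenter n M j)).source)
  have hD : ∀ i, MeasurableSet (D i) := fun i ↦
    MeasurableSet.disjointed (fun j ↦ (chartAt _ _).open_source.measurableSet) i
  have hDu : ⋃ i, D i = univ := by rw [iUnion_disjointed, iUnion_chartCenter_source]
  rw [riemannianVolume, Measure.sum_apply _ hA]
  have h1 : ∀ i, ((chartVolume (n := n) (chartCenter n M i)).restrict (D i)) A =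
      chartVolume (n := n) x₀ (A ∩ D i) := fun i ↦ by
    rw [Measure.restrict_apply hA]
    refine chartVolume_eq (hA.inter (hD i)) (fun x hx ↦ ?_) fun x hx ↦ hAs hx.1
    rw [extChartAt_source]
    exact disjointed_subset _ i hx.2
  change ∑' i, ((chartVolume (n := n) (chartCenter n M i)).restrict (D i)) A = _
  simp_rw [h1]
  rw [← measure_iUnion (fun i j hij ↦ ((disjoint_disjointed _ hij).mono inter_subset_right
    inter_subset_right)) (fun i ↦ hA.inter (hD i)), ← inter_iUnion, hDu, inter_univ]

theorem riemannianVolume_restrict_source (x₀ : M) :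
    (riemannianVolume n).restrict (extChartAt (𝓡 n) x₀).source = chartVolume (n := n) x₀ := by
  have hs := measurableSet_extChartAt_source (n := n) x₀
  ext A hA
  rw [Measure.restrict_apply hA, riemannianVolume_apply (hA.inter hs) inter_subset_right,
    measure_inter_conull' (measure_mono_null (fun x hx ↦ hx.2) (chartVolume_compl_source x₀))]

end Volume

/-! ### Fibre Gaussians as measures on the tangent bundle -/

section Kernel

variable [IsManifold (𝓡 n) ∞ M]

theorem continuous_fibre (x : M) :
    Continuous fun u : TangentSpace (𝓡 n) x ↦ (⟨x, u⟩ : TangentBundle (𝓡 n) M) :=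
  FiberBundle.continuous_totalSpaceMk (Coord n) (TangentSpace (𝓡 n) : M → Type _) x

variable [RiemannianBundle (fun x : M ↦ TangentSpace (𝓡 n) x)]

/-- The Gaussian distribution of the tangent space at `x`, as a measure on the tangent bundle. -/
def fibreGaussian (x : M) : Measure (TangentBundle (𝓡 n) M) :=
  (tangentGaussian x).map fun u ↦ ⟨x, u⟩

theorem fibreGaussian_apply (x : M) {B : Set (TangentBundle (𝓡 n) M)} (hB : MeasurableSet B) :
    fibreGaussian x B = tangentGaussian x {u | (⟨x, u⟩ : TangentBundle (𝓡 n) M) ∈ B} :=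
  Measure.map_apply (continuous_fibre x).measurable hB

instance isProbabilityMeasure_tangentGaussian (x : M) :
    IsProbabilityMeasure (tangentGaussian (n := n) x) :=
  isProbabilityMeasure_stdGaussian

instance isProbabilityMeasure_fibreGaussian (x : M) :
    IsProbabilityMeasure (fibreGaussian (n := n) x) :=
  Measure.isProbabilityMeasure_map (continuous_fibre x).measurable.aemeasurable

theorem fibreGaussian_chart {x₀ x : M} (hx : x ∈ (extChartAt (𝓡 n) x₀).source)
    {B : Set (TangentBundle (𝓡 n) M)} (hB : MeasurableSet B) (hBs : B ⊆ (phaseChart x₀).source) :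
    fibreGaussian x B = ∫⁻ w, (phaseChart x₀ '' B).indicator (fibreDensity x₀)
      (extChartAt (𝓡 n) x₀ x, w) := by
  have hI : MeasurableSet (phaseChart x₀ '' B) := (phaseChart x₀).measurableSet_image hB hBs
  have hIx : MeasurableSet {w | (extChartAt (𝓡 n) x₀ x, w) ∈ phaseChart x₀ '' B} :=
    hI.preimage measurable_prodMk_left
  have h1 : {u : TangentSpace (𝓡 n) x | (⟨x, u⟩ : TangentBundle (𝓡 n) M) ∈ B} =
      ofTangent x₀ x ⁻¹' {w | (extChartAt (𝓡 n) x₀ x, w) ∈ phaseChart x₀ '' B} := by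
    ext u
    have hu : (⟨x, u⟩ : TangentBundle (𝓡 n) M) ∈ (phaseChart x₀).source :=
      mem_phaseChart_source.2 hx
    simp only [mem_ofPred_eq, mem_preimage]
    rw [← phaseChart_mk]
    exact ((phaseChart x₀).injOn.mem_image_iff hBs hu).symm
  rw [fibreGaussian_apply x hB, h1, tangentGaussian_preimage hx hIx, ← lintegral_indicator hIx]
  rfl

variable [IsContMDiffRiemannianBundle (𝓡 n) ∞ (EuclideanSpace ℝ (Fin n))
      (fun x : M ↦ TangentSpace (𝓡 n) x)]

theorem continuousOn_fibreDensity (x₀ : M) :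
    ContinuousOn (fibreDensity (n := n) x₀) (phaseChart (n := n) x₀).target := by
  rw [phaseChart_target]
  refine ENNReal.continuous_ofReal.comp_continuousOn (continuousOn_const.mul (ContinuousOn.mul
    (Real.continuous_sqrt.comp_continuousOn ((continuousOn_det_metricMatrix x₀).comp
      continuousOn_fst fun z hz ↦ hz.1)) (Real.continuous_exp.comp_continuousOn
        ((contDiffOn_form (contDiffOn_metricMatrix x₀)).continuousOn.neg.div_const 2))))

theorem measurable_indicator_fibreDensity {x₀ : M} {B : Set (Coord n × Coord n)}
    (hB : MeasurableSet B) (hBs : B ⊆ (phaseChart (n := n) x₀).target) :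
    Measurable (B.indicator (fibreDensity (n := n) x₀)) := by
  classical
  rw [← piecewise_eq_indicator]
  exact ((continuousOn_fibreDensity x₀).mono hBs).measurable_piecewise continuousOn_const hB

end Kernel

end GeodesicWalk

namespace GeodesicWalk

variable {n : ℕ} {M : Type*}

/-! ### The phase measure and its density -/

section PhaseMeasure

variable [TopologicalSpace M] [ChartedSpace (EuclideanSpace ℝ (Fin n)) M]
  [IsManifold (𝓡 n) ∞ M] [RiemannianBundle (fun x : M ↦ TangentSpace (𝓡 n) x)]

theorem fibreGaussian_eq_zero {x : M} {B : Set (TangentBundle (𝓡 n) M)} (hB : MeasurableSet B)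
    (h : ∀ p ∈ B, p.1 ≠ x) : fibreGaussian x B = 0 := by
  rw [fibreGaussian_apply x hB]
  convert measure_empty (μ := tangentGaussian (n := n) x)
  exact eq_empty_of_forall_notMem fun u hu ↦ h _ hu rfl

variable [IsContMDiffRiemannianBundle (𝓡 n) ∞ (EuclideanSpace ℝ (Fin n))
      (fun x : M ↦ TangentSpace (𝓡 n) x)] [MeasurableSpace M] [BorelSpace M]

theorem measurable_fibreGaussian_of_subset {x₀ : M} {B : Set (TangentBundle (𝓡 n) M)}
    (hB : MeasurableSet B) (hBs : B ⊆ (phaseChart x₀).source) :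
    Measurable fun x ↦ fibreGaussian x B := by
  classical
  have hs := measurableSet_extChartAt_source (n := n) x₀
  have hI : MeasurableSet (phaseChart x₀ '' B) := (phaseChart x₀).measurableSet_image hB hBs
  have hIs : phaseChart x₀ '' B ⊆ (phaseChart x₀).target :=
    image_subset_iff.2 fun p hp ↦ (phaseChart x₀).map_source (hBs hp)
  have hh : Measurable fun y ↦ ∫⁻ w, (phaseChart x₀ '' B).indicator (fibreDensity x₀) (y, w) :=
    (measurable_indicator_fibreDensity hI hIs).lintegral_prod_right'
  -- The value `0` off the chart domain is immaterial: no vector of `B` lies over such points, and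
  -- the indicator removes them.
  have hφ : Measurable ((extChartAt (𝓡 n) x₀).source.piecewise (extChartAt (𝓡 n) x₀) fun _ ↦ 0) :=
    (continuousOn_extChartAt (I := 𝓡 n) x₀).measurable_piecewise continuousOn_const hs
  convert (hh.comp hφ).indicator hs using 1
  funext x
  by_cases hx : x ∈ (extChartAt (𝓡 n) x₀).source
  · rw [indicator_of_mem hx, fibreGaussian_chart hx hB hBs, Function.comp_apply,
      piecewise_eq_of_mem _ _ _ hx]
  · rw [indicator_of_notMem hx, fibreGaussian_eq_zero hB]
    rintro p hp rfl
    exact hx (mem_phaseChart_source.1 (hBs hp))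

variable [SecondCountableTopology M] [Nonempty M]

theorem measurable_fibreGaussian : Measurable (fibreGaussian (n := n) (M := M)) := by
  refine Measure.measurable_of_measurable_coe _ fun B hB ↦ ?_
  set D := disjointed (fun j ↦ (chartAt (EuclideanSpace ℝ (Fin n)) (chartCenter n M j)).source)
  have hD : ∀ i, MeasurableSet (D i) := fun i ↦
    MeasurableSet.disjointed (fun j ↦ (chartAt _ _).open_source.measurableSet) i
  have hDu : ⋃ i, D i = univ := by rw [iUnion_disjointed, iUnion_chartCenter_source]
  have hDs : ∀ i, D i ⊆ (chartAt (EuclideanSpace ℝ (Fin n)) (chartCenter n M i)).source :=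
    disjointed_subset _
  have hBD : ∀ i, MeasurableSet (B ∩ (fun p : TangentBundle (𝓡 n) M ↦ p.1) ⁻¹' D i) := fun i ↦
    hB.inter (continuous_base.measurable (hD i))
  have h1 : ∀ x, fibreGaussian x B =
      ∑' i, fibreGaussian x (B ∩ (fun p : TangentBundle (𝓡 n) M ↦ p.1) ⁻¹' D i) := fun x ↦ by
    rw [← measure_iUnion (fun i j hij ↦ (((disjoint_disjointed _ hij).preimage _).mono
      inter_subset_right inter_subset_right)) hBD, ← inter_iUnion, ← preimage_iUnion, hDu,
      preimage_univ, inter_univ]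
  simp_rw [h1]
  refine Measurable.tsum fun i ↦ measurable_fibreGaussian_of_subset
    (x₀ := chartCenter n M i) (hBD i) fun p hp ↦ mem_phaseChart_source.2 ?_
  rw [extChartAt_source]
  exact hDs i hp.2

variable (n M) in
/-- The Gaussian distributions of the tangent spaces, as a kernel to the tangent bundle. -/
def fibreKernel : Kernel M (TangentBundle (𝓡 n) M) := ⟨fibreGaussian, measurable_fibreGaussian⟩

instance isMarkovKernel_fibreKernel : IsMarkovKernel (fibreKernel n M) :=
  ⟨fun x ↦ isProbabilityMeasure_fibreGaussian x⟩

variable (n M) in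
/-- The measure on the tangent bundle composed of the Riemannian volume and the Gaussian
distributions of the tangent spaces. -/
def phaseMeasure : Measure (TangentBundle (𝓡 n) M) :=
  (riemannianVolume n).bind (fibreKernel n M)

theorem phaseMeasure_apply {A : Set (TangentBundle (𝓡 n) M)} (hA : MeasurableSet A) :
    phaseMeasure n M A = ∫⁻ x, fibreGaussian x A ∂riemannianVolume n :=
  Measure.bind_apply hA (fibreKernel n M).aemeasurable

theorem phaseMeasure_inter_preimage {A : Set (TangentBundle (𝓡 n) M)} (hA : MeasurableSet A)
    {B : Set M} (hB : MeasurableSet B) :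
    phaseMeasure n M ((fun p ↦ p.1) ⁻¹' B ∩ A) =
      ∫⁻ x in B, fibreGaussian x A ∂riemannianVolume n := by
  have hB' : MeasurableSet ((fun p : TangentBundle (𝓡 n) M ↦ p.1) ⁻¹' B) :=
    continuous_base.measurable hB
  rw [phaseMeasure_apply (hB'.inter hA), ← lintegral_indicator hB]
  refine lintegral_congr fun x ↦ ?_
  by_cases hx : x ∈ B
  · rw [indicator_of_mem hx, fibreGaussian_apply x (hB'.inter hA), fibreGaussian_apply x hA]
    congr 1
    ext u
    exact ⟨fun h ↦ h.2, fun h ↦ ⟨hx, h⟩⟩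
  · rw [indicator_of_notMem hx, fibreGaussian_eq_zero (hB'.inter hA)]
    rintro p hp rfl
    exact hx hp.1

/-- Fubini in the chart: the volume and the fibre Gaussian each contribute a factor `√(det g)`, and
the product is the density for which the continuity equation holds. -/
theorem phaseMeasure_chart (x₀ : M) {A : Set (TangentBundle (𝓡 n) M)} (hA : MeasurableSet A)
    (hAs : A ⊆ (phaseChart x₀).source) : phaseMeasure n M A = ∫⁻ z in phaseChart x₀ '' A,
      ENNReal.ofReal (density (metricMatrix x₀) (gaussianConst n) z) := by
  have hs := measurableSet_extChartAt_source (n := n) x₀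
  have ht := measurableSet_extChartAt_target (n := n) x₀
  have hI : MeasurableSet (phaseChart x₀ '' A) := (phaseChart x₀).measurableSet_image hA hAs
  have hIs : phaseChart x₀ '' A ⊆ (phaseChart x₀).target :=
    image_subset_iff.2 fun p hp ↦ (phaseChart x₀).map_source (hAs hp)
  have hA' : (fun p : TangentBundle (𝓡 n) M ↦ p.1) ⁻¹' (extChartAt (𝓡 n) x₀).source ∩ A = A :=
    inter_eq_right.2 fun p hp ↦ mem_phaseChart_source.1 (hAs hp)
  have hdens : ∀ z ∈ (phaseChart (n := n) x₀).target,
      ENNReal.ofReal (Real.sqrt (metricMatrix x₀ z.1).det) * fibreDensity x₀ z =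
        ENNReal.ofReal (density (metricMatrix x₀) (gaussianConst n) z) := by
    intro z hz
    have := (det_metricMatrix_pos (mem_phaseChart_target.1 hz)).le
    rw [fibreDensity, ← ENNReal.ofReal_mul (Real.sqrt_nonneg _), density]
    congr 1
    linear_combination (gaussianConst n * Real.exp (-(form (metricMatrix x₀ z.1) z.2 z.2) / 2)) *
      Real.mul_self_sqrt this
  have hind : ∀ z, ENNReal.ofReal (Real.sqrt (metricMatrix x₀ z.1).det) *
      (phaseChart x₀ '' A).indicator (fibreDensity x₀) z = (phaseChart x₀ '' A).indicator
        (fun z ↦ ENNReal.ofReal (density (metricMatrix x₀) (gaussianConst n) z)) z := by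
    intro z
    by_cases hz : z ∈ phaseChart x₀ '' A
    · rw [indicator_of_mem hz, indicator_of_mem hz]
      exact hdens _ (hIs hz)
    · rw [indicator_of_notMem hz, indicator_of_notMem hz, mul_zero]
  have hmeas : Measurable ((phaseChart x₀ '' A).indicator fun z ↦
      ENNReal.ofReal (density (metricMatrix x₀) (gaussianConst n) z)) := by
    classical
    rw [← piecewise_eq_indicator]
    refine ContinuousOn.measurable_piecewise (fun z hz ↦ ?_) continuousOn_const hI
    have hz' := hIs hz
    rw [phaseChart_target] at hz'
    exact (ENNReal.continuous_ofReal.continuousAt.comp (differentiableAt_density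
      (isOpen_extChartAt_target (I := 𝓡 n) x₀) (contDiffOn_metricMatrix x₀)
      (gaussianConst n) hz').continuousAt).continuousWithinAt
  rw [← hA', phaseMeasure_inter_preimage hA hs, riemannianVolume_restrict_source, hA',
    lintegral_chartVolume x₀ (measurable_fibreGaussian_of_subset hA hAs)
      (continuousOn_det_metricMatrix x₀), ← lintegral_indicator hI, Measure.volume_eq_prod,
    lintegral_prod _ hmeas.aemeasurable, ← lintegral_indicator ht]
  refine lintegral_congr fun y ↦ ?_
  by_cases hy : y ∈ (extChartAt (𝓡 n) x₀).target
  · rw [indicator_of_mem hy, fibreGaussian_chart ((extChartAt (𝓡 n) x₀).map_target hy) hA hAs,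
      (extChartAt (𝓡 n) x₀).right_inv hy, ← lintegral_const_mul' _ _ ENNReal.ofReal_ne_top]
    exact lintegral_congr fun w ↦ hind (y, w)
  · rw [indicator_of_notMem hy]
    refine (lintegral_eq_zero_of_ae_eq_zero (Eventually.of_forall fun w ↦ ?_)).symm
    exact indicator_of_notMem (fun hw ↦ hy (mem_phaseChart_target.1 (hIs hw))) _

/-- Fibre by fibre, this is the symmetry of a centred Gaussian. -/
theorem measurePreserving_dilate_neg :
    MeasurePreserving (dilate (n := n) (M := M) (-1)) (phaseMeasure n M) (phaseMeasure n M) := by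
  refine ⟨(continuous_dilate (-1)).measurable, ?_⟩
  ext A hA
  rw [Measure.map_apply (continuous_dilate (-1)).measurable hA, phaseMeasure_apply hA,
    phaseMeasure_apply ((continuous_dilate (-1)).measurable hA)]
  refine lintegral_congr fun x ↦ ?_
  have hA' : MeasurableSet {u : TangentSpace (𝓡 n) x | (⟨x, u⟩ : TangentBundle (𝓡 n) M) ∈ A} :=
    (continuous_fibre x).measurable hA
  rw [fibreGaussian_apply x hA, fibreGaussian_apply x ((continuous_dilate (-1)).measurable hA),
    ← tangentGaussian_neg x, Measure.map_apply measurable_neg hA', tangentGaussian_neg x]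
  congr 1
  ext u
  simp [dilate]

end PhaseMeasure

/-! ### Invariance under the geodesic flow and detailed balance -/

section Flow

variable [MetricSpace M] [ChartedSpace (EuclideanSpace ℝ (Fin n)) M] [IsManifold (𝓡 n) ∞ M]
  [RiemannianBundle (fun x : M ↦ TangentSpace (𝓡 n) x)]
  [IsContMDiffRiemannianBundle (𝓡 n) ∞ (EuclideanSpace ℝ (Fin n))
      (fun x : M ↦ TangentSpace (𝓡 n) x)]
  [IsRiemannianManifold (𝓡 n) M] [CompleteSpace M]

theorem continuous_geodesicFlow (t : ℝ) : Continuous (geodesicFlow n M t) :=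
  FieldAtlas.continuous_flow (complete_geodesicAtlas n M) t

variable (n M) in
/-- The geodesic flow followed by the reversal of velocities. -/
def reversedFlow (t : ℝ) (p : TangentBundle (𝓡 n) M) : TangentBundle (𝓡 n) M :=
  dilate (-1) (geodesicFlow n M t p)

/-- Reversing the velocity conjugates the flow at time `t` to the flow at time `-t`, so the second
passage retraces the geodesic. -/
theorem reversedFlow_reversedFlow (t : ℝ) (p : TangentBundle (𝓡 n) M) :
    reversedFlow n M t (reversedFlow n M t p) = p := by
  rw [reversedFlow, reversedFlow, geodesicFlow_dilate, neg_one_mul]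
  have h1 : geodesicFlow n M (-t) (geodesicFlow n M t p) = p :=
    FieldAtlas.flow_neg_flow (complete_geodesicAtlas n M) t p
  rw [h1]
  exact congrArg (TotalSpace.mk p.1)
    ((neg_one_smul ℝ _).trans (by rw [neg_one_smul, neg_neg]) : (-1 : ℝ) • (-1 : ℝ) • p.2 = p.2)

variable [SecondCountableTopology M] [MeasurableSpace M] [BorelSpace M] [Nonempty M]

theorem measurePreserving_geodesicFlow (t : ℝ) :
    MeasurePreserving (geodesicFlow n M t) (phaseMeasure n M) (phaseMeasure n M) := by
  have : (volume : Measure (Coord n × Coord n)).IsAddHaarMeasure := by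
    rw [Measure.volume_eq_prod]
    infer_instance
  refine FieldAtlas.measurePreserving_flow (complete_geodesicAtlas n M) volume
    (ρ := fun x₀ ↦ density (metricMatrix x₀) (gaussianConst n))
    (fun x₀ A hA hAs ↦ phaseMeasure_chart x₀ hA hAs) (fun x₀ z hz ↦ ?_) (fun x₀ z hz ↦ ?_)
    (fun x₀ z hz ↦ ?_) t
  · have := det_metricMatrix_pos (mem_phaseChart_target.1 hz)
    exact mul_nonneg (gaussianConst_pos n).le (mul_nonneg this.le (Real.exp_pos _).le)
  · exact differentiableAt_density (isOpen_extChartAt_target (I := 𝓡 n) x₀)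
      (contDiffOn_metricMatrix x₀) _ ((phaseChart_target x₀).subset hz)
  · exact density_continuity_equation (isOpen_extChartAt_target (I := 𝓡 n) x₀)
      (contDiffOn_metricMatrix x₀) (fun y hy ↦ (det_metricMatrix_pos hy).ne')
      (metricMatrix_isSymm x₀) _ ((phaseChart_target x₀).subset hz)

theorem measurePreserving_reversedFlow (t : ℝ) :
    MeasurePreserving (reversedFlow n M t) (phaseMeasure n M) (phaseMeasure n M) :=
  measurePreserving_dilate_neg.comp (measurePreserving_geodesicFlow t)

/-- Detailed balance for the unrestricted walk. -/
theorem lintegral_fibreGaussian_symm (t : ℝ) {A B : Set M} (hA : MeasurableSet A)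
    (hB : MeasurableSet B) :
    ∫⁻ x in A, fibreGaussian x {p | (geodesicFlow n M t p).1 ∈ B} ∂riemannianVolume n =
      ∫⁻ x in B, fibreGaussian x {p | (geodesicFlow n M t p).1 ∈ A} ∂riemannianVolume n := by
  have hm : ∀ {C : Set M}, MeasurableSet C →
      MeasurableSet {p : TangentBundle (𝓡 n) M | (geodesicFlow n M t p).1 ∈ C} := fun hC ↦
    (continuous_base.comp (continuous_geodesicFlow t)).measurable hC
  -- Both sides become phase measures of sets of pairs (start, end), and the reversed flow pulls one
  -- set back to the other.
  rw [← phaseMeasure_inter_preimage (hm hB) hA, ← phaseMeasure_inter_preimage (hm hA) hB,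
    ← (measurePreserving_reversedFlow t).measure_preimage
      ((continuous_base.measurable hB).inter (hm hA)).nullMeasurableSet]
  congr 1
  ext p
  have h0 := congrArg TotalSpace.proj (reversedFlow_reversedFlow t p)
  have h1 : (geodesicFlow n M t (reversedFlow n M t p)).1 = p.1 := h0
  simp only [mem_inter_iff, mem_preimage, mem_ofPred_eq, h1]
  exact and_comm

end Flow

end GeodesicWalk

/-! ### Uniqueness of invariant probability measures -/

/-- A Markov kernel all of whose transition probabilities dominate a fixed non-zero measure has at
most one invariant probability measure. -/
theorem ProbabilityTheory.Kernel.Invariant.eq_of_absolutelyContinuous {α : Type*}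
    [MeasurableSpace α] {P : Kernel α α} [IsMarkovKernel P] {ν : Measure α} (hν : ν ≠ 0)
    (hac : ∀ x, ν ≪ P x) {μ₁ μ₂ : Measure α} [IsProbabilityMeasure μ₁] [IsProbabilityMeasure μ₂]
    (h₁ : P.Invariant μ₁) (h₂ : P.Invariant μ₂) : μ₁ = μ₂ := by
  obtain ⟨S, hS, hle₁, hle₂⟩ := hahn_decomposition μ₁ μ₂
  -- The minimum of the two measures: by the Hahn decomposition `μ₂ ≤ μ₁` on `S` and `μ₁ ≤ μ₂` on
  -- the complement.
  set lam := μ₂.restrict S + μ₁.restrict Sᶜ with hlam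
  have hlamA : ∀ A, MeasurableSet A → lam A = μ₂ (A ∩ S) + μ₁ (A ∩ Sᶜ) := fun A hA ↦ by
    rw [hlam, Measure.add_apply, Measure.restrict_apply hA, Measure.restrict_apply hA]
  have hsplit : ∀ (μ : Measure α) (A : Set α), μ A = μ (A ∩ S) + μ (A ∩ Sᶜ) := fun μ A ↦
    (measure_inter_add_sdiff A hS).symm
  have hl₁ : lam ≤ μ₁ := Measure.le_iff.2 fun A hA ↦ by
    rw [hlamA A hA, hsplit μ₁ A]
    exact add_le_add_left (hle₁ _ (hA.inter hS) inter_subset_right) _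
  have hl₂ : lam ≤ μ₂ := Measure.le_iff.2 fun A hA ↦ by
    rw [hlamA A hA, hsplit μ₂ A]
    exact add_le_add_right (hle₂ _ (hA.inter hS.compl) inter_subset_right) _
  have hbind : ∀ μ : Measure α, P.Invariant μ → lam ≤ μ →
      (μ - lam).bind P + lam.bind P = μ := fun μ hμ hl ↦ by
    rw [← Measure.comp_add, Measure.sub_add_cancel_of_le hl]
    exact hμ
  have hb₁ : lam.bind P ≤ μ₁ := (Measure.le_add_left le_rfl).trans (hbind μ₁ h₁ hl₁).le
  have hb₂ : lam.bind P ≤ μ₂ := (Measure.le_add_left le_rfl).trans (hbind μ₂ h₂ hl₂).le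
  have hfin : IsFiniteMeasure (lam.bind P) := isFiniteMeasure_of_le μ₁ hb₁
  -- The image of `lam` lies below both invariant measures, hence below their minimum; a Markov
  -- kernel preserves total mass, so equality holds.
  have hinv : lam.bind P = lam := by
    refine Measure.eq_of_le_of_measure_univ_eq (Measure.le_iff.2 fun A hA ↦ ?_)
      Measure.comp_apply_univ
    rw [hlamA A hA, hsplit (lam.bind P) A]
    exact add_le_add (hb₂ _) (hb₁ _)
  -- The remainder `μ - lam` is invariant. If it annihilates `N`, then `P x N = 0` for almost every
  -- `x`; as it is non-zero such an `x` exists, and `ν ≪ P x` yields `ν N = 0`.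
  have key : ∀ μ : Measure α, P.Invariant μ → lam ≤ μ → μ - lam ≠ 0 → ν ≪ μ - lam := by
    intro μ hμ hl hne
    have hρ : (μ - lam).bind P = μ - lam := by
      have := hbind μ hμ hl
      rw [hinv] at this
      conv_rhs => rw [← this]
      exact (Measure.add_sub_cancel).symm
    refine Measure.AbsolutelyContinuous.mk fun N hN h0 ↦ ?_
    rw [← hρ, Measure.bind_apply hN (Kernel.aemeasurable _),
      lintegral_eq_zero_iff (Kernel.measurable_coe P hN)] at h0
    have : (ae (μ - lam)).NeBot := ae_neBot.2 hne
    obtain ⟨x, hx⟩ := h0.exists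
    exact hac x hx
  have hnull : ∀ (μ : Measure α) (A : Set α), lam ≤ μ → lam A = μ A → (μ - lam) A = 0 := by
    intro μ A hl hA
    have := congrArg (fun m : Measure α ↦ m A) (Measure.sub_add_cancel_of_le hl)
    simp only [Measure.add_apply, ← hA] at this
    exact (ENNReal.add_left_inj (measure_ne_top lam A)).1 (this.trans (zero_add _).symm)
  by_cases hρ₁ : μ₁ - lam = 0
  · have : μ₁ ≤ μ₂ := by
      rw [← Measure.sub_add_cancel_of_le hl₁, hρ₁, zero_add]
      exact hl₂
    exact Measure.eq_of_le_of_isProbabilityMeasure this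
  by_cases hρ₂ : μ₂ - lam = 0
  · have : μ₂ ≤ μ₁ := by
      rw [← Measure.sub_add_cancel_of_le hl₂, hρ₂, zero_add]
      exact hl₁
    exact (Measure.eq_of_le_of_isProbabilityMeasure this).symm
  -- The remainders are concentrated on `S` and on its complement respectively. If both dominate
  -- `ν`, then `ν` vanishes on both sets.
  refine absurd ?_ hν
  rw [← Measure.measure_univ_eq_zero, hsplit, univ_inter, univ_inter,
    key μ₁ h₁ hl₁ hρ₁ (hnull μ₁ Sᶜ hl₁ (by rw [hlamA _ hS.compl]; simp)),
    key μ₂ h₂ hl₂ hρ₂ (hnull μ₂ S hl₂ (by rw [hlamA _ hS]; simp)), add_zero]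

/-! ### The walk in `K`: kernel, reversibility and absolute continuity -/

namespace GeodesicWalk

variable {n : ℕ} {M : Type*} [MetricSpace M] [ChartedSpace (EuclideanSpace ℝ (Fin n)) M]
  [IsManifold (𝓡 n) ∞ M] [RiemannianBundle (fun x : M ↦ TangentSpace (𝓡 n) x)]
  [IsContMDiffRiemannianBundle (𝓡 n) ∞ (EuclideanSpace ℝ (Fin n))
      (fun x : M ↦ TangentSpace (𝓡 n) x)]
  [IsRiemannianManifold (𝓡 n) M] [CompleteSpace M]

theorem continuous_expMap_smul (δ : ℝ) (x : M) :
    Continuous fun u : TangentSpace (𝓡 n) x ↦ expMap x (δ • u) := by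
  simp_rw [expMap_smul]
  exact continuous_base.comp ((continuous_geodesicFlow δ).comp (continuous_fibre x))

variable [MeasurableSpace M] [BorelSpace M]

theorem measurable_walkUpdate (δ : ℝ) {K : Set M} (hK : MeasurableSet K) (x : K) :
    Measurable (walkUpdate (n := n) δ K x) := by
  classical
  rw [← (MeasurableEmbedding.subtype_coe hK).measurable_comp_iff]
  have hc := (continuous_expMap_smul (n := n) δ (x : M)).measurable
  convert Measurable.ite (hc hK) hc (measurable_const (a := (x : M))) using 1
  funext u
  simp only [Function.comp_apply, walkUpdate]
  by_cases h : expMap (x : M) (δ • u) ∈ K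
  · rw [dif_pos h]
    exact (if_pos h).symm
  · rw [dif_neg h]
    exact (if_neg h).symm

theorem measurableSet_flow_mem (t : ℝ) {B : Set M} (hB : MeasurableSet B) :
    MeasurableSet {p : TangentBundle (𝓡 n) M | (geodesicFlow n M t p).1 ∈ B} :=
  (continuous_base.comp (continuous_geodesicFlow t)).measurable hB

/-- Accepted moves give the first term; rejected moves end at `x` and count only when `x ∈ B`.
Expressing both through the flow on `M` makes measurability and symmetry in `x` accessible. -/
theorem oneStep_apply (δ : ℝ) {K : Set M} (hK : MeasurableSet K) (x : K) {B : Set K}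
    (hB : MeasurableSet B) : oneStep n δ K x B =
      fibreGaussian (x : M) {p | (geodesicFlow n M δ p).1 ∈ ((↑) '' B : Set M)} +
        ((↑) '' B : Set M).indicator
          (fun y ↦ fibreGaussian y {p | (geodesicFlow n M δ p).1 ∈ Kᶜ}) (x : M) := by
  have hB' : MeasurableSet ((↑) '' B : Set M) := hK.subtype_image hB
  have hm : ∀ {C : Set M}, MeasurableSet C →
      MeasurableSet {u : TangentSpace (𝓡 n) (x : M) | expMap (x : M) (δ • u) ∈ C} := fun hC ↦
    (continuous_expMap_smul δ (x : M)).measurable hC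
  have hG : ∀ {C : Set M}, MeasurableSet C →
      fibreGaussian (x : M) {p | (geodesicFlow n M δ p).1 ∈ C} =
        tangentGaussian (n := n) (x : M) {u | expMap (x : M) (δ • u) ∈ C} := fun hC ↦ by
    rw [fibreGaussian_apply _ (measurableSet_flow_mem δ hC)]
    simp only [expMap_smul]
    rfl
  have hmem : ∀ u : TangentSpace (𝓡 n) (x : M), walkUpdate δ K x u ∈ B ↔
      expMap (x : M) (δ • u) ∈ ((↑) '' B : Set M) ∨ (expMap (x : M) (δ • u) ∈ Kᶜ ∧ x ∈ B) := by
    intro u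
    by_cases h : expMap (x : M) (δ • u) ∈ K
    · rw [walkUpdate, dif_pos h]
      constructor
      · exact fun h' ↦ Or.inl ⟨_, h', rfl⟩
      · rintro (⟨y, hy, hyx⟩ | h')
        · have : y = ⟨expMap (x : M) (δ • u), h⟩ := Subtype.ext hyx
          rwa [← this]
        · exact absurd h h'.1
    · rw [walkUpdate, dif_neg h]
      constructor
      · exact fun h' ↦ Or.inr ⟨h, h'⟩
      · rintro (⟨y, hy, hyx⟩ | h')
        · exact absurd (hyx ▸ y.2) h
        · exact h'.2
  rw [oneStep, Measure.map_apply (measurable_walkUpdate δ hK x) hB, hG hB']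
  by_cases hx : x ∈ B
  · rw [indicator_of_mem (mem_image_of_mem _ hx), hG hK.compl, ← measure_union _ (hm hK.compl)]
    · congr 1
      ext u
      exact (hmem u).trans (by simp [hx])
    · rw [Set.disjoint_left]
      rintro u ⟨y, -, hy⟩ hu
      exact hu (hy ▸ y.2)
  · rw [indicator_of_notMem (by simpa using hx), add_zero]
    congr 1
    ext u
    exact (hmem u).trans (by simp [hx])

variable [SecondCountableTopology M] [Nonempty M]

theorem measurable_fibreGaussian_flow (t : ℝ) {B : Set M} (hB : MeasurableSet B) :
    Measurable fun x : M ↦ fibreGaussian x {p | (geodesicFlow n M t p).1 ∈ B} :=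
  Kernel.measurable_coe (fibreKernel n M) (measurableSet_flow_mem t hB)

variable (n) in
/-- The Markov kernel of the geodesic walk. -/
def walkKernel (δ : ℝ) {K : Set M} (hK : MeasurableSet K) : Kernel K K where
  toFun := oneStep n δ K
  measurable' := by
    refine Measure.measurable_of_measurable_coe _ fun B hB ↦ ?_
    simp_rw [oneStep_apply δ hK _ hB]
    exact ((measurable_fibreGaussian_flow δ (hK.subtype_image hB)).add
      ((measurable_fibreGaussian_flow δ hK.compl).indicator (hK.subtype_image hB))).comp
        measurable_subtype_coe

theorem walkKernel_apply (δ : ℝ) {K : Set M} (hK : MeasurableSet K) (x : K) :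
    walkKernel n δ hK x = oneStep n δ K x := rfl

instance isMarkovKernel_walkKernel (δ : ℝ) {K : Set M} (hK : MeasurableSet K) :
    IsMarkovKernel (walkKernel n δ hK) :=
  ⟨fun x ↦ Measure.isProbabilityMeasure_map (measurable_walkUpdate δ hK x).aemeasurable⟩

/-- After integration over `A`, the accepted part is symmetric by detailed balance for the flow, and
the rejected part is an integral over `B ∩ A`. -/
theorem isReversible_walkKernel (δ : ℝ) {K : Set M} (hK : MeasurableSet K) :
    (walkKernel n δ hK).IsReversible ((riemannianVolume n).comap Subtype.val) := by
  have key : ∀ {A B : Set K}, MeasurableSet A → MeasurableSet B →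
      ∫⁻ x in A, walkKernel n δ hK x B ∂((riemannianVolume n).comap Subtype.val) =
        ∫⁻ x in ((↑) '' A : Set M), fibreGaussian x
          {p | (geodesicFlow n M δ p).1 ∈ ((↑) '' B : Set M)} ∂riemannianVolume n +
        ∫⁻ x in ((↑) '' B ∩ (↑) '' A : Set M),
          fibreGaussian x {p | (geodesicFlow n M δ p).1 ∈ Kᶜ} ∂riemannianVolume n := by
    intro A B hA hB
    have hB' : MeasurableSet ((↑) '' B : Set M) := hK.subtype_image hB
    simp_rw [walkKernel_apply, oneStep_apply δ hK _ hB]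
    rw [setLIntegral_subtype hK A fun x ↦ fibreGaussian x
      {p | (geodesicFlow n M δ p).1 ∈ ((↑) '' B : Set M)} + ((↑) '' B : Set M).indicator
        (fun y ↦ fibreGaussian y {p | (geodesicFlow n M δ p).1 ∈ Kᶜ}) x,
      lintegral_add_left (measurable_fibreGaussian_flow δ hB'), setLIntegral_indicator hB']
  intro A B hA hB
  rw [key hA hB, key hB hA, inter_comm, lintegral_fibreGaussian_symm δ (hK.subtype_image hA)
    (hK.subtype_image hB)]

/-- Let `E` be `u ↦ exp_x (δ u)` in coordinates of the fibre. Then `E ⁻¹' N` is Lebesgue null, `E`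
maps it onto `N` by convexity, and differentiable maps preserve null sets. Neither injectivity nor
regularity of the exponential map plays a role. -/
theorem riemannianVolume_eq_zero {δ : ℝ} (hδ : δ ≠ 0) {K : Set M} (hK : GeodesicallyConvex n K)
    {x : M} (hx : x ∈ K) {N : Set M} (hN : MeasurableSet N) (hNK : N ⊆ K)
    (h0 : fibreGaussian x {p | (geodesicFlow n M δ p).1 ∈ N} = 0) : riemannianVolume n N = 0 := by
  set φ := extChartAt (𝓡 n) x
  have hxs : x ∈ φ.source := mem_extChartAt_source (I := 𝓡 n) x
  have htar : ∀ w, (φ x, w) ∈ (phaseChart (n := n) x).target := fun w ↦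
    mem_phaseChart_target.2 (φ.map_source hxs)
  have hsymm : Continuous fun w : Coord n ↦ (phaseChart (n := n) x).symm (φ x, w) :=
    (phaseChart (n := n) x).continuousOn_symm.comp_continuous (by fun_prop) htar
  set E : Coord n → M := fun w ↦ (geodesicFlow n M δ ((phaseChart x).symm (φ x, w))).1
  have hE : Continuous E := continuous_base.comp ((continuous_geodesicFlow δ).comp hsymm)
  have hfib : ∀ u : TangentSpace (𝓡 n) x, (phaseChart x).symm (φ x, ofTangent x x u) = ⟨x, u⟩ :=
    fun u ↦ (phaseChart x).left_inv (x := ⟨x, u⟩) (mem_phaseChart_source.2 hxs)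
  have hW : volume (E ⁻¹' N) = 0 := by
    have h1 : {u : TangentSpace (𝓡 n) x |
        (⟨x, u⟩ : TangentBundle (𝓡 n) M) ∈ {p | (geodesicFlow n M δ p).1 ∈ N}} =
        ofTangent x x ⁻¹' (E ⁻¹' N) := by
      ext u
      simp only [mem_preimage, mem_ofPred_eq, E, hfib]
    rw [fibreGaussian_apply x (measurableSet_flow_mem δ hN), h1,
      tangentGaussian_preimage hxs (hE.measurable hN)] at h0
    have hm : Measurable fun w ↦ fibreDensity x (φ x, w) :=
      ((continuousOn_fibreDensity x).comp_continuous (by fun_prop) htar).measurable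
    rw [lintegral_eq_zero_iff hm] at h0
    -- The Gaussian density is nowhere zero, so a vanishing integral forces the domain of
    -- integration to be null.
    have h2 : ∀ᵐ w ∂(volume : Measure (Coord n)).restrict (E ⁻¹' N), False := by
      filter_upwards [h0] with w hw using fibreDensity_ne_zero (htar w) hw
    simpa [ae_iff] using h2
  have hsub : N ⊆ ⋃ i, N ∩ (extChartAt (𝓡 n) (chartCenter n M i)).source := fun y hy ↦ by
    have : y ∈ ⋃ i, (chartAt (EuclideanSpace ℝ (Fin n)) (chartCenter n M i)).source := by
      rw [iUnion_chartCenter_source]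
      trivial
    obtain ⟨i, hi⟩ := mem_iUnion.1 this
    exact mem_iUnion.2 ⟨i, hy, by rwa [extChartAt_source]⟩
  refine measure_mono_null hsub (measure_iUnion_null fun i ↦ ?_)
  set c := chartCenter n M i
  have hNc : MeasurableSet (N ∩ (extChartAt (𝓡 n) c).source) :=
    hN.inter (measurableSet_extChartAt_source c)
  rw [riemannianVolume_apply hNc inter_subset_right, chartVolume_apply hNc inter_subset_right
    (continuousOn_det_metricMatrix c)]
  refine setLIntegral_measure_zero _ _ ?_
  have himg : extChartAt (𝓡 n) c '' (N ∩ (extChartAt (𝓡 n) c).source) ⊆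
      (fun w ↦ extChartAt (𝓡 n) c (E w)) '' (E ⁻¹' (N ∩ (extChartAt (𝓡 n) c).source)) := by
    rintro _ ⟨y, hy, rfl⟩
    obtain ⟨v, hv⟩ := exists_expMap_eq hK hx (hNK hy.1)
    -- `E` runs the flow for time `δ`, so the initial velocity of the joining geodesic is rescaled
    -- by `δ⁻¹`.
    have hEy : E (ofTangent x x (δ⁻¹ • v)) = y := by
      simp only [E, hfib]
      rw [← expMap_smul, smul_inv_smul₀ hδ, hv]
    refine ⟨ofTangent x x (δ⁻¹ • v), ?_, ?_⟩
    · rw [mem_preimage, hEy]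
      exact hy
    · simp only [hEy]
  refine measure_mono_null himg (addHaar_image_eq_zero_of_differentiableOn_of_addHaar_eq_zero
    volume (fun w hw ↦ ?_) (measure_mono_null (preimage_mono inter_subset_left) hW))
  have hd := (FieldAtlas.isDiffAt_flow (complete_geodesicAtlas n M) δ
    ((phaseChart x).symm (φ x, w))).2 x c ((phaseChart x).map_target (htar w))
    (mem_phaseChart_source.2 hw.2)
  have hval : (geodesicAtlas n M).chart x ((phaseChart x).symm (φ x, w)) = (φ x, w) :=
    (phaseChart x).right_inv (htar w)
  rw [hval] at hd
  have hd2 : DifferentiableAt ℝ (fun w : Coord n ↦ (φ x, w)) w := by fun_prop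
  exact (differentiableAt_fst.comp w (hd.comp w hd2)).differentiableWithinAt

theorem absolutelyContinuous_walkKernel {δ : ℝ} (hδ : δ ≠ 0) {K : Set M} (hK : MeasurableSet K)
    (hconv : GeodesicallyConvex n K) (x : K) :
    (riemannianVolume n).comap Subtype.val ≪ walkKernel n δ hK x := by
  refine Measure.AbsolutelyContinuous.mk fun N hN h0 ↦ ?_
  rw [walkKernel_apply, oneStep_apply δ hK x hN, add_eq_zero] at h0
  rw [comap_subtype_coe_apply hK]
  exact riemannianVolume_eq_zero hδ hconv x.2 (hK.subtype_image hN)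
    (Subtype.coe_image_subset _ _) h0.1

end GeodesicWalk

theorem mainTheorem10 {n : ℕ} {M : Type*} [MetricSpace M]
    [ChartedSpace (EuclideanSpace ℝ (Fin n)) M] [IsManifold (𝓡 n) ∞ M]
    [RiemannianBundle (fun x : M ↦ TangentSpace (𝓡 n) x)]
    [IsContMDiffRiemannianBundle (𝓡 n) ∞ (EuclideanSpace ℝ (Fin n))
      (fun x : M ↦ TangentSpace (𝓡 n) x)]
    [IsRiemannianManifold (𝓡 n) M] [CompleteSpace M] [ConnectedSpace M]
    [SecondCountableTopology M] [MeasurableSpace M] [BorelSpace M]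
    (δ : ℝ) (hδ : 0 < δ) (K : Set M) (hK : MeasurableSet K) :
    ∃ P : Kernel K K, IsMarkovKernel P ∧ (∀ x : K, P x = GeodesicWalk.oneStep n δ K x) ∧
      P.IsReversible ((GeodesicWalk.riemannianVolume n).comap Subtype.val) ∧
      (GeodesicWalk.GeodesicallyConvex n K → GeodesicWalk.riemannianVolume n K ≠ 0 →
        GeodesicWalk.riemannianVolume n K ≠ ⊤ →
          IsProbabilityMeasure (GeodesicWalk.uniformDistribution n K) ∧
          P.Invariant (GeodesicWalk.uniformDistribution n K) ∧
          ∀ μ : Measure K, IsProbabilityMeasure μ → P.Invariant μ →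
            μ = GeodesicWalk.uniformDistribution n K) := by
  have hrev := GeodesicWalk.isReversible_walkKernel (n := n) δ hK
  refine ⟨GeodesicWalk.walkKernel n δ hK, inferInstance, fun x ↦ rfl, hrev,
    fun hconv h0 htop ↦ ?_⟩
  have huniv : (GeodesicWalk.riemannianVolume n).comap (Subtype.val : K → M) univ =
      GeodesicWalk.riemannianVolume n K := by
    rw [comap_subtype_coe_apply hK, image_univ, Subtype.range_coe]
  have hprob : IsProbabilityMeasure (GeodesicWalk.uniformDistribution n K) := ⟨by
    rw [GeodesicWalk.uniformDistribution, Measure.smul_apply, huniv, smul_eq_mul,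
      ENNReal.inv_mul_cancel h0 htop]⟩
  have hinv : (GeodesicWalk.walkKernel n δ hK).Invariant
      (GeodesicWalk.uniformDistribution n K) := by
    rw [Kernel.Invariant, GeodesicWalk.uniformDistribution, Measure.comp_smul]
    exact congrArg _ hrev.invariant
  -- The dominated measure is the volume on `K`, which is non-zero because its total mass is
  -- `Vol(K)`.
  refine ⟨hprob, hinv, fun μ hμ hμinv ↦ hμinv.eq_of_absolutelyContinuous
    (ν := (GeodesicWalk.riemannianVolume n).comap (Subtype.val : K → M)) (fun h ↦ h0 ?_)
    (GeodesicWalk.absolutelyContinuous_walkKernel hδ.ne' hK hconv) hinv⟩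
  rw [← huniv, h]
  rfl
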